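/- Conventions. Manifolds are smooth, Hausdorff, second countable and without boundary. For a manifold $W$ with a closed $2$-form $\omega$, a *connection with curvature $\omega$* on a smooth principal $S^1$-bundle $\pi:P\to W$ is a smooth $S^1$-invariant $1$-form $\alpha$ on $P$ with $d\alpha=\pi^*\omega$ which takes the value $1$ on the velocity of the orbits $t\mapsto e^{2\pi i t}\cdot p$ (the circle has length $1$). If $\omega$ is symplectic, $(P,\pi,\alpha)$ is then called a *Boothby–Wang manifold* $\mathbb S(W)$ of $(W,\omega)$; equivalently, $P$ is the unit circle bundle of a Hermitian line bundle $L_\omega\to W$ with a unitary connection whose curvature is, in this normalization, $\omega$. Its contact structure is $\ker\alpha$. **Theorem.** Let $(W_1,\omega_1)$, $(W_2,\omega_2)$ be symplectic manifolds with Boothby–Wang manifolds $(\mathbb S(W_1),\pi_1,\alpha_1)$ and $(\mathbb S(W_2),\pi_2,\alpha_2)$, the unit circle bundles of line bundles $L_1$ and $L_2$. Let $a,b$ be coprime integers, and consider the circle action $$\theta\cdot(p,q)=(a\theta\cdot p,\,-b\theta\cdot q)$$ on $\mathbb S(W_1)\times\mathbb S(W_2)$, with orbit space $Q$ (with the quotient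 topology) and projection $\rho:\mathbb S(W_1)\times\mathbb S(W_2)\to Q$. Write $\omega=b\,\mathrm{pr}_1^*\omega_1+a\,\mathrm{pr}_2^*\omega_2$ on $W_1\times W_2$; it is symplectic if $a\neq0$ and $b\neq 0$. Then: 1. $Q$ is a manifold of dimension $\dim W_1+\dim W_2+1$, such that $\rho$ is a smooth submersion. 2. $Q$, with the projection $[p,q]\mapsto(\pi_1(p),\pi_2(q))$ and the circle action for which $[z\cdot p,w\cdot q]=z^bw^a\cdot[p,q]$ for all $z,w\in S^1$, is a principal circle bundle over $W_1\times W_2$, namely a unit circle bundle of the line bundle $\mathrm{pr}_1^*L_1^{\otimes b}\otimes \mathrm{pr}_2^*L_2^{\otimes a}$. There is a connection $\alpha$ on it with curvature $\omega$ such that $\rho^*\alpha=b\,\mathrm{pr}_1^*\alpha_1+a\,\mathrm{pr}_2^*\alpha_2$. If $\omega$ is symplectic, $\alpha$ is a contact form, so that $(Q,\alpha)$ is a Boothby–Wang manifold of $(W_1\times W_2,\omega)$. 3. Let $S\to W_1\times W_2$ be any unit circle bundle of $\mathrm{pr}_1^*L_1^{\otimes b}\otimes \mathrm{pr}_2^*L_2^{\otimes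 a}$. Then $Q$ is diffeomorphic to $S$. If moreover $W_1$ and $W_2$ are compact and $\omega$ is symplectic, then for every connection $\alpha_S$ on $S$ with curvature $\omega$, that is, for every Boothby–Wang manifold $\mathbb S_{(b,a)}(W_1\times W_2)=(S,\ker\alpha_S)$ of $(W_1\times W_2,\omega)$ on this bundle, $(Q,\ker\alpha)$ is contactomorphic to $(S,\ker\alpha_S)$. -/

import Mathlib

open Set Topology Manifold
open scoped ContDiff

noncomputable section

/-! ### Differential forms on manifolds without boundary -/

section Forms

variable {E : Type*} [NormedAddCommGroup E] [NormedSpace ℝ E]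
  {H : Type*} [TopologicalSpace H] (I : ModelWithCorners ℝ E H)
  {E' : Type*} [NormedAddCommGroup E'] [NormedSpace ℝ E']
  {H' : Type*} [TopologicalSpace H'] (I' : ModelWithCorners ℝ E' H')
  (M : Type*) [TopologicalSpace M] [ChartedSpace H M]
  {N : Type*} [TopologicalSpace N] [ChartedSpace H' N]

/-- A (not necessarily smooth) real differential form of degree `k` on `M`: an alternating
`k`-linear form on each tangent space. -/
abbrev DiffForm (k : ℕ) : Type _ :=
  (x : M) → (TangentSpace I x) [⋀^Fin k]→L[ℝ] ℝ

namespace DiffForm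

variable {I I' M} {k : ℕ}

/-- The pullback `f^* η` of a form along a map `f : M → N`. -/
def pullback (I : ModelWithCorners ℝ E H) {I' : ModelWithCorners ℝ E' H'}
    (f : M → N) (η : DiffForm I' N k) : DiffForm I M k :=
  fun x => (η (f x)).compContinuousLinearMap (mfderiv I I' f x)

/-- The coordinate expression of a form in the preferred chart at `x₀` (a form on the model
vector space, meaningful on the target of the chart). -/
def inChart (η : DiffForm I M k) (x₀ : M) : E → E [⋀^Fin k]→L[ℝ] ℝ :=
  fun y => (η ((extChartAt I x₀).symm y)).compContinuousLinearMap
    (mfderiv 𝓘(ℝ, E) I (extChartAt I x₀).symm y)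

/-- A form is smooth when all its coordinate expressions are. -/
def IsSmooth (η : DiffForm I M k) : Prop :=
  ∀ x₀ : M, ContDiffOn ℝ ∞ (η.inChart x₀) (extChartAt I x₀).target

/-- The exterior derivative, computed at each point `x` in the preferred chart at `x`. -/
def d (η : DiffForm I M k) : DiffForm I M (k + 1) :=
  fun x => (extDeriv (η.inChart x) (extChartAt I x x)).compContinuousLinearMap
    (mfderiv I 𝓘(ℝ, E) (extChartAt I x) x)

/-- A symplectic form: a smooth, closed, nondegenerate form of degree two. -/
structure IsSymplectic (η : DiffForm I M 2) : Prop where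
  smooth : η.IsSmooth
  closed : η.d = 0
  nondegenerate : ∀ (x : M) (v : TangentSpace I x),
    (∀ w : TangentSpace I x, η x ![v, w] = 0) → v = 0

/-- A contact form: a smooth, nowhere vanishing form `α` of degree one such that `dα` is
nondegenerate on the hyperplane field `ker α`. -/
structure IsContactForm (α : DiffForm I M 1) : Prop where
  smooth : α.IsSmooth
  ne_zero : ∀ x : M, α x ≠ 0
  nondegenerate : ∀ (x : M) (v : TangentSpace I x), α x ![v] = 0 →
    (∀ w : TangentSpace I x, α x ![w] = 0 → α.d x ![v, w] = 0) → v = 0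

/-- The manifolds `M` and `N`, with the hyperplane fields `ker α` and `ker β`, are
contactomorphic: some diffeomorphism carries the first hyperplane field to the second. -/
def Contactomorphic (α : DiffForm I M 1) (β : DiffForm I' N 1) : Prop :=
  ∃ Φ : M ≃ₘ^∞⟮I, I'⟯ N, ∀ (x : M) (v : TangentSpace I x),
    β (Φ x) ![mfderiv I I' Φ x v] = 0 ↔ α x ![v] = 0

/-- The form `b π₁^* ω₁ + a π₂^* ω₂` on a product. -/
def weightedSum (b a : ℤ) (ω₁ : DiffForm I M k) (ω₂ : DiffForm I' N k) :
    DiffForm (I.prod I') (M × N) k :=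
  fun x => (b : ℝ) • pullback (I.prod I') Prod.fst ω₁ x
    + (a : ℝ) • pullback (I.prod I') Prod.snd ω₂ x

end DiffForm

end Forms

/-! ### Circle bundles and Boothby–Wang manifolds -/

section CircleBundles

variable {E : Type*} [NormedAddCommGroup E] [NormedSpace ℝ E]
  {H : Type*} [TopologicalSpace H] (I : ModelWithCorners ℝ E H)
  {F : Type*} [NormedAddCommGroup F] [NormedSpace ℝ F]
  {G : Type*} [TopologicalSpace G] (J : ModelWithCorners ℝ F G)
  {W : Type*} [TopologicalSpace W] [ChartedSpace H W]
  {P : Type*} [TopologicalSpace P] [ChartedSpace G P] [MulAction Circle P]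

/-- `π : P → W` is a smooth principal circle bundle: the circle acts smoothly on `P`, and `π`
has smooth equivariant local trivializations over a neighbourhood of every point. (These are
exactly the unit circle bundles of Hermitian line bundles.) -/
structure IsPrincipalCircleBundle (π : P → W) : Prop where
  smooth_smul : ContMDiff ((𝓡 1).prod J) J ∞ (fun q : Circle × P => q.1 • q.2)
  locally_trivial : ∀ w : W, ∃ e : Bundle.Trivialization Circle π, w ∈ e.baseSet ∧
    ContMDiffOn J (I.prod (𝓡 1)) ∞ e e.source ∧
    ContMDiffOn (I.prod (𝓡 1)) J ∞ e.toOpenPartialHomeomorph.symm e.target ∧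
    ∀ p : P, π p ∈ e.baseSet → ∀ z : Circle,
      π (z • p) = π p ∧ (e (z • p)).2 = z * (e p).2

/-- `π : P → W` is a principal circle bundle and `α` is (the real-valued form of) a principal
connection on it with curvature `η`. The circle has length one: `α` takes the value `1` on the
velocity of the orbits `t ↦ exp (2 π i t) • p`. -/
structure IsCircleConnection (π : P → W) (α : DiffForm J P 1) (η : DiffForm I W 2) : Prop where
  bundle : IsPrincipalCircleBundle I J π
  smooth : α.IsSmooth
  invariant : ∀ z : Circle, DiffForm.pullback J (fun p : P => z • p) α = α
  normalized : ∀ (p : P) (t : ℝ), α (Circle.exp (2 * Real.pi * t) • p)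
    ![mfderiv 𝓘(ℝ, ℝ) J (fun s : ℝ => Circle.exp (2 * Real.pi * s) • p) t (1 : ℝ)] = 1
  curvature : α.d = DiffForm.pullback J π η

/-- `P`, with the projection `π` and the contact structure `ker α`, is a Boothby–Wang manifold of
the symplectic manifold `(W, η)`. -/
structure IsBoothbyWang (π : P → W) (α : DiffForm J P 1) (η : DiffForm I W 2) : Prop where
  symplectic : η.IsSymplectic
  connection : IsCircleConnection I J π α η

end CircleBundles

section Weights

variable {E₁ : Type*} [NormedAddCommGroup E₁] [NormedSpace ℝ E₁]
  {H₁ : Type*} [TopologicalSpace H₁] (I₁ : ModelWithCorners ℝ E₁ H₁)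
  {E₂ : Type*} [NormedAddCommGroup E₂] [NormedSpace ℝ E₂]
  {H₂ : Type*} [TopologicalSpace H₂] (I₂ : ModelWithCorners ℝ E₂ H₂)
  {F₁ : Type*} [NormedAddCommGroup F₁] [NormedSpace ℝ F₁]
  {G₁ : Type*} [TopologicalSpace G₁] (J₁ : ModelWithCorners ℝ F₁ G₁)
  {F₂ : Type*} [NormedAddCommGroup F₂] [NormedSpace ℝ F₂]
  {G₂ : Type*} [TopologicalSpace G₂] (J₂ : ModelWithCorners ℝ F₂ G₂)
  {F : Type*} [NormedAddCommGroup F] [NormedSpace ℝ F]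
  {G : Type*} [TopologicalSpace G] (J : ModelWithCorners ℝ F G)
  {W₁ : Type*} [TopologicalSpace W₁] [ChartedSpace H₁ W₁]
  {W₂ : Type*} [TopologicalSpace W₂] [ChartedSpace H₂ W₂]
  {P₁ : Type*} [TopologicalSpace P₁] [ChartedSpace G₁ P₁] [MulAction Circle P₁]
  {P₂ : Type*} [TopologicalSpace P₂] [ChartedSpace G₂ P₂] [MulAction Circle P₂]
  {S : Type*} [TopologicalSpace S] [ChartedSpace G S] [MulAction Circle S]

/-- If `P₁` and `P₂` are the unit circle bundles of `L₁ → W₁` and `L₂ → W₂`, then the circle bundle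
`S → W₁ × W₂` is that of the line bundle `L₁^b ⊗ L₂^a` (pulled back to the product): over an open
cover of `W₁ × W₂` by products `U x ×ˢ V y` it has sections `σ x y` whose transition functions are
`g₁ ^ b * g₂ ^ a`, where `g₁` and `g₂` are the transition functions of unit sections `s₁ x` of `L₁`
over `U x` and `s₂ y` of `L₂` over `V y`. -/
def IsTensorCircleBundle (b a : ℤ) (π₁ : P₁ → W₁) (π₂ : P₂ → W₂) (π : S → W₁ × W₂) : Prop :=
  ∃ (U : W₁ → Set W₁) (V : W₂ → Set W₂) (s₁ : W₁ → W₁ → P₁) (s₂ : W₂ → W₂ → P₂)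
    (σ : W₁ → W₂ → W₁ × W₂ → S),
    (∀ x, IsOpen (U x) ∧ x ∈ U x ∧ ContMDiffOn I₁ J₁ ∞ (s₁ x) (U x) ∧
      ∀ u ∈ U x, π₁ (s₁ x u) = u) ∧
    (∀ y, IsOpen (V y) ∧ y ∈ V y ∧ ContMDiffOn I₂ J₂ ∞ (s₂ y) (V y) ∧
      ∀ v ∈ V y, π₂ (s₂ y v) = v) ∧
    (∀ x y, ContMDiffOn (I₁.prod I₂) J ∞ (σ x y) (U x ×ˢ V y) ∧
      ∀ w ∈ U x ×ˢ V y, π (σ x y w) = w) ∧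
    ∀ x x' y y', ∀ u ∈ U x ∩ U x', ∀ v ∈ V y ∩ V y', ∀ g₁ g₂ : Circle,
      s₁ x' u = g₁ • s₁ x u → s₂ y' v = g₂ • s₂ y v →
        σ x' y' (u, v) = (g₁ ^ b * g₂ ^ a) • σ x y (u, v)

/-- The circle action `θ · (p, q) = (aθ · p, -bθ · q)` on `P₁ × P₂`, written multiplicatively. -/
@[reducible] def weightedAction (a b : ℤ) (P₁ P₂ : Type*) [MulAction Circle P₁]
    [MulAction Circle P₂] : MulAction Circle (P₁ × P₂) where
  smul z x := (z ^ a • x.1, z ^ (-b) • x.2)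
  one_smul x := by
    change ((1 : Circle) ^ a • x.1, (1 : Circle) ^ (-b) • x.2) = x
    simp
  mul_smul z w x := by
    change ((z * w) ^ a • x.1, (z * w) ^ (-b) • x.2)
      = (z ^ a • w ^ a • x.1, z ^ (-b) • w ^ (-b) • x.2)
    rw [mul_zpow, mul_zpow, mul_smul, mul_smul]

/-- The space of orbits of `weightedAction a b`. -/
def OrbitSpace (a b : ℤ) (P₁ P₂ : Type*) [MulAction Circle P₁] [MulAction Circle P₂] : Type _ :=
  Quotient (@MulAction.orbitRel Circle (P₁ × P₂) _ (weightedAction a b P₁ P₂))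

/-- The projection of `P₁ × P₂` to the space of orbits. -/
def OrbitSpace.mk (a b : ℤ) {P₁ P₂ : Type*} [MulAction Circle P₁] [MulAction Circle P₂]
    (x : P₁ × P₂) : OrbitSpace a b P₁ P₂ :=
  Quotient.mk (@MulAction.orbitRel Circle (P₁ × P₂) _ (weightedAction a b P₁ P₂)) x

/-- The quotient topology on the space of orbits. -/
instance OrbitSpace.instTopologicalSpace (a b : ℤ) (P₁ P₂ : Type*) [MulAction Circle P₁]
    [MulAction Circle P₂] [TopologicalSpace P₁] [TopologicalSpace P₂] :
    TopologicalSpace (OrbitSpace a b P₁ P₂) :=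
  inferInstanceAs (TopologicalSpace
    (Quotient (@MulAction.orbitRel Circle (P₁ × P₂) _ (weightedAction a b P₁ P₂))))

end Weights

end

/-! The homomorphism `(z, w) ↦ z ^ b * w ^ a` from the torus to the circle has as kernel the circle
of the pairs `(θ ^ a, θ ^ (-b))`, and a Bézout relation `m * b + n * a = 1` splits it by `ζ ↦ (ζ ^
m, ζ ^ n)`. Explicitly, for `ζ = z ^ b * w ^ a` the pair `(ζ ^ m, ζ ^ n)` is `(z, w)` moved by `θ =
w ^ m * z ^ (-n)` (`zpow_mul_zpow_pow_eq`, `zpow_mul_zpow_pow_eq'`). Over a product of trivializing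
open sets an orbit is therefore determined by its base point and the coordinate `ζ`, and the
splitting provides smooth local sections of the quotient map. These coordinates are glued to a
manifold structure (`OrbitSpace.exists_manifold_structure`). The identity `mk (z • p, w • q) = (z ^
b * w ^ a) • mk (p, q)` makes the images of pairs of sections into sections with transition
functions `g₁ ^ b * g₂ ^ a`; a bundle with this cocycle is unique up to equivariant diffeomorphism
(`IsOrbitBundle.exists_equivariant_diffeomorph`).

Moving a pair of maps along the weighted orbits by `exp (2 π i σ)` changes the pullback of `b α₁ + a
α₂` by `(-b a + a b) dσ = 0`, so this form descends to a form `α` on the orbit space. Its value on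
the fundamental vector is `b m + a n = 1`; invariance and curvature can be checked after pulling
back along the quotient map, which is a submersion (`IsOrbitBundle.isCircleConnection`).

For the comparison of contact structures, let `Φ` be the equivariant diffeomorphism to `S` and `β =
Φ^* αS - α`. Equal curvatures make `β` closed, and equal normalizations make it vanish on the
fundamental vector field `R`, which is the Reeb field of `α`. As `α ⊗ α + dα` is nondegenerate,
there is a unique field `v` with `α(v) α + dα(v, ·) = β`; evaluation on `R` gives `α(v) = 0`, whence
`dα(v, ·) = β` and `β(v) = 0`. By Cartan's formula the flow of `v` satisfies `F_s^* α = α + s β` and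
`F_s^* β = β`, so `F_{-1}` pulls `α + β` back to `α` (`DiffForm.IsContactForm.exists_diffeomorph`).
A single autonomous field suffices because everything is linear in `s`.

Compactness makes the flow global. Its smoothness comes from the implicit function theorem, applied
to the integral equation on a Banach space of curves (`ContDiff.exists_local_flow`). -/

noncomputable section

set_option linter.unusedSectionVars false

/-! ### Smooth dependence of pulled back alternating forms -/

section AlternatingSmooth

variable {E F G X : Type*} [NormedAddCommGroup E] [NormedSpace ℝ E]
  [NormedAddCommGroup F] [NormedSpace ℝ F] [NormedAddCommGroup G] [NormedSpace ℝ G]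
  [NormedAddCommGroup X] [NormedSpace ℝ X]

/-- Alternatization as a continuous linear map. -/
def ContinuousMultilinearMap.alternatizationL (k : ℕ) :
    ContinuousMultilinearMap ℝ (fun _ : Fin k => E) G →L[ℝ] E [⋀^Fin k]→L[ℝ] G :=
  LinearMap.mkContinuous
    { toFun := fun f => ContinuousMultilinearMap.alternatization f
      map_add' := map_add _
      map_smul' := fun c f => by
        ext v
        simp only [ContinuousMultilinearMap.alternatization_apply_apply,
          smul_apply, RingHom.id_apply,
          ContinuousAlternatingMap.smul_apply, Finset.smul_sum]
        exact Finset.sum_congr rfl fun σ _ => smul_comm _ _ _ }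
    (Fintype.card (Equiv.Perm (Fin k))) (fun f => by
      refine ContinuousAlternatingMap.opNorm_le_bound _ (by positivity) fun v => ?_
      simp only [LinearMap.coe_mk, AddHom.coe_mk,
        ContinuousMultilinearMap.alternatization_apply_apply]
      refine (norm_sum_le _ _).trans ?_
      rw [mul_assoc, Fintype.card, ← nsmul_eq_mul]
      refine Finset.sum_le_card_nsmul _ _ _ fun σ _ => ?_
      have h1 : ‖Equiv.Perm.sign σ • f (v ∘ σ)‖ = ‖f (v ∘ σ)‖ := by
        rcases Int.units_eq_one_or (Equiv.Perm.sign σ) with h | h <;> simp [h]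
      rw [h1]
      refine (f.le_opNorm _).trans_eq ?_
      rw [← Equiv.prod_comp σ (fun i => ‖v i‖)]
      rfl)

/-- As a multilinear map the composite is smooth, since it depends on the linear maps through a
continuous multilinear map. Alternatization multiplies an alternating map by `k!`, so alternatizing
and dividing by `k!` returns to alternating maps by a continuous linear map. -/
theorem ContDiffAt.continuousAlternatingMap_compContinuousLinearMap {k : ℕ} {n : WithTop ℕ∞}
    {f : X → F [⋀^Fin k]→L[ℝ] G} {g : X → E →L[ℝ] F} {x : X}
    (hf : ContDiffAt ℝ n f x) (hg : ContDiffAt ℝ n g x) :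
    ContDiffAt ℝ n (fun y => (f y).compContinuousLinearMap (g y)) x := by
  have h1 : ContDiffAt ℝ n (fun y =>
      ContinuousMultilinearMap.compContinuousLinearMapContinuousMultilinear ℝ
        (fun _ : Fin k => E) (fun _ : Fin k => F) G (fun _ => g y)) x :=
    (ContinuousMultilinearMap.contDiff _).contDiffAt.comp x (contDiffAt_pi.2 fun _ => hg)
  have h2 : ContDiffAt ℝ n (fun y =>
      ContinuousAlternatingMap.toContinuousMultilinearMapCLM ℝ (f y)) x :=
    (ContinuousLinearMap.contDiff _).contDiffAt.comp x hf
  have h3 := (ContinuousMultilinearMap.alternatizationL (E := E) (G := G) k).contDiff.contDiffAt.comp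
    x (h1.clm_apply h2)
  have h4 := h3.const_smul ((Nat.factorial k : ℝ)⁻¹)
  refine h4.congr_of_eventuallyEq (Filter.Eventually.of_forall fun y => ?_)
  ext v
  have := congrArg (fun A => A v) (AlternatingMap.coe_alternatization
    ((f y).compContinuousLinearMap (g y)).toAlternatingMap)
  simp only [MultilinearMap.alternatization_apply] at this
  simp only [Function.comp_apply, ContinuousAlternatingMap.smul_apply,
    ContinuousMultilinearMap.alternatizationL, LinearMap.mkContinuous_apply, LinearMap.coe_mk,
    AddHom.coe_mk, ContinuousMultilinearMap.alternatization_apply_apply]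
  have hk : (Nat.factorial k : ℝ) ≠ 0 := by positivity
  rw [eq_inv_smul_iff₀ hk]
  simp only [Fintype.card_fin] at this
  simpa [Nat.cast_smul_eq_nsmul, Function.comp_def] using this.symm

end AlternatingSmooth

/-! ### Pullback, smoothness and exterior derivative in charts -/

section FormCalculus

variable {E : Type*} [NormedAddCommGroup E] [NormedSpace ℝ E]
  {H : Type*} [TopologicalSpace H] {I : ModelWithCorners ℝ E H}
  {E' : Type*} [NormedAddCommGroup E'] [NormedSpace ℝ E']
  {H' : Type*} [TopologicalSpace H'] {I' : ModelWithCorners ℝ E' H'}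
  {E'' : Type*} [NormedAddCommGroup E''] [NormedSpace ℝ E'']
  {H'' : Type*} [TopologicalSpace H''] {I'' : ModelWithCorners ℝ E'' H''}
  {M : Type*} [TopologicalSpace M] [ChartedSpace H M]
  {N : Type*} [TopologicalSpace N] [ChartedSpace H' N]
  {O : Type*} [TopologicalSpace O] [ChartedSpace H'' O]

/-- The derivative of a map, as a linear map between the model vector spaces. -/
def mfderivModel (I : ModelWithCorners ℝ E H) (I' : ModelWithCorners ℝ E' H') (f : M → N) (x : M) :
    E →L[ℝ] E' :=
  mfderiv I I' f x

/-- Keeping `y` apart from `f x` lets the chain rule apply when the two points agree only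
propositionally. The model spaces do not depend on the points, so nothing has to be transported. -/
theorem mfderivModel_comp {f : M → N} {g : N → O} {x : M} {y : N} (hf : MDifferentiableAt I I' f x)
    (hg : MDifferentiableAt I' I'' g y) (h : f x = y) :
    mfderivModel I I'' (g ∘ f) x = (mfderivModel I' I'' g y).comp (mfderivModel I I' f x) := by
  subst h
  exact mfderiv_comp x hg hf

theorem mfderivModel_congr {f g : M → N} {x : M} (h : f =ᶠ[𝓝 x] g) :
    mfderivModel I I' f x = mfderivModel I I' g x :=
  h.mfderiv_eq

theorem mfderivModel_id (x : M) : mfderivModel I I id x = ContinuousLinearMap.id ℝ E :=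
  mfderiv_id

theorem mfderivModel_const (x : M) (y : N) : mfderivModel I I' (fun _ => y) x = 0 :=
  mfderiv_const

namespace DiffForm

variable {k : ℕ}

/-- A form, with values in the alternating forms on the model vector space. -/
def toModel (η : DiffForm I M k) (x : M) : E [⋀^Fin k]→L[ℝ] ℝ := η x

theorem apply_congr (η : DiffForm I M k) {x y : M} (h : x = y) (v : Fin k → E) :
    η.toModel x v = η.toModel y v := by
  subst h; rfl

theorem pullback_apply (f : M → N) (η : DiffForm I' N k) (x : M)
    (v : Fin k → TangentSpace I x) :
    pullback I f η x v = η (f x) (fun i => mfderiv I I' f x (v i)) := rfl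

theorem pullback_comp {f : M → N} {g : N → O} (η : DiffForm I'' O k) {x : M}
    (hf : MDifferentiableAt I I' f x) (hg : MDifferentiableAt I' I'' g (f x)) :
    pullback I (g ∘ f) η x = pullback I f (pullback I' g η) x := by
  ext v
  rw [pullback_apply, mfderiv_comp x hg hf]
  rfl

theorem pullback_congr {f g : M → N} (η : DiffForm I' N k) {x : M} (h : f =ᶠ[𝓝 x] g) :
    pullback I f η x = pullback I g η x := by
  ext v
  rw [pullback_apply, pullback_apply, h.mfderiv_eq]
  exact apply_congr η h.eq_of_nhds _

theorem pullback_id (η : DiffForm I M k) (x : M) : pullback I (id : M → M) η x = η x := by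
  ext v
  rw [pullback_apply, mfderiv_id]
  rfl

theorem pullback_congr_form {f : M → N} {η θ : DiffForm I' N k} {x : M} (h : η (f x) = θ (f x)) :
    pullback I f η x = pullback I f θ x := by
  unfold pullback
  rw [h]

/-- Pulling back along a map with surjective differential is injective. -/
theorem eq_of_pullback_eq {f : M → N} {η θ : DiffForm I' N k} {x : M}
    (hf : Function.Surjective (mfderiv I I' f x))
    (h : pullback I f η x = pullback I f θ x) : η (f x) = θ (f x) := by
  ext v
  choose w hw using hf
  have := congrArg (fun A => A (fun i => w (v i))) h
  simpa [pullback_apply, hw] using this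

/-- The coordinate expression is the pullback along the inverse of the chart. -/
theorem inChart_eq_pullback (η : DiffForm I M k) (x₀ : M) :
    η.inChart x₀ = pullback 𝓘(ℝ, E) (extChartAt I x₀).symm η := rfl

theorem inChart_self (η : DiffForm 𝓘(ℝ, E) E k) (x₀ : E) : η.inChart x₀ = η := by
  rw [inChart_eq_pullback]
  funext y
  have : ((extChartAt 𝓘(ℝ, E) x₀).symm : E → E) = id := by
    rw [extChartAt_model_space_eq_id]; rfl
  rw [pullback_congr η (Filter.Eventually.of_forall (fun z => congrFun this z))]
  exact pullback_id η y

theorem d_self (η : DiffForm 𝓘(ℝ, E) E k) : η.d = extDeriv (show E → E [⋀^Fin k]→L[ℝ] ℝ from η) := by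
  funext x
  unfold d
  rw [inChart_self]
  have : (extChartAt 𝓘(ℝ, E) x : E → E) = id := by
    rw [extChartAt_model_space_eq_id]; rfl
  rw [this, mfderiv_id]
  rfl

/-- Smoothness of a form at a point, in the preferred chart at that point. -/
def SmoothAt (η : DiffForm I M k) (x : M) : Prop :=
  ContDiffAt ℝ ∞ (η.inChart x) (extChartAt I x x)

variable [I.Boundaryless] [I'.Boundaryless] [I''.Boundaryless]
variable [IsManifold I ∞ M] [IsManifold I' ∞ N] [IsManifold I'' ∞ O]

theorem mdifferentiableAt_extChartAt_symm (x₀ : M) {z : E} (hz : z ∈ (extChartAt I x₀).target) :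
    MDifferentiableAt 𝓘(ℝ, E) I (extChartAt I x₀).symm z :=
  ((contMDiffOn_extChartAt_symm (n := ∞) x₀).contMDiffAt
    ((isOpen_extChartAt_target x₀).mem_nhds hz)).mdifferentiableAt (by simp)

omit [I.Boundaryless] [I'.Boundaryless] in
-- Smoothness of order `∞` at a point gives a neighbourhood for each finite order, possibly
-- shrinking with the order. Order one persists nearby, which is enough for the chain rule.
theorem eventually_contMDiffAt_one {f : M → N} {x : M} (hf : ContMDiffAt I I' ∞ f x) :
    ∀ᶠ x' in 𝓝 x, ContMDiffAt I I' 1 f x' := by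
  have := IsManifold.of_le (I := I) (M := M) (n := ∞) (m := 1) (by simp)
  have := IsManifold.of_le (I := I') (M := N) (n := ∞) (m := 1) (by simp)
  obtain ⟨u, hu, hfu⟩ := (contMDiffAt_iff_contMDiffOn_nhds (n := 1) (by simp)).1
    (hf.of_le (by simp))
  obtain ⟨v, hvu, hv, hxv⟩ := mem_nhds_iff.1 hu
  filter_upwards [hv.mem_nhds hxv] with y hy
  exact (hfu y (hvu hy)).contMDiffAt (Filter.mem_of_superset (hv.mem_nhds hy) hvu)

/-- The coordinate expression of a pullback. -/
theorem pullback_inChart_eventuallyEq {f : M → N} (η : DiffForm I' N k) {x x₀ : M} {y₀ : N}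
    (hf : ContMDiffAt I I' ∞ f x) (hx : x ∈ (extChartAt I x₀).source)
    (hy : f x ∈ (extChartAt I' y₀).source) :
    (pullback I f η).inChart x₀ =ᶠ[𝓝 (extChartAt I x₀ x)] fun z =>
      (η.inChart y₀ ((extChartAt I' y₀ ∘ f ∘ (extChartAt I x₀).symm) z)).compContinuousLinearMap
        (fderiv ℝ (extChartAt I' y₀ ∘ f ∘ (extChartAt I x₀).symm) z) := by
  have hz0 : extChartAt I x₀ x ∈ (extChartAt I x₀).target := (extChartAt I x₀).map_source hx
  have hcont : ContinuousAt (extChartAt I x₀).symm (extChartAt I x₀ x) :=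
    continuousAt_extChartAt_symm'' hz0
  have hinv : (extChartAt I x₀).symm (extChartAt I x₀ x) = x := (extChartAt I x₀).left_inv hx
  have h1 : ∀ᶠ x' in 𝓝 x, ContMDiffAt I I' 1 f x' :=
    eventually_contMDiffAt_one hf
  have h2 : ∀ᶠ x' in 𝓝 x, f x' ∈ (extChartAt I' y₀).source :=
    hf.continuousAt.eventually_mem (extChartAt_source_mem_nhds' hy)
  have h12 := (h1.and h2)
  rw [← hinv] at h12
  filter_upwards [hcont.eventually h12, extChartAt_target_mem_nhds' hz0] with z hz hzt
  obtain ⟨hz1, hz2⟩ := hz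
  set ψ := (extChartAt I x₀).symm with hψ
  have hψd : MDifferentiableAt 𝓘(ℝ, E) I ψ z := mdifferentiableAt_extChartAt_symm x₀ hzt
  have hfd : MDifferentiableAt I I' f (ψ z) := hz1.mdifferentiableAt (by simp)
  have hφd : MDifferentiableAt I' 𝓘(ℝ, E') (extChartAt I' y₀) (f (ψ z)) :=
    mdifferentiableAt_extChartAt (by rwa [← extChartAt_source I'])
  have hFd : MDifferentiableAt 𝓘(ℝ, E) 𝓘(ℝ, E') (extChartAt I' y₀ ∘ f ∘ ψ) z :=
    hφd.comp z (hfd.comp z hψd)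
  have hFt : (extChartAt I' y₀ ∘ f ∘ ψ) z ∈ (extChartAt I' y₀).target :=
    (extChartAt I' y₀).map_source hz2
  -- Inserting the chart at `y₀` and its inverse turns the pullback by `f ∘ ψ` into one by a map of
  -- model spaces.
  have hev : f ∘ ψ =ᶠ[𝓝 z] (extChartAt I' y₀).symm ∘ (extChartAt I' y₀ ∘ f ∘ ψ) := by
    have hc : ContinuousAt (f ∘ ψ) z := (hfd.comp z hψd).continuousAt
    filter_upwards [hc.eventually_mem (extChartAt_source_mem_nhds' hz2)] with w hw
    exact ((extChartAt I' y₀).left_inv hw).symm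
  have e1 : pullback 𝓘(ℝ, E) (f ∘ ψ) η z = (pullback I f η).inChart x₀ z :=
    pullback_comp η hψd hfd
  have e2 : pullback 𝓘(ℝ, E) (f ∘ ψ) η z =
      pullback 𝓘(ℝ, E) ((extChartAt I' y₀).symm ∘ (extChartAt I' y₀ ∘ f ∘ ψ)) η z :=
    pullback_congr η hev
  have e3 : pullback 𝓘(ℝ, E) ((extChartAt I' y₀).symm ∘ (extChartAt I' y₀ ∘ f ∘ ψ)) η z =
      pullback 𝓘(ℝ, E) (extChartAt I' y₀ ∘ f ∘ ψ) (η.inChart y₀) z :=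
    pullback_comp η hFd (mdifferentiableAt_extChartAt_symm y₀ hFt)
  refine e1.symm.trans (e2.trans (e3.trans ?_))
  unfold pullback
  rw [mfderiv_eq_fderiv]
  rfl

theorem contDiffAt_writtenInCharts {f : M → N} {x x₀ : M} {y₀ : N}
    (hf : ContMDiffAt I I' ∞ f x) (hx : x ∈ (extChartAt I x₀).source)
    (hy : f x ∈ (extChartAt I' y₀).source) :
    ContDiffAt ℝ ∞ (extChartAt I' y₀ ∘ f ∘ (extChartAt I x₀).symm) (extChartAt I x₀ x) := by
  rw [← contMDiffAt_iff_contDiffAt]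
  have hz0 : extChartAt I x₀ x ∈ (extChartAt I x₀).target := (extChartAt I x₀).map_source hx
  have hinv : (extChartAt I x₀).symm (extChartAt I x₀ x) = x := (extChartAt I x₀).left_inv hx
  have h1 : ContMDiffAt 𝓘(ℝ, E) I ∞ (extChartAt I x₀).symm (extChartAt I x₀ x) :=
    (contMDiffOn_extChartAt_symm x₀).contMDiffAt ((isOpen_extChartAt_target x₀).mem_nhds hz0)
  have h2 : ContMDiffAt I' 𝓘(ℝ, E') ∞ (extChartAt I' y₀) (f x) :=
    contMDiffAt_extChartAt' (by rwa [← extChartAt_source I'])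
  exact (h2.comp x hf).comp_of_eq h1 hinv

theorem contDiffAt_inChart_pullback {f : M → N} (η : DiffForm I' N k) {x x₀ : M} {y₀ : N}
    (hf : ContMDiffAt I I' ∞ f x) (hx : x ∈ (extChartAt I x₀).source)
    (hy : f x ∈ (extChartAt I' y₀).source)
    (hη : ContDiffAt ℝ ∞ (η.inChart y₀) (extChartAt I' y₀ (f x))) :
    ContDiffAt ℝ ∞ ((pullback I f η).inChart x₀) (extChartAt I x₀ x) := by
  have hF := contDiffAt_writtenInCharts hf hx hy
  refine ContDiffAt.congr_of_eventuallyEq ?_ (pullback_inChart_eventuallyEq η hf hx hy)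
  refine ContDiffAt.continuousAlternatingMap_compContinuousLinearMap ?_
    (hF.fderiv_right (m := ∞) (by simp))
  refine ContDiffAt.comp (f := extChartAt I' y₀ ∘ f ∘ (extChartAt I x₀).symm) (g := η.inChart y₀)
    (extChartAt I x₀ x) ?_ hF
  simp only [Function.comp_apply]
  rwa [(extChartAt I x₀).left_inv hx]

/-- A change of charts is the coordinate expression of the identity map, so this is preservation of
smoothness under pullback along `id`. -/
theorem smoothAt_iff_inChart (η : DiffForm I M k) {x x₀ : M}
    (hx : x ∈ (extChartAt I x₀).source) :
    η.SmoothAt x ↔ ContDiffAt ℝ ∞ (η.inChart x₀) (extChartAt I x₀ x) := by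
  have hid : pullback I (id : M → M) η = η := funext fun x => pullback_id η x
  constructor <;> intro h
  · have := contDiffAt_inChart_pullback (f := id) η contMDiffAt_id hx
      (mem_extChartAt_source (I := I) x) h
    rwa [hid] at this
  · have := contDiffAt_inChart_pullback (f := id) η contMDiffAt_id
      (mem_extChartAt_source (I := I) x) hx h
    rwa [hid] at this

theorem isSmooth_iff_smoothAt (η : DiffForm I M k) : η.IsSmooth ↔ ∀ x, η.SmoothAt x := by
  constructor
  · intro h x
    exact (h x).contDiffAt (extChartAt_target_mem_nhds x)
  · intro h x₀ z hz
    have h1 := (smoothAt_iff_inChart η ((extChartAt I x₀).map_target hz)).1 (h _)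
    rw [(extChartAt I x₀).right_inv hz] at h1
    exact h1.contDiffWithinAt

theorem SmoothAt.pullback {f : M → N} {η : DiffForm I' N k} {x : M}
    (hη : η.SmoothAt (f x)) (hf : ContMDiffAt I I' ∞ f x) : (pullback I f η).SmoothAt x :=
  contDiffAt_inChart_pullback η hf (mem_extChartAt_source x) (mem_extChartAt_source _) hη

theorem IsSmooth.pullback {f : M → N} {η : DiffForm I' N k}
    (hη : η.IsSmooth) (hf : ContMDiff I I' ∞ f) : (pullback I f η).IsSmooth := by
  rw [isSmooth_iff_smoothAt] at hη ⊢
  exact fun x => (hη (f x)).pullback (hf x)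

omit [I.Boundaryless] [IsManifold I ∞ M] in
theorem inChart_congr {η θ : DiffForm I M k} {x : M} (h : ∀ᶠ y in 𝓝 x, η y = θ y) :
    η.inChart x =ᶠ[𝓝 (extChartAt I x x)] θ.inChart x := by
  have hcont : ContinuousAt (extChartAt I x).symm (extChartAt I x x) :=
    continuousAt_extChartAt_symm x
  have h' : ∀ᶠ y in 𝓝 ((extChartAt I x).symm (extChartAt I x x)), η y = θ y := by
    rwa [extChartAt_to_inv]
  filter_upwards [hcont.eventually h'] with z hz
  exact pullback_congr_form hz

theorem SmoothAt.congr {η θ : DiffForm I M k} {x : M} (hη : η.SmoothAt x) (h : ∀ᶠ y in 𝓝 x, η y = θ y) :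
    θ.SmoothAt x :=
  ContDiffAt.congr_of_eventuallyEq hη (inChart_congr (h.mono fun _ hy => hy.symm))

/-- The exterior derivative commutes with pullbacks. -/
theorem d_pullback {f : M → N} {η : DiffForm I' N k} {x : M}
    (hη : η.SmoothAt (f x)) (hf : ContMDiffAt I I' ∞ f x) :
    (DiffForm.pullback I f η).d x = DiffForm.pullback I f η.d x := by
  have hF := contDiffAt_writtenInCharts hf (mem_extChartAt_source x) (mem_extChartAt_source (f x))
  set F := extChartAt I' (f x) ∘ f ∘ (extChartAt I x).symm with hFdef
  have hFx : F (extChartAt I x x) = extChartAt I' (f x) (f x) := by simp [hFdef]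
  have h1 : extDeriv ((DiffForm.pullback I f η).inChart x) (extChartAt I x x) =
      (extDeriv (η.inChart (f x)) (F (extChartAt I x x))).compContinuousLinearMap
        (fderiv ℝ F (extChartAt I x x)) := by
    rw [(pullback_inChart_eventuallyEq η hf (mem_extChartAt_source x)
      (mem_extChartAt_source (f x))).extDeriv_eq]
    refine extDeriv_pullback (r := ∞) ?_ hF ?_
    · rw [← hFdef, hFx]
      exact ContDiffAt.differentiableAt hη (by simp)
    · simp only [minSmoothness_of_isRCLikeNormedField]
      exact WithTop.coe_le_coe.2 le_top
  -- The definition of `d` composes with the differential of the chart. The chain rule on both sides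
  -- of this equality moves that differential from the source of `f` to its target.
  have h2 : mfderiv I 𝓘(ℝ, E') (F ∘ extChartAt I x) x =
      mfderiv I 𝓘(ℝ, E') (extChartAt I' (f x) ∘ f) x := by
    refine Filter.EventuallyEq.mfderiv_eq ?_
    filter_upwards [extChartAt_source_mem_nhds (I := I) x] with y hy
    simp only [hFdef, Function.comp_apply, (extChartAt I x).left_inv hy]
  have hFm : MDifferentiableAt 𝓘(ℝ, E) 𝓘(ℝ, E') F (extChartAt I x x) :=
    (contMDiffAt_iff_contDiffAt.2 hF).mdifferentiableAt (by simp)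
  rw [mfderiv_comp x hFm (mdifferentiableAt_extChartAt (mem_chart_source H x)),
    mfderiv_comp x (mdifferentiableAt_extChartAt (mem_chart_source H' (f x)))
      (hf.mdifferentiableAt (by simp)), mfderiv_eq_fderiv] at h2
  unfold d
  rw [h1, hFx]
  ext v
  rw [pullback_apply]
  have h3 : ∀ w : TangentSpace I x, fderiv ℝ F (extChartAt I x x)
      (mfderiv I 𝓘(ℝ, E) (extChartAt I x) x w) =
      mfderiv I' 𝓘(ℝ, E') (extChartAt I' (f x)) (f x) (mfderiv I I' f x w) :=
    fun w => congrArg (fun A => A w) h2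
  exact congrArg (extDeriv (η.inChart (f x)) (extChartAt I' (f x) (f x))) (funext fun i => h3 (v i))

theorem SmoothAt.add {η θ : DiffForm I M k} {x : M} (hη : η.SmoothAt x) (hθ : θ.SmoothAt x) :
    (η + θ).SmoothAt x :=
  ContDiffAt.add hη hθ

theorem SmoothAt.const_smul {η : DiffForm I M k} {x : M} (hη : η.SmoothAt x) (c : ℝ) :
    (c • η).SmoothAt x :=
  ContDiffAt.const_smul c hη

theorem d_add {η θ : DiffForm I M k} {x : M} (hη : η.SmoothAt x) (hθ : θ.SmoothAt x) :
    (η + θ).d x = η.d x + θ.d x := by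
  unfold d
  have : (η + θ).inChart x = η.inChart x + θ.inChart x := rfl
  rw [this, extDeriv_add (ContDiffAt.differentiableAt hη (by simp))
    (ContDiffAt.differentiableAt hθ (by simp))]
  rfl

theorem d_smul (c : ℝ) (η : DiffForm I M k) (x : M) : (c • η).d x = c • η.d x := by
  unfold d
  have : (c • η).inChart x = c • η.inChart x := rfl
  rw [this, extDeriv_smul]
  rfl

/-- Near a point of the domain of a chart, the coordinate expression of `dη` is the exterior
derivative of that of `η`. -/
theorem d_inChart {η : DiffForm I M k} (hη : η.IsSmooth) (x₀ : M) {z : E}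
    (hz : z ∈ (extChartAt I x₀).target) : η.d.inChart x₀ z = extDeriv (η.inChart x₀) z := by
  rw [inChart_eq_pullback, ← d_pullback ((isSmooth_iff_smoothAt η).1 hη _)
    ((contMDiffOn_extChartAt_symm x₀).contMDiffAt ((isOpen_extChartAt_target x₀).mem_nhds hz)),
    d_self]
  rfl

end DiffForm

end FormCalculus

/-! ### Weighted sums of forms on a product -/

section WeightedSum

variable {E : Type*} [NormedAddCommGroup E] [NormedSpace ℝ E]
  {H : Type*} [TopologicalSpace H] {I : ModelWithCorners ℝ E H}
  {E' : Type*} [NormedAddCommGroup E'] [NormedSpace ℝ E']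
  {H' : Type*} [TopologicalSpace H'] {I' : ModelWithCorners ℝ E' H'}
  {E'' : Type*} [NormedAddCommGroup E''] [NormedSpace ℝ E'']
  {H'' : Type*} [TopologicalSpace H''] {I'' : ModelWithCorners ℝ E'' H''}
  {M : Type*} [TopologicalSpace M] [ChartedSpace H M]
  {N : Type*} [TopologicalSpace N] [ChartedSpace H' N]
  {O : Type*} [TopologicalSpace O] [ChartedSpace H'' O]

namespace DiffForm

variable {k : ℕ}

theorem weightedSum_eq (b a : ℤ) (ω₁ : DiffForm I M k) (ω₂ : DiffForm I' N k) :
    weightedSum b a ω₁ ω₂ = (b : ℝ) • pullback (I.prod I') Prod.fst ω₁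
      + (a : ℝ) • pullback (I.prod I') Prod.snd ω₂ := rfl

theorem weightedSum_apply (b a : ℤ) (ω₁ : DiffForm I M k) (ω₂ : DiffForm I' N k) (x : M × N)
    (v : Fin k → E × E') :
    (weightedSum b a ω₁ ω₂).toModel x v =
      (b : ℝ) * ω₁.toModel x.1 (fun i => (v i).1)
      + (a : ℝ) * ω₂.toModel x.2 (fun i => (v i).2) := by
  change (b : ℝ) * ω₁.toModel x.1 (fun i => mfderiv (I.prod I') I Prod.fst x (v i))
    + (a : ℝ) * ω₂.toModel x.2 (fun i => mfderiv (I.prod I') I' Prod.snd x (v i)) = _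
  rw [mfderiv_fst, mfderiv_snd]
  rfl

theorem pullback_weightedSum {f : O → M} {g : O → N} (b a : ℤ) (ω₁ : DiffForm I M k)
    (ω₂ : DiffForm I' N k) {x : O} (hf : MDifferentiableAt I'' I f x)
    (hg : MDifferentiableAt I'' I' g x) :
    pullback I'' (fun y => (f y, g y)) (weightedSum b a ω₁ ω₂) x =
      (b : ℝ) • pullback I'' f ω₁ x + (a : ℝ) • pullback I'' g ω₂ x := by
  ext v
  rw [pullback_apply, mfderiv_prodMk hf hg]
  exact weightedSum_apply b a ω₁ ω₂ (f x, g x) _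

variable [I.Boundaryless] [I'.Boundaryless] [IsManifold I ∞ M] [IsManifold I' ∞ N]

theorem weightedSum_isSmooth (b a : ℤ) {ω₁ : DiffForm I M k} {ω₂ : DiffForm I' N k}
    (h₁ : ω₁.IsSmooth) (h₂ : ω₂.IsSmooth) : (weightedSum b a ω₁ ω₂).IsSmooth := by
  rw [isSmooth_iff_smoothAt] at *
  intro x
  exact (((h₁ x.1).pullback contMDiffAt_fst).const_smul _).add
    (((h₂ x.2).pullback contMDiffAt_snd).const_smul _)

theorem weightedSum_d (b a : ℤ) {ω₁ : DiffForm I M k} {ω₂ : DiffForm I' N k}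
    (h₁ : ω₁.IsSmooth) (h₂ : ω₂.IsSmooth) :
    (weightedSum b a ω₁ ω₂).d = weightedSum b a ω₁.d ω₂.d := by
  rw [isSmooth_iff_smoothAt] at *
  funext x
  have e1 : (pullback (I.prod I') Prod.fst ω₁).SmoothAt x := (h₁ x.1).pullback contMDiffAt_fst
  have e2 : (pullback (I.prod I') Prod.snd ω₂).SmoothAt x := (h₂ x.2).pullback contMDiffAt_snd
  rw [weightedSum_eq, d_add (e1.const_smul _) (e2.const_smul _), d_smul, d_smul,
    d_pullback (h₁ x.1) contMDiffAt_fst, d_pullback (h₂ x.2) contMDiffAt_snd]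
  rfl

theorem weightedSum_isSymplectic {a b : ℤ} (ha : a ≠ 0) (hb : b ≠ 0) {ω₁ : DiffForm I M 2}
    {ω₂ : DiffForm I' N 2} (h₁ : ω₁.IsSymplectic) (h₂ : ω₂.IsSymplectic) :
    (weightedSum b a ω₁ ω₂).IsSymplectic where
  smooth := weightedSum_isSmooth b a h₁.smooth h₂.smooth
  closed := by
    rw [weightedSum_d b a h₁.smooth h₂.smooth, h₁.closed, h₂.closed]
    funext x
    ext v
    refine (weightedSum_apply b a _ _ x v).trans ?_
    change (b : ℝ) * 0 + (a : ℝ) * 0 = 0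
    simp
  nondegenerate := by
    intro x v hv
    have hv' : ∀ w : E × E', (b : ℝ) * ω₁.toModel x.1 ![v.1, w.1]
      + (a : ℝ) * ω₂.toModel x.2 ![v.2, w.2] = 0 := by
      intro w
      have := (weightedSum_apply b a ω₁ ω₂ x ![v, w]).symm.trans (hv w)
      rw [← this]
      congr 3 <;> (ext i; fin_cases i <;> rfl)
    -- Vectors tangent to one factor kill the term of the other factor, and the remaining weight is
    -- nonzero.
    refine Prod.ext (h₁.nondegenerate x.1 v.1 fun w => ?_) (h₂.nondegenerate x.2 v.2 fun w => ?_)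
    · have := hv' (w, 0)
      have h0 : ω₂.toModel x.2 ![v.2, 0] = 0 :=
        ContinuousAlternatingMap.map_coord_zero _ 1 rfl
      simp only [h0, mul_zero, add_zero, mul_eq_zero, Int.cast_eq_zero, hb, false_or] at this
      exact this
    · have := hv' (0, w)
      have h0 : ω₁.toModel x.1 ![v.1, 0] = 0 :=
        ContinuousAlternatingMap.map_coord_zero _ 1 rfl
      simp only [h0, mul_zero, zero_add, mul_eq_zero, Int.cast_eq_zero, ha, false_or] at this
      exact this

end DiffForm

end WeightedSum

/-! ### Logarithms of circle-valued functions -/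

section CircleLifts

variable {E : Type*} [NormedAddCommGroup E] [NormedSpace ℝ E]
  {H : Type*} [TopologicalSpace H] {I : ModelWithCorners ℝ E H}
  {N : Type*} [TopologicalSpace N] [ChartedSpace H N]

theorem ContMDiffAt.circle_zpow {f : N → Circle} {x : N} (hf : ContMDiffAt I (𝓡 1) ∞ f x) (m : ℤ) :
    ContMDiffAt I (𝓡 1) ∞ (fun y => f y ^ m) x := by
  cases m with
  | ofNat m => simpa using hf.pow m
  | negSucc m => simpa [zpow_negSucc] using (hf.pow (m + 1)).inv

/-- Every circle valued function is `exp (2 π i σ)` for a function `σ`, that can be chosen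
smooth at a given point. -/
theorem exists_circle_lift {f : N → Circle} {x : N} (hf : ContMDiffAt I (𝓡 1) ∞ f x) :
    ∃ σ : N → ℝ, ContMDiffAt I 𝓘(ℝ, ℝ) ∞ σ x ∧ ∀ y, f y = Circle.exp (2 * Real.pi * σ y) := by
  have hpi : (2 * Real.pi) ≠ 0 := by positivity
  -- Division by `f x` moves the value at `x` to `1`, away from the branch cut of the argument. The
  -- formula is a lift everywhere, but it may jump far from `x`.
  refine ⟨fun y => (2 * Real.pi)⁻¹ * (Complex.arg (f x) + Complex.arg ((f y * (f x)⁻¹ : Circle))),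
    ?_, fun y => ?_⟩
  · have h0 : ContMDiff (𝓡 1) 𝓘(ℝ, ℂ) ∞ (fun z : Circle => (z : ℂ)) :=
      @contMDiff_coe_sphere ℂ _ _ ∞ 1 finrank_real_complex_fact'
    have h1 : ContMDiffAt I (𝓡 1) ∞ (fun y => f y * (f x)⁻¹) x := hf.mul contMDiffAt_const
    have h2 : ContMDiffAt I 𝓘(ℝ, ℂ) ∞ (fun y => ((f y * (f x)⁻¹ : Circle) : ℂ)) x :=
      h0.contMDiffAt.comp x h1
    have h3 : ContDiffAt ℝ ∞ (fun z : ℂ => (2 * Real.pi)⁻¹ * (Complex.arg (f x) + Complex.arg z)) 1 := by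
      have : ContDiffAt ℝ ∞ (fun z : ℂ => (Complex.log z).im) 1 :=
        Complex.imCLM.contDiff.contDiffAt.comp 1
          ((Complex.contDiffAt_log (by simp)).restrict_scalars ℝ)
      simp only [Complex.log_im] at this
      exact contDiffAt_const.mul (contDiffAt_const.add this)
    have hx : ((f x * (f x)⁻¹ : Circle) : ℂ) = 1 := by simp
    exact ContMDiffAt.comp_of_eq (g := fun z : ℂ => (2 * Real.pi)⁻¹ * (Complex.arg (f x) + Complex.arg z))
      (contMDiffAt_iff_contDiffAt.2 h3) h2 hx
  · rw [mul_inv_cancel_left₀ hpi, Circle.exp_add, Circle.exp_arg, Circle.exp_arg]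
    rw [mul_comm (f y), mul_inv_cancel_left]

end CircleLifts

/-! ### Derivatives along circle actions -/

section CircleActions

variable {E : Type*} [NormedAddCommGroup E] [NormedSpace ℝ E]
  {H : Type*} [TopologicalSpace H] {I : ModelWithCorners ℝ E H}
  {F : Type*} [NormedAddCommGroup F] [NormedSpace ℝ F]
  {G : Type*} [TopologicalSpace G] {J : ModelWithCorners ℝ F G}
  {E'' : Type*} [NormedAddCommGroup E''] [NormedSpace ℝ E'']
  {H'' : Type*} [TopologicalSpace H''] {I'' : ModelWithCorners ℝ E'' H''}
  {W : Type*} [TopologicalSpace W] [ChartedSpace H W]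
  {P : Type*} [TopologicalSpace P] [ChartedSpace G P] [MulAction Circle P]
  {N : Type*} [TopologicalSpace N] [ChartedSpace H'' N]

/-- The velocity at `p` of the orbit `t ↦ exp (2 π i t) • p`. -/
def fundamentalVector (J : ModelWithCorners ℝ F G) (p : P) : TangentSpace J p :=
  (show ℝ →L[ℝ] F from
    mfderiv 𝓘(ℝ, ℝ) J (fun s : ℝ => Circle.exp (2 * Real.pi * s) • p) 0) 1

variable (hs : ContMDiff ((𝓡 1).prod J) J ∞ (fun q : Circle × P => q.1 • q.2))

include hs

theorem ContMDiffAt.circle_smul {z : N → Circle} {f : N → P} {x : N}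
    (hz : ContMDiffAt I'' (𝓡 1) ∞ z x) (hf : ContMDiffAt I'' J ∞ f x) :
    ContMDiffAt I'' J ∞ (fun y => z y • f y) x :=
  ContMDiffAt.comp (g := fun q : Circle × P => q.1 • q.2) (f := fun y => (z y, f y)) x
    hs.contMDiffAt (hz.prodMk hf)

theorem contMDiff_circle_const_smul (z : Circle) : ContMDiff J J ∞ (fun p : P => z • p) :=
  fun _ => ContMDiffAt.circle_smul hs contMDiffAt_const contMDiffAt_id

theorem contMDiff_exp_smul :
    ContMDiff (𝓘(ℝ, ℝ).prod J) J ∞ (fun q : ℝ × P => Circle.exp (2 * Real.pi * q.1) • q.2) := by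
  intro q
  refine ContMDiffAt.circle_smul hs ?_ contMDiffAt_snd
  refine ContMDiffAt.comp q (contMDiff_circleExp (m := ∞)).contMDiffAt ?_
  exact contMDiffAt_const.mul contMDiffAt_fst

/-- The orbit of `p` is a time shift of the orbit of `exp (2 π i s) • p`, so its velocity at `s` is
the velocity of the latter at `0`. -/
theorem mfderiv_orbit (p : P) (s : ℝ) :
    (mfderiv 𝓘(ℝ, ℝ) J (fun s : ℝ => Circle.exp (2 * Real.pi * s) • p) s (1 : ℝ) : F) =
      fundamentalVector J (Circle.exp (2 * Real.pi * s) • p) := by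
  have h1 : (fun s : ℝ => Circle.exp (2 * Real.pi * s) • p) =
      (fun r : ℝ => Circle.exp (2 * Real.pi * r) • (Circle.exp (2 * Real.pi * s) • p)) ∘
        (fun r => r - s) := by
    funext r
    simp only [Function.comp_apply, smul_smul, ← Circle.exp_add]
    congr 2
    ring
  have h2 : ∀ p : P, MDifferentiable 𝓘(ℝ, ℝ) J (fun s : ℝ => Circle.exp (2 * Real.pi * s) • p) :=
    fun p => ((contMDiff_exp_smul hs).comp
      (contMDiff_id.prodMk contMDiff_const)).mdifferentiable (by simp)
  have h3 : HasDerivAt (fun r : ℝ => r - s) 1 s := (hasDerivAt_id s).sub_const s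
  have h4 : HasMFDerivAt 𝓘(ℝ, ℝ) 𝓘(ℝ, ℝ) (fun r : ℝ => r - s) s
      (ContinuousLinearMap.toSpanSingleton ℝ (1 : ℝ)) :=
    hasMFDerivAt_iff_hasFDerivAt.2 h3.hasFDerivAt
  have h5 := mfderiv_comp_of_eq (I := 𝓘(ℝ, ℝ)) (I' := 𝓘(ℝ, ℝ)) (I'' := J) (x := s) (y := 0)
    (g := fun r : ℝ => Circle.exp (2 * Real.pi * r) • (Circle.exp (2 * Real.pi * s) • p))
    (f := fun r : ℝ => r - s) ((h2 _) 0) h4.mdifferentiableAt (sub_self s)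
  rw [← h1, h4.mfderiv] at h5
  have h6 := congrArg (fun A : ℝ →L[ℝ] F => A 1) h5
  refine h6.trans ?_
  let D : ℝ → ℝ →L[ℝ] F := fun r₀ => mfderiv 𝓘(ℝ, ℝ) J (fun r : ℝ =>
    Circle.exp (2 * Real.pi * r) • (Circle.exp (2 * Real.pi * s) • p)) r₀
  change D (s - s) ((1 : ℝ) • (1 : ℝ)) = D 0 1
  rw [one_smul, sub_self]

/-- This is the product rule for the action map: the variation of `σ` contributes a vertical vector,
that of `f` is carried along by the fixed circle element. -/
theorem mfderiv_exp_smul {f : N → P} {σ : N → ℝ} {y : N} (hσ : MDifferentiableAt I'' 𝓘(ℝ, ℝ) σ y)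
    (hf : MDifferentiableAt I'' J f y) (v : TangentSpace I'' y) :
    mfderiv I'' J (fun y => Circle.exp (2 * Real.pi * σ y) • f y) y v =
      (show ℝ from mfderiv I'' 𝓘(ℝ, ℝ) σ y v) •
        fundamentalVector J (Circle.exp (2 * Real.pi * σ y) • f y) +
      mfderiv J J (fun p => Circle.exp (2 * Real.pi * σ y) • p) (f y) (mfderiv I'' J f y v) := by
  have hA : MDifferentiableAt (𝓘(ℝ, ℝ).prod J) J
    (fun q : ℝ × P => Circle.exp (2 * Real.pi * q.1) • q.2) (σ y, f y) :=
    (contMDiff_exp_smul hs).contMDiffAt.mdifferentiableAt (by simp)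
  have h1 := mfderiv_comp (I := I'') (I' := 𝓘(ℝ, ℝ).prod J) (I'' := J) y
    (g := fun q : ℝ × P => Circle.exp (2 * Real.pi * q.1) • q.2) (f := fun y => (σ y, f y))
    hA (hσ.prodMk hf)
  rw [mfderiv_prodMk hσ hf] at h1
  have h2 := congrArg (fun A => A v) h1
  refine h2.trans ?_
  refine (mfderiv_prod_eq_add_apply hA).trans ?_
  refine congrArg₂ (fun a b : F => a + b) ?_ rfl
  have h3 := mfderiv_orbit hs (f y) (σ y)
  have h4 : ∀ (A : ℝ →L[ℝ] F) (r : ℝ), A r = r • A 1 := fun A r => by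
    rw [← A.map_smul, smul_eq_mul, mul_one]
  refine (h4 _ _).trans ?_
  exact congrArg (fun w : F => (show ℝ from mfderiv I'' 𝓘(ℝ, ℝ) σ y v) • w) h3

end CircleActions

/-! ### Forms of degree one as linear functionals -/

namespace DiffForm

variable {E : Type*} [NormedAddCommGroup E] [NormedSpace ℝ E]
  {H : Type*} [TopologicalSpace H] {I : ModelWithCorners ℝ E H}
  {E' : Type*} [NormedAddCommGroup E'] [NormedSpace ℝ E']
  {H' : Type*} [TopologicalSpace H'] {I' : ModelWithCorners ℝ E' H'}
  {M : Type*} [TopologicalSpace M] [ChartedSpace H M]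
  {N : Type*} [TopologicalSpace N] [ChartedSpace H' N]

/-- A form of degree one at a point, as a linear form on the model vector space. -/
def lin (α : DiffForm I M 1) (x : M) : E →L[ℝ] ℝ :=
  (ContinuousAlternatingMap.ofSubsingleton ℝ E ℝ (0 : Fin 1)).symm (α.toModel x)

theorem apply_eq_lin (α : DiffForm I M 1) (x : M) (v : TangentSpace I x) :
    α x ![v] = α.lin x v := by
  change α.toModel x ![v] = α.toModel x (fun _ => v)
  congr 1
  ext i
  fin_cases i
  rfl

theorem apply_eq_lin_zero (α : DiffForm I M 1) (x : M) (v : Fin 1 → TangentSpace I x) :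
    α x v = α.lin x (v 0) := by
  change α.toModel x v = α.toModel x (fun _ => v 0)
  congr 1
  ext i
  fin_cases i
  rfl

theorem ext_lin {α β : DiffForm I M 1} {x : M} (h : ∀ v : TangentSpace I x, α.lin x v = β.lin x v) :
    α x = β x := by
  ext v
  rw [apply_eq_lin_zero, apply_eq_lin_zero, h]

theorem lin_pullback (f : M → N) (α : DiffForm I' N 1) (x : M) (v : TangentSpace I x) :
    (pullback I f α).lin x v = α.lin (f x) (mfderiv I I' f x v) := rfl

theorem lin_congr (α : DiffForm I M 1) {x y : M} (h : x = y) (v : E) :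
    α.lin x v = α.lin y v := by
  subst h; rfl

theorem lin_eq_of_eq {α β : DiffForm I M 1} {x : M} (h : α x = β x) (v : E) :
    α.lin x v = β.lin x v := by
  rw [lin, lin, toModel, toModel, h]

end DiffForm

/-! ### Principal circle bundles: division in fibres, sections, vertical vectors, topology -/

section PrincipalBundles

variable {E : Type*} [NormedAddCommGroup E] [NormedSpace ℝ E]
  {H : Type*} [TopologicalSpace H] {I : ModelWithCorners ℝ E H}
  {F : Type*} [NormedAddCommGroup F] [NormedSpace ℝ F]
  {G : Type*} [TopologicalSpace G] {J : ModelWithCorners ℝ F G}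
  {E'' : Type*} [NormedAddCommGroup E''] [NormedSpace ℝ E'']
  {H'' : Type*} [TopologicalSpace H''] {I'' : ModelWithCorners ℝ E'' H''}
  {W : Type*} [TopologicalSpace W] [ChartedSpace H W]
  {P : Type*} [TopologicalSpace P] [ChartedSpace G P] [MulAction Circle P]
  {N : Type*} [TopologicalSpace N] [ChartedSpace H'' N]

open Classical in
/-- The element of the circle that carries `p` to `q`, when there is one. -/
def circleDiv (p q : P) : Circle :=
  if h : ∃ z : Circle, q = z • p then h.choose else 1

namespace IsPrincipalCircleBundle

variable {π : P → W} (hP : IsPrincipalCircleBundle I J π)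

include hP

theorem proj_smul (z : Circle) (p : P) : π (z • p) = π p := by
  obtain ⟨e, he, -, -, h⟩ := hP.locally_trivial (π p)
  exact (h p he z).1

theorem smul_left_injective {z z' : Circle} {p : P} (h : z • p = z' • p) : z = z' := by
  obtain ⟨e, he, -, -, h'⟩ := hP.locally_trivial (π p)
  have h1 := (h' p he z).2
  rw [h, (h' p he z').2] at h1
  exact (mul_right_cancel h1).symm

theorem exists_smul_eq {p q : P} (h : π p = π q) : ∃ z : Circle, q = z • p := by
  obtain ⟨e, he, -, -, h'⟩ := hP.locally_trivial (π p)
  refine ⟨(e q).2 * ((e p).2)⁻¹, ?_⟩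
  have hp : p ∈ e.source := e.mem_source.2 he
  have hq : q ∈ e.source := e.mem_source.2 (h ▸ he)
  have hz := h' p he ((e q).2 * ((e p).2)⁻¹)
  refine e.injOn hq (e.mem_source.2 (by rw [hz.1]; exact he)) (Prod.ext ?_ ?_)
  · exact (e.coe_fst hq).trans (h.symm.trans (hz.1.symm.trans
      (e.coe_fst (e.mem_source.2 (by rw [hz.1]; exact he))).symm))
  · refine Eq.trans ?_ hz.2.symm
    simp

theorem circleDiv_smul {p q : P} (h : π p = π q) : circleDiv p q • p = q := by
  have h' := hP.exists_smul_eq h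
  rw [circleDiv, dif_pos h']
  exact h'.choose_spec.symm

theorem circleDiv_eq {p q : P} {z : Circle} (h : q = z • p) : circleDiv p q = z :=
  hP.smul_left_injective
    ((hP.circleDiv_smul (by rw [h, hP.proj_smul])).trans h)

theorem circleDiv_eq_of_trivialization (e : Bundle.Trivialization Circle π)
    (h : ∀ p : P, π p ∈ e.baseSet → ∀ z : Circle, π (z • p) = π p ∧ (e (z • p)).2 = z * (e p).2)
    {p q : P} (hp : π p ∈ e.baseSet) (hpq : π p = π q) :
    circleDiv p q = (e q).2 * ((e p).2)⁻¹ := by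
  obtain ⟨z, hz⟩ := hP.exists_smul_eq hpq
  rw [hP.circleDiv_eq hz, hz, (h p hp z).2]
  simp

theorem contMDiff_proj : ContMDiff J I ∞ π := by
  intro p
  obtain ⟨e, he, he1, -, -⟩ := hP.locally_trivial (π p)
  have hp : p ∈ e.source := e.mem_source.2 he
  have h1 : ContMDiffAt J (I.prod (𝓡 1)) ∞ e p := he1.contMDiffAt (e.open_source.mem_nhds hp)
  refine (contMDiffAt_fst.comp p h1).congr_of_eventuallyEq ?_
  filter_upwards [e.open_source.mem_nhds hp] with q hq
  exact (e.coe_fst hq).symm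

theorem exists_section (p : P) : ∃ (U : Set W) (s : W → P), IsOpen U ∧ π p ∈ U ∧
    ContMDiffOn I J ∞ s U ∧ (∀ u ∈ U, π (s u) = u) ∧ s (π p) = p := by
  obtain ⟨e, he, -, he2, -⟩ := hP.locally_trivial (π p)
  have hp : p ∈ e.source := e.mem_source.2 he
  refine ⟨e.baseSet, fun u => e.toOpenPartialHomeomorph.symm (u, (e p).2), e.open_baseSet, he,
    ?_, fun u hu => ?_, ?_⟩
  · refine he2.comp (contMDiff_id.prodMk contMDiff_const).contMDiffOn fun u hu => ?_
    exact e.mem_target.2 hu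
  · exact e.proj_symm_apply (e.mem_target.2 hu)
  · change e.toOpenPartialHomeomorph.symm (π p, (e p).2) = p
    rw [← e.coe_fst hp]
    exact e.toOpenPartialHomeomorph.left_inv hp

/-- In an equivariant trivialization, division is the quotient of the two fibre coordinates. -/
theorem contMDiffAt_circleDiv {f g : N → P} {x : N} (hf : ContMDiffAt I'' J ∞ f x)
    (hg : ContMDiffAt I'' J ∞ g x) (hfg : ∀ᶠ y in 𝓝 x, π (f y) = π (g y)) :
    ContMDiffAt I'' (𝓡 1) ∞ (fun y => circleDiv (f y) (g y)) x := by
  obtain ⟨e, he, he1, -, h⟩ := hP.locally_trivial (π (f x))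
  have hfx : f x ∈ e.source := e.mem_source.2 he
  have hgx : g x ∈ e.source := e.mem_source.2 (hfg.self_of_nhds ▸ he)
  have h1 : ∀ q ∈ e.source, ContMDiffAt J (𝓡 1) ∞ (fun q => (e q).2) q := fun q hq =>
    contMDiffAt_snd.comp q (he1.contMDiffAt (e.open_source.mem_nhds hq))
  refine (((h1 _ hgx).comp x hg).mul ((h1 _ hfx).comp x hf).inv).congr_of_eventuallyEq ?_
  filter_upwards [hfg, hf.continuousAt.eventually_mem (e.open_source.mem_nhds hfx)] with y hy hy'
  exact hP.circleDiv_eq_of_trivialization e h (e.mem_source.1 hy') hy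

/-- The differential of a local section through `p` is a right inverse. -/
theorem mfderiv_proj_surjective (p : P) : Function.Surjective (mfderiv J I π p) := by
  obtain ⟨U, s, hU, hpU, hs, hπs, hsp⟩ := hP.exists_section p
  have hsd : MDifferentiableAt I J s (π p) :=
    (hs.contMDiffAt (hU.mem_nhds hpU)).mdifferentiableAt (by simp)
  have hπd : MDifferentiableAt J I π p := hP.contMDiff_proj.contMDiffAt.mdifferentiableAt (by simp)
  have h1 : mfderivModel I I (π ∘ s) (π p) = mfderivModel I I id (π p) := by
    refine mfderivModel_congr ?_
    filter_upwards [hU.mem_nhds hpU] with u hu using hπs u hu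
  rw [mfderivModel_comp hsd hπd hsp, mfderivModel_id] at h1
  intro w
  exact ⟨mfderivModel I J s (π p) w, congrArg (fun A : E →L[ℝ] E => A w) h1⟩

theorem mfderiv_proj_fundamentalVector (p : P) : mfderiv J I π p (fundamentalVector J p) = 0 := by
  have hπd : MDifferentiable J I π := hP.contMDiff_proj.mdifferentiable (by simp)
  have hod : MDifferentiable 𝓘(ℝ, ℝ) J (fun s : ℝ => Circle.exp (2 * Real.pi * s) • p) :=
    ((contMDiff_exp_smul hP.smooth_smul).comp
      (contMDiff_id.prodMk contMDiff_const)).mdifferentiable (by simp)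
  have h1 := mfderivModel_comp (x := (0 : ℝ)) (hod 0) (hπd p) (by simp)
  have h2 : π ∘ (fun s : ℝ => Circle.exp (2 * Real.pi * s) • p) = fun _ => π p :=
    funext fun s => hP.proj_smul _ _
  rw [h2, mfderivModel_const] at h1
  exact (congrArg (fun A : ℝ →L[ℝ] E => A 1) h1).symm

/-- The vertical vectors are the multiples of the fundamental vector. -/
theorem exists_eq_smul_fundamentalVector {p : P} {v : TangentSpace J p}
    (hv : mfderiv J I π p v = 0) : ∃ r : ℝ, v = r • fundamentalVector J p := by
  obtain ⟨U, s, hU, hpU, hs, hπs, hsp⟩ := hP.exists_section p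
  have hsd : ContMDiffAt J J ∞ (s ∘ π) p :=
    (hs.contMDiffAt (hU.mem_nhds hpU)).comp p hP.contMDiff_proj.contMDiffAt
  have hev : ∀ᶠ q in 𝓝 p, π ((s ∘ π) q) = π (id q) := by
    filter_upwards [hP.contMDiff_proj.continuous.continuousAt.eventually_mem (hU.mem_nhds hpU)]
      with q hq using hπs _ hq
  -- Near `p` the identity is `exp (2 π i σ) • (s ∘ π)`. Differentiating along `v`, the term of `s ∘
  -- π` vanishes because `v` is vertical, and `dσ(v)` times the fundamental vector remains.
  obtain ⟨σ, hσ, hσ'⟩ := exists_circle_lift (hP.contMDiffAt_circleDiv hsd contMDiffAt_id hev)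
  have h1 : (fun q => Circle.exp (2 * Real.pi * σ q) • (s ∘ π) q) =ᶠ[𝓝 p] id := by
    filter_upwards [hev] with q hq
    rw [← hσ']
    exact hP.circleDiv_smul hq
  have h2 := mfderiv_exp_smul hP.smooth_smul (hσ.mdifferentiableAt (by simp))
    (hsd.mdifferentiableAt (by simp)) v
  have h3 : mfderivModel J J (s ∘ π) p v = 0 := by
    rw [mfderivModel_comp (hP.contMDiff_proj.contMDiffAt.mdifferentiableAt (by simp))
      ((hs.contMDiffAt (hU.mem_nhds hpU)).mdifferentiableAt (by simp)) rfl]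
    have : mfderivModel J I π p v = 0 := hv
    exact (congrArg (mfderivModel I J s (π p)) this).trans (map_zero _)
  have h4 := congrArg (fun A : F →L[ℝ] F => A v) (mfderivModel_congr (I := J) (I' := J) h1)
  have h5 := h4.symm.trans h2
  have h6 : ∀ A : F →L[ℝ] F, A (mfderivModel J J (s ∘ π) p v) = 0 := fun A => by
    rw [h3, map_zero]
  have h7 : ∀ q : P, q = p → (fundamentalVector J q : F) = fundamentalVector J p := by
    rintro q rfl
    rfl
  refine ⟨mfderiv J 𝓘(ℝ, ℝ) σ p v, ?_⟩
  have h8 : mfderivModel J J id p v = v := by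
    rw [mfderivModel_id]
    rfl
  refine h8.symm.trans (h5.trans ?_)
  refine (congrArg₂ (fun a b : F => a + b) ?_ (h6 _)).trans (add_zero _)
  exact congrArg (fun w : F => (show ℝ from mfderiv J 𝓘(ℝ, ℝ) σ p v) • w)
    (h7 _ h1.self_of_nhds)

/-- Points of one fibre are separated by the fibre coordinate of a trivialization, points of
different fibres by their projections. -/
theorem t2Space [T2Space W] : T2Space P := by
  refine ⟨fun p q hpq => ?_⟩
  by_cases h : π p = π q
  · obtain ⟨e, he, -, -, -⟩ := hP.locally_trivial (π p)
    have hp : p ∈ e.source := e.mem_source.2 he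
    have hq : q ∈ e.source := e.mem_source.2 (h ▸ he)
    have hne : (e p).2 ≠ (e q).2 := fun h' => hpq <| e.injOn hp hq <|
      Prod.ext ((e.coe_fst hp).trans (h.trans (e.coe_fst hq).symm)) h'
    obtain ⟨A, B, hA, hB, hpA, hqB, hAB⟩ := t2_separation hne
    have hc : ContinuousOn (fun r => (e r).2) e.source :=
      continuous_snd.comp_continuousOn e.continuousOn_toFun
    exact ⟨_, _, hc.isOpen_inter_preimage e.open_source hA,
      hc.isOpen_inter_preimage e.open_source hB, ⟨hp, hpA⟩, ⟨hq, hqB⟩,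
      Set.disjoint_left.2 fun r hr hr' => Set.disjoint_left.1 hAB hr.2 hr'.2⟩
  · obtain ⟨A, B, hA, hB, hpA, hqB, hAB⟩ := t2_separation h
    have hc := hP.contMDiff_proj.continuous
    exact ⟨_, _, hA.preimage hc, hB.preimage hc, hpA, hqB, hAB.preimage _⟩

/-- The projection of an ultrafilter converges to some `w`, and its fibre coordinate in a
trivialization at `w` converges in the compact circle; the trivialization carries the limit back. -/
theorem compactSpace [CompactSpace W] : CompactSpace P := by
  refine ⟨isCompact_iff_ultrafilter_le_nhds.2 fun f _ => ?_⟩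
  obtain ⟨w, -, hw⟩ := isCompact_univ.ultrafilter_le_nhds (f.map π) (by simp)
  obtain ⟨e, he, -, -, -⟩ := hP.locally_trivial w
  obtain ⟨z, -, hz⟩ := isCompact_univ.ultrafilter_le_nhds (f.map fun p => (e p).2) (by simp)
  have hsrc : e.source ∈ (f : Filter P) := by
    rw [e.source_eq]
    exact hw (e.open_baseSet.mem_nhds he)
  have ht : (w, z) ∈ e.target := e.mem_target.2 he
  refine ⟨e.toOpenPartialHomeomorph.symm (w, z), mem_univ _, ?_⟩
  have h1 : Filter.Tendsto e f (𝓝 (w, z)) := by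
    rw [nhds_prod_eq]
    refine Filter.Tendsto.prodMk ?_ hz
    refine Filter.Tendsto.congr' ?_ (show Filter.Tendsto π f (𝓝 w) from hw)
    filter_upwards [hsrc] with p hp using (e.coe_fst hp).symm
  have h2 := (e.toOpenPartialHomeomorph.continuousAt_symm ht).tendsto.comp h1
  refine Filter.Tendsto.congr' (f₂ := id) ?_ h2
  filter_upwards [hsrc] with p hp
  exact e.toOpenPartialHomeomorph.left_inv hp

end IsPrincipalCircleBundle

end PrincipalBundles

/-! ### Connections, contact forms and equivariant maps -/

section Connections

variable {E : Type*} [NormedAddCommGroup E] [NormedSpace ℝ E]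
  {H : Type*} [TopologicalSpace H] {I : ModelWithCorners ℝ E H}
  {F : Type*} [NormedAddCommGroup F] [NormedSpace ℝ F]
  {G : Type*} [TopologicalSpace G] {J : ModelWithCorners ℝ F G}
  {F' : Type*} [NormedAddCommGroup F'] [NormedSpace ℝ F']
  {G' : Type*} [TopologicalSpace G'] {J' : ModelWithCorners ℝ F' G'}
  {E'' : Type*} [NormedAddCommGroup E''] [NormedSpace ℝ E'']
  {H'' : Type*} [TopologicalSpace H''] {I'' : ModelWithCorners ℝ E'' H''}
  {W : Type*} [TopologicalSpace W] [ChartedSpace H W]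
  {P : Type*} [TopologicalSpace P] [ChartedSpace G P] [MulAction Circle P]
  {S : Type*} [TopologicalSpace S] [ChartedSpace G' S] [MulAction Circle S]
  {N : Type*} [TopologicalSpace N] [ChartedSpace H'' N]

namespace IsCircleConnection

open DiffForm

variable {π : P → W} {α : DiffForm J P 1} {η : DiffForm I W 2}
  (h : IsCircleConnection I J π α η)

include h

theorem lin_fundamentalVector (p : P) : α.lin p (fundamentalVector J p) = 1 := by
  have h1 := h.normalized p 0
  rw [apply_eq_lin] at h1
  rw [← h1]
  exact lin_congr α (by simp) _

/-- The gauge transformation formula: normalization turns the vertical term of `mfderiv_exp_smul`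
into `dσ`, and invariance removes the circle element from the other term. -/
theorem lin_exp_smul {f : N → P} {σ : N → ℝ} {y : N} (hσ : MDifferentiableAt I'' 𝓘(ℝ, ℝ) σ y)
    (hf : MDifferentiableAt I'' J f y) (v : TangentSpace I'' y) :
    (pullback I'' (fun y => Circle.exp (2 * Real.pi * σ y) • f y) α).lin y v =
      mfderivModel I'' 𝓘(ℝ, ℝ) σ y v + (pullback I'' f α).lin y v := by
  have h1 := mfderiv_exp_smul h.bundle.smooth_smul hσ hf v
  have h2 := congrFun (h.invariant (Circle.exp (2 * Real.pi * σ y))) (f y)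
  rw [lin_pullback]
  refine (congrArg (α.lin _) h1).trans ?_
  refine (map_add (α.lin _) _ _).trans ?_
  refine congrArg₂ (fun a b : ℝ => a + b) ?_ ?_
  · refine ((α.lin _).map_smul _ _).trans ?_
    exact (congrArg (fun r : ℝ => (mfderivModel I'' 𝓘(ℝ, ℝ) σ y v) * r)
      (h.lin_fundamentalVector _)).trans (mul_one _)
  · exact lin_eq_of_eq h2 _

theorem d_fundamentalVector (p : P) (w : TangentSpace J p) :
    α.d p ![fundamentalVector J p, w] = 0 := by
  rw [h.curvature, pullback_apply]
  refine ContinuousAlternatingMap.map_coord_zero _ 0 ?_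
  exact h.bundle.mfderiv_proj_fundamentalVector p

/-- A connection with symplectic curvature is a contact form. -/
theorem isContactForm (hη : η.IsSymplectic) : α.IsContactForm where
  smooth := h.smooth
  ne_zero := by
    intro p hp
    have h1 := h.lin_fundamentalVector p
    rw [← apply_eq_lin, hp] at h1
    exact zero_ne_one h1
  nondegenerate := by
    intro p v hv hvw
    have hR := h.lin_fundamentalVector p
    have h1 : ∀ w : TangentSpace J p, α.d p ![v, w] = 0 := by
      intro w
      -- Subtracting the vertical component makes `w` horizontal. Vertical vectors pair to zero
      -- under `dα`, which is pulled back from the base.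
      have h2 := hvw (w - α.lin p w • fundamentalVector J p) (by
        rw [apply_eq_lin]
        refine (map_sub (α.lin p) _ _).trans ?_
        have := (α.lin p).map_smul (α.lin p w) (fundamentalVector J p)
        rw [hR, smul_eq_mul, mul_one] at this
        exact sub_eq_zero.2 this.symm)
      have h3 : α.d p ![v, fundamentalVector J p] = 0 := by
        rw [h.curvature, pullback_apply]
        refine ContinuousAlternatingMap.map_coord_zero _ 1 ?_
        exact h.bundle.mfderiv_proj_fundamentalVector p
      have h4 : w = (w - α.lin p w • fundamentalVector J p) + α.lin p w • fundamentalVector J p :=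
        (sub_add_cancel _ _).symm
      have h5 : ∀ a b : TangentSpace J p, ∀ r : ℝ,
          α.d p ![v, a + r • b] = α.d p ![v, a] + r * α.d p ![v, b] := by
        intro a b r
        have e1 := (α.d p).map_update_add ![v, 0] 1 a (r • b)
        have e2 := (α.d p).map_update_smul ![v, 0] 1 r b
        have e3 : ∀ c : TangentSpace J p, Function.update ![v, 0] (1 : Fin 2) c = ![v, c] := by
          intro c
          ext i
          fin_cases i <;> rfl
        simp only [e3] at e1 e2
        rw [e1, e2]
        rfl
      rw [h4, h5, h2, h3, mul_zero, add_zero]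
    -- Every tangent vector of the base lifts to `P`, so nondegeneracy of `η` forces `v` to be
    -- vertical; `α v = 0` then forces it to vanish.
    have h6 : mfderiv J I π p v = 0 := by
      refine hη.nondegenerate (π p) _ fun w => ?_
      obtain ⟨u, hu⟩ := h.bundle.mfderiv_proj_surjective p w
      have h7 := h1 u
      rw [h.curvature, pullback_apply] at h7
      rw [← h7, ← hu]
      congr 1
      ext i
      fin_cases i <;> rfl
    obtain ⟨r, hr⟩ := h.bundle.exists_eq_smul_fundamentalVector h6
    rw [apply_eq_lin, hr] at hv
    have h8 := (α.lin p).map_smul r (fundamentalVector J p)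
    rw [hR] at h8
    have h9 : r = 0 := by
      have := h8.symm.trans hv
      simpa using this
    rw [hr, h9, zero_smul]

end IsCircleConnection

namespace IsPrincipalCircleBundle

variable {π : P → W} {πS : S → W} (hP : IsPrincipalCircleBundle I J π)
  (hS : IsPrincipalCircleBundle I J' πS)

include hP hS

/-- A smooth equivariant map of principal circle bundles over the identity is a diffeomorphism. -/
theorem exists_diffeomorph {Φ : P → S} (hΦ : ContMDiff J J' ∞ Φ) (hπ : ∀ p, πS (Φ p) = π p)
    (heq : ∀ (z : Circle) p, Φ (z • p) = z • Φ p) :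
    ∃ Ψ : P ≃ₘ^∞⟮J, J'⟯ S, ∀ p, Ψ p = Φ p := by
  have hinj : Function.Injective Φ := by
    intro p q hpq
    obtain ⟨z, rfl⟩ := hP.exists_smul_eq (p := p) (q := q) (by rw [← hπ, ← hπ, hpq])
    rw [heq] at hpq
    have : z = 1 := hS.smul_left_injective (p := Φ p) (by rw [← hpq, one_smul])
    rw [this, one_smul]
  have hsurj : Function.Surjective Φ := by
    intro s
    obtain ⟨p, hp⟩ : ∃ p, π p = πS s := by
      obtain ⟨e, he, -, -, -⟩ := hP.locally_trivial (πS s)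
      exact ⟨_, e.proj_symm_apply (x := (πS s, 1)) (e.mem_target.2 he)⟩
    obtain ⟨z, hz⟩ := hS.exists_smul_eq (p := Φ p) (q := s) (by rw [hπ, hp])
    exact ⟨z • p, by rw [heq, hz]⟩
  let Φe := Equiv.ofBijective Φ ⟨hinj, hsurj⟩
  refine ⟨{ toEquiv := Φe, contMDiff_toFun := hΦ, contMDiff_invFun := ?_ }, fun p => rfl⟩
  intro s
  obtain ⟨U, t, hU, hpU, ht, hπt, -⟩ := hP.exists_section (Φe.symm s)
  have hps : π (Φe.symm s) = πS s := by
    rw [← hπ]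
    congr 1
    exact Φe.apply_symm_apply s
  rw [hps] at hpU
  have h1 : ContMDiffAt J' J ∞ (t ∘ πS) s :=
    (ht.contMDiffAt (hU.mem_nhds hpU)).comp s hS.contMDiff_proj.contMDiffAt
  have hU' : ∀ᶠ s' in 𝓝 s, πS s' ∈ U :=
    hS.contMDiff_proj.continuous.continuousAt.eventually_mem (hU.mem_nhds hpU)
  -- Over a section `t` of `P`, equivariance gives the inverse as `s' ↦ circleDiv (Φ (t (πS s'))) s'
  -- • t (πS s')`, a smooth expression.
  have h2 : ContMDiffAt J' (𝓡 1) ∞ (fun s' => circleDiv (Φ (t (πS s'))) s') s := by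
    refine hS.contMDiffAt_circleDiv (hΦ.contMDiffAt.comp s h1) contMDiffAt_id ?_
    filter_upwards [hU'] with s' hs'
    rw [hπ, hπt _ hs']
  refine (ContMDiffAt.circle_smul hP.smooth_smul h2 h1).congr_of_eventuallyEq ?_
  filter_upwards [hU'] with s' hs'
  refine Φe.injective ?_
  change Φe (Φe.symm s') = _
  rw [Φe.apply_symm_apply]
  change _ = Φ _
  rw [heq]
  exact (hS.circleDiv_smul (by rw [hπ, hπt _ hs'])).symm

end IsPrincipalCircleBundle

end Connections

/-! ### Manifold structures glued from open pieces of a manifold -/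

section Gluing

variable {E : Type*} [NormedAddCommGroup E] [NormedSpace ℝ E]
  {E' : Type*} [NormedAddCommGroup E'] [NormedSpace ℝ E']
  {H' : Type*} [TopologicalSpace H'] (I' : ModelWithCorners ℝ E' H') [I'.Boundaryless]
  {M : Type*} [TopologicalSpace M]
  {N : Type*} [TopologicalSpace N] [ChartedSpace H' N]

/-- The charted space structure on a space covered by open subsets that are identified with open
subsets of a manifold. -/
@[reducible] def gluedChartedSpace (L : E' ≃L[ℝ] E) (e : M → OpenPartialHomeomorph M N)
    (he : ∀ x, x ∈ (e x).source) : ChartedSpace E M where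
  chartAt x := (e x).trans ((chartAt H' (e x x)).trans
    (I'.toHomeomorph.trans L.toHomeomorph).toOpenPartialHomeomorph)
  atlas := Set.range fun x => (e x).trans ((chartAt H' (e x x)).trans
    (I'.toHomeomorph.trans L.toHomeomorph).toOpenPartialHomeomorph)
  mem_chart_source x := by simp [he]
  chart_mem_atlas x := ⟨x, rfl⟩

variable [IsManifold I' ∞ N] (L : E' ≃L[ℝ] E) (e : M → OpenPartialHomeomorph M N)
    (he : ∀ x, x ∈ (e x).source)
    (htr : ∀ x y, ContMDiffOn I' I' ∞ (e y ∘ (e x).symm) ((e x).symm.trans (e y)).source)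

include htr

/-- Conjugation by charts of `N` and by the linear isomorphism `L` keeps `e y ∘ (e x).symm` smooth.
The result is the transition map of the glued atlas. -/
theorem contMDiffOn_gluedTransition (x y : M) :
    ContMDiffOn 𝓘(ℝ, E) 𝓘(ℝ, E)  ∞
      (fun z => L (extChartAt I' (e y y) (e y ((e x).symm ((extChartAt I' (e x x)).symm (L.symm z))))))
      {z | L.symm z ∈ (extChartAt I' (e x x)).target ∧
        (extChartAt I' (e x x)).symm (L.symm z) ∈ (e x).target ∧
        (e x).symm ((extChartAt I' (e x x)).symm (L.symm z)) ∈ (e y).source ∧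
        e y ((e x).symm ((extChartAt I' (e x x)).symm (L.symm z))) ∈ (extChartAt I' (e y y)).source} := by
  have h1 : ContMDiff 𝓘(ℝ, E) 𝓘(ℝ, E') ∞ L.symm := L.symm.contDiff.contMDiff
  have h2 : ContMDiff 𝓘(ℝ, E') 𝓘(ℝ, E) ∞ L := L.contDiff.contMDiff
  have h3 := contMDiffOn_extChartAt_symm (I := I') (n := ∞) (e x x)
  have h4 := contMDiffOn_extChartAt (I := I') (n := ∞) (x := e y y)
  have h5 := (h3.comp h1.contMDiffOn (fun z (hz : z ∈ L.symm ⁻¹' _) => hz))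
  refine h2.comp_contMDiffOn (h4.comp ((htr x y).comp (h5.mono ?_) ?_) ?_)
  · exact fun z hz => hz.1
  · intro z hz
    rw [OpenPartialHomeomorph.trans_source]
    exact ⟨hz.2.1, hz.2.2.1⟩
  · intro z hz
    rw [← extChartAt_source I']
    exact hz.2.2.2

theorem isManifold_glued : @IsManifold ℝ _ E _ _ E _ 𝓘(ℝ, E) ∞ M _
    (gluedChartedSpace I' L e he) := by
  let _ := gluedChartedSpace I' L e he
  refine isManifold_of_contDiffOn _ _ _ ?_
  rintro _ _ ⟨x, rfl⟩ ⟨y, rfl⟩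
  refine ((contMDiffOn_gluedTransition I' L e htr x y).mono ?_).contDiffOn
  rintro z ⟨hz, -⟩
  simp only [mfld_simps] at hz
  simp only [mfld_simps, Set.mem_ofPred_eq]
  exact ⟨⟨by rw [I'.range_eq_univ]; trivial, hz.1.1⟩, hz.1.2, hz.2.1, hz.2.2⟩

/-- Near `y` the map `e y` is the glued chart at `y` followed by `L.symm` and an inverse chart of
`N`, hence smooth; `e x` differs from it by a smooth transition. -/
theorem contMDiffOn_glued (x : M) : @ContMDiffOn ℝ _ E _ _ E _ 𝓘(ℝ, E) M _
    (gluedChartedSpace I' L e he) E' _ _ H' _ I' N _ _ ∞ (e x) (e x).source := by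
  let _ := gluedChartedSpace I' L e he
  have := isManifold_glued I' L e he htr
  intro y hy
  have h1 : ContMDiffAt 𝓘(ℝ, E) 𝓘(ℝ, E) ∞ (extChartAt 𝓘(ℝ, E) y) y := contMDiffAt_extChartAt
  have h2 : ContMDiff 𝓘(ℝ, E) 𝓘(ℝ, E') ∞ L.symm := L.symm.contDiff.contMDiff
  have h3 := contMDiffOn_extChartAt_symm (I := I') (n := ∞) (e y y)
  have hv : L.symm (extChartAt 𝓘(ℝ, E) y y) = extChartAt I' (e y y) (e y y) :=
    L.symm_apply_apply _
  have h4 : ContMDiffAt 𝓘(ℝ, E) I' ∞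
      (fun q => (extChartAt I' (e y y)).symm (L.symm (extChartAt 𝓘(ℝ, E) y q))) y := by
    refine ContMDiffAt.comp_of_eq (h3.contMDiffAt (extChartAt_target_mem_nhds (e y y)))
      (h2.contMDiffAt.comp y h1) hv
  have h5 : ContMDiffAt I' I' ∞ (e x ∘ (e y).symm) (e y y) := by
    refine (htr y x).contMDiffAt (IsOpen.mem_nhds (OpenPartialHomeomorph.open_source _) ?_)
    rw [OpenPartialHomeomorph.trans_source]
    exact ⟨(e y).map_source (he y), by
      change (e y).symm (e y y) ∈ (e x).source
      rwa [(e y).left_inv (he y)]⟩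
  have h6 : (extChartAt I' (e y y)).symm (L.symm (extChartAt 𝓘(ℝ, E) y y)) = e y y := by
    rw [hv, extChartAt_to_inv]
  refine (ContMDiffAt.congr_of_eventuallyEq (ContMDiffAt.comp_of_eq h5 h4 h6) ?_).contMDiffWithinAt
  have hc : ContinuousAt (e y) y := (e y).continuousAt (he y)
  filter_upwards [hc.eventually_mem (extChartAt_source_mem_nhds (I := I') (e y y)),
    (e y).open_source.mem_nhds (he y)] with q hq hq'
  have h7 : (extChartAt I' (e y y)).symm (L.symm (extChartAt 𝓘(ℝ, E) y q)) = e y q := by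
    refine Eq.trans (congrArg _ (L.symm_apply_apply _)) ?_
    exact (extChartAt I' (e y y)).left_inv hq
  simp only [Function.comp_apply, h7]
  rw [(e y).left_inv hq']

theorem contMDiffOn_glued_symm (x : M) : @ContMDiffOn ℝ _ E' _ _ H' _ I' N _ _ E _ _ E _ 𝓘(ℝ, E) M _
    (gluedChartedSpace I' L e he) ∞ (e x).symm (e x).target := by
  let _ := gluedChartedSpace I' L e he
  have := isManifold_glued I' L e he htr
  intro n hn
  set y := (e x).symm n with hy
  have hyx : y ∈ (e x).source := (e x).map_target hn
  have h0 : ContMDiffOn 𝓘(ℝ, E) 𝓘(ℝ, E) ∞ (extChartAt 𝓘(ℝ, E) y).symm (extChartAt 𝓘(ℝ, E) y).target :=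
    contMDiffOn_extChartAt_symm y
  have h1 := h0.contMDiffAt (extChartAt_target_mem_nhds y)
  have h2 : ContMDiff 𝓘(ℝ, E') 𝓘(ℝ, E) ∞ L := L.contDiff.contMDiff
  have h3 : ContMDiffAt I' 𝓘(ℝ, E') ∞ (extChartAt I' (e y y)) (e y y) := contMDiffAt_extChartAt
  have h5 : ContMDiffAt I' I' ∞ (e y ∘ (e x).symm) n := by
    refine (htr x y).contMDiffAt (IsOpen.mem_nhds (OpenPartialHomeomorph.open_source _) ?_)
    rw [OpenPartialHomeomorph.trans_source]
    exact ⟨hn, he y⟩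
  have h6 := ContMDiffAt.comp n (h2.contMDiffAt.comp _ h3) h5
  refine (ContMDiffAt.congr_of_eventuallyEq (ContMDiffAt.comp_of_eq h1 h6 rfl) ?_).contMDiffWithinAt
  have hc : ContinuousAt (e x).symm n := (e x).continuousAt_symm hn
  filter_upwards [hc.eventually_mem (extChartAt_source_mem_nhds (I := 𝓘(ℝ, E)) y)] with q hq
  exact ((extChartAt 𝓘(ℝ, E) y).left_inv hq).symm

end Gluing

/-! ### Bézout identities and the residual circle action -/

section OrbitSpaceAlgebra

/-- Since `b * m = 1 - n * a`, the deviation from `z` is an `a`-th power. The companion identity has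
the same `θ = w ^ m * z ^ (-n)` with exponent `-b`, so the two together describe one element of the
weighted circle. -/
theorem zpow_mul_zpow_pow_eq {a b m n : ℤ} (hmn : m * b + n * a = 1) (z w : Circle) :
    (z ^ b * w ^ a) ^ m = (w ^ m * z ^ (-n)) ^ a * z := by
  have h1 : z ^ (b * m) = z ^ (-n * a) * z := by
    rw [← zpow_add_one]
    congr 1
    linarith
  rw [mul_zpow, mul_zpow, ← zpow_mul, ← zpow_mul, ← zpow_mul, ← zpow_mul, h1, mul_comm a m,
    mul_comm, mul_assoc]

theorem zpow_mul_zpow_pow_eq' {a b m n : ℤ} (hmn : m * b + n * a = 1) (z w : Circle) :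
    (z ^ b * w ^ a) ^ n = (w ^ m * z ^ (-n)) ^ (-b) * w := by
  have h1 : w ^ (a * n) = w ^ (m * -b) * w := by
    rw [← zpow_add_one]
    congr 1
    linarith
  rw [mul_zpow, mul_zpow, ← zpow_mul, ← zpow_mul, ← zpow_mul, ← zpow_mul, h1, mul_comm b n,
    neg_mul_neg, mul_comm, mul_assoc, mul_comm w, ← mul_assoc]

theorem zpow_zpow_mul_zpow_zpow {a b m n : ℤ} (hmn : m * b + n * a = 1) (z : Circle) :
    (z ^ m) ^ b * (z ^ n) ^ a = z := by
  rw [← zpow_mul, ← zpow_mul, ← zpow_add, hmn, zpow_one]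

namespace OrbitSpace

variable {P₁ P₂ : Type*} [MulAction Circle P₁] [MulAction Circle P₂] (a b : ℤ)

theorem mk_eq_iff {x y : P₁ × P₂} :
    mk a b x = mk a b y ↔ ∃ θ : Circle, x.1 = θ ^ a • y.1 ∧ x.2 = θ ^ (-b) • y.2 := by
  refine Quotient.eq''.trans ?_
  constructor
  · rintro ⟨θ, h⟩
    exact ⟨θ, (congrArg Prod.fst h).symm, (congrArg Prod.snd h).symm⟩
  · rintro ⟨θ, h1, h2⟩
    exact ⟨θ, (Prod.ext h1 h2).symm⟩

theorem mk_surjective : Function.Surjective (mk a b : P₁ × P₂ → OrbitSpace a b P₁ P₂) :=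
  Quotient.mk_surjective

theorem mk_zpow_smul (θ : Circle) (p : P₁) (q : P₂) :
    mk a b (θ ^ a • p, θ ^ (-b) • q) = mk a b (p, q) :=
  (mk_eq_iff a b).2 ⟨θ, rfl, rfl⟩

variable {a b}

/-- A representative of an orbit. -/
def out (x : OrbitSpace a b P₁ P₂) : P₁ × P₂ := (mk_surjective a b x).choose

theorem mk_out (x : OrbitSpace a b P₁ P₂) : mk a b x.out = x := (mk_surjective a b x).choose_spec

variable (a b) (m n : ℤ) (P₁ P₂)

/-- The residual circle action on the space of orbits. -/
@[reducible] def residualAction : MulAction Circle (OrbitSpace a b P₁ P₂) :=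
  letI : SMul Circle (OrbitSpace a b P₁ P₂) :=
    ⟨fun z x => mk a b (z ^ m • x.out.1, z ^ n • x.out.2)⟩
  -- Two representatives differ by a weighted circle element, which commutes with the action of `(z
  -- ^ m, z ^ n)`.
  have key : ∀ (z : Circle) (p : P₁) (q : P₂),
      z • mk a b (p, q) = mk a b (z ^ m • p, z ^ n • q) := by
    intro z p q
    obtain ⟨θ, h1, h2⟩ := (mk_eq_iff a b).1 (mk_out (mk a b (p, q)))
    refine (mk_eq_iff a b).2 ⟨θ, ?_, ?_⟩
    · change z ^ m • (out _).1 = _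
      rw [h1, smul_comm]
    · change z ^ n • (out _).2 = _
      rw [h2, smul_comm]
  { one_smul := fun x => by
      rw [← mk_out x, key]
      simp
    mul_smul := fun z w x => by
      rw [← mk_out x, key, key, key, mul_zpow, mul_zpow, mul_smul, mul_smul] }

variable {a b m n P₁ P₂}

theorem residualAction_smul_mk (z : Circle) (p : P₁) (q : P₂) :
    (residualAction P₁ P₂ a b m n).toSMul.smul z (mk a b (p, q)) =
      mk a b (z ^ m • p, z ^ n • q) := by
  obtain ⟨θ, h1, h2⟩ := (mk_eq_iff a b).1 (mk_out (mk a b (p, q)))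
  refine (mk_eq_iff a b).2 ⟨θ, ?_, ?_⟩
  · change z ^ m • (out _).1 = _
    rw [h1, smul_comm]
  · change z ^ n • (out _).2 = _
    rw [h2, smul_comm]

end OrbitSpace

end OrbitSpaceAlgebra

/-! ### The quotient map is open -/

section OrbitSpaceTopology

variable {P₁ P₂ : Type*} [MulAction Circle P₁] [MulAction Circle P₂] [TopologicalSpace P₁]
  [TopologicalSpace P₂] (a b : ℤ)

theorem OrbitSpace.isOpenQuotientMap_mk (h₁ : ∀ z : Circle, Continuous fun p : P₁ => z • p)
    (h₂ : ∀ z : Circle, Continuous fun p : P₂ => z • p) :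
    IsOpenQuotientMap (OrbitSpace.mk a b : P₁ × P₂ → OrbitSpace a b P₁ P₂) := by
  exact @MulAction.isOpenQuotientMap_quotientMk Circle _ (P₁ × P₂) _ (weightedAction a b P₁ P₂)
    (@ContinuousConstSMul.mk Circle (P₁ × P₂) _ (weightedAction a b P₁ P₂).toSMul
      fun z => ((h₁ _).comp continuous_fst).prodMk ((h₂ _).comp continuous_snd))

end OrbitSpaceTopology

/-! ### Smooth equivariant trivializations -/

section Trivializations

variable {E : Type*} [NormedAddCommGroup E] [NormedSpace ℝ E]
  {H : Type*} [TopologicalSpace H] (I : ModelWithCorners ℝ E H)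
  {F : Type*} [NormedAddCommGroup F] [NormedSpace ℝ F]
  {G : Type*} [TopologicalSpace G] (J : ModelWithCorners ℝ F G)
  {W : Type*} [TopologicalSpace W] [ChartedSpace H W]
  {P : Type*} [TopologicalSpace P] [ChartedSpace G P] [MulAction Circle P] {π : P → W}

/-- A smooth equivariant local trivialization of a principal circle bundle. -/
structure IsSmoothTrivialization (e : Bundle.Trivialization Circle π) : Prop where
  contMDiffOn : ContMDiffOn J (I.prod (𝓡 1)) ∞ e e.source
  contMDiffOn_symm : ContMDiffOn (I.prod (𝓡 1)) J ∞ e.toOpenPartialHomeomorph.symm e.target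
  smul : ∀ p : P, π p ∈ e.baseSet → ∀ z : Circle, π (z • p) = π p ∧ (e (z • p)).2 = z * (e p).2

variable {I J}

theorem IsPrincipalCircleBundle.exists_isSmoothTrivialization (hP : IsPrincipalCircleBundle I J π)
    (w : W) : ∃ e : Bundle.Trivialization Circle π, w ∈ e.baseSet ∧ IsSmoothTrivialization I J e := by
  obtain ⟨e, h0, h1, h2, h3⟩ := hP.locally_trivial w
  exact ⟨e, h0, h1, h2, h3⟩

theorem IsSmoothTrivialization.symm_apply {e : Bundle.Trivialization Circle π}
    (he : IsSmoothTrivialization I J e) {p : P} (hp : π p ∈ e.baseSet) (z : Circle) :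
    e.toOpenPartialHomeomorph.symm (π p, z * (e p).2) = z • p := by
  have h := he.smul p hp z
  have hz : z • p ∈ e.source := e.mem_source.2 (by rw [h.1]; exact hp)
  rw [← h.2, ← h.1, ← e.coe_fst hz]
  exact e.toOpenPartialHomeomorph.left_inv hz

end Trivializations

/-! ### Local trivializations of the orbit space -/

section OrbitSpaceBundle

variable {E₁ : Type*} [NormedAddCommGroup E₁] [NormedSpace ℝ E₁]
  {H₁ : Type*} [TopologicalSpace H₁] {I₁ : ModelWithCorners ℝ E₁ H₁}
  {E₂ : Type*} [NormedAddCommGroup E₂] [NormedSpace ℝ E₂]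
  {H₂ : Type*} [TopologicalSpace H₂] {I₂ : ModelWithCorners ℝ E₂ H₂}
  {F₁ : Type*} [NormedAddCommGroup F₁] [NormedSpace ℝ F₁]
  {G₁ : Type*} [TopologicalSpace G₁] {J₁ : ModelWithCorners ℝ F₁ G₁}
  {F₂ : Type*} [NormedAddCommGroup F₂] [NormedSpace ℝ F₂]
  {G₂ : Type*} [TopologicalSpace G₂] {J₂ : ModelWithCorners ℝ F₂ G₂}
  {F : Type*} [NormedAddCommGroup F] [NormedSpace ℝ F]
  {W₁ : Type*} [TopologicalSpace W₁] [ChartedSpace H₁ W₁]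
  {W₂ : Type*} [TopologicalSpace W₂] [ChartedSpace H₂ W₂]
  {P₁ : Type*} [TopologicalSpace P₁] [ChartedSpace G₁ P₁] [MulAction Circle P₁]
  {P₂ : Type*} [TopologicalSpace P₂] [ChartedSpace G₂ P₂] [MulAction Circle P₂]
  {a b m n : ℤ} (hmn : m * b + n * a = 1) {π₁ : P₁ → W₁} {π₂ : P₂ → W₂}
  (h₁ : IsPrincipalCircleBundle I₁ J₁ π₁) (h₂ : IsPrincipalCircleBundle I₂ J₂ π₂)
  {e₁ : Bundle.Trivialization Circle π₁} {e₂ : Bundle.Trivialization Circle π₂}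
  (he₁ : IsSmoothTrivialization I₁ J₁ e₁) (he₂ : IsSmoothTrivialization I₂ J₂ e₂)

namespace OrbitSpace

variable (π₁ π₂) in
/-- The projection of the space of orbits induced by invariant maps. -/
def proj (x : OrbitSpace a b P₁ P₂) : W₁ × W₂ := (π₁ x.out.1, π₂ x.out.2)

include h₁ h₂ in
theorem proj_mk (p : P₁) (q : P₂) : proj π₁ π₂ (mk a b (p, q)) = (π₁ p, π₂ q) := by
  obtain ⟨θ, hp, hq⟩ := (mk_eq_iff a b).1 (mk_out (mk a b (p, q)))
  rw [proj, hp, hq, h₁.proj_smul, h₂.proj_smul]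

include h₁ h₂ in
theorem isOpenQuotientMap_mk_of_bundle :
    IsOpenQuotientMap (mk a b : P₁ × P₂ → OrbitSpace a b P₁ P₂) :=
  isOpenQuotientMap_mk a b (fun z => (contMDiff_circle_const_smul h₁.smooth_smul z).continuous)
    (fun z => (contMDiff_circle_const_smul h₂.smooth_smul z).continuous)

include h₁ h₂ in
theorem continuous_proj : Continuous (proj π₁ π₂ : OrbitSpace a b P₁ P₂ → W₁ × W₂) := by
  refine (isOpenQuotientMap_mk_of_bundle h₁ h₂).isQuotientMap.continuous_iff.2 ?_
  refine Continuous.congr ((h₁.contMDiff_proj.continuous.comp continuous_fst).prodMk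
    (h₂.contMDiff_proj.continuous.comp continuous_snd)) ?_
  rintro ⟨p, q⟩
  exact (proj_mk h₁ h₂ p q).symm

variable (e₁ e₂) in
/-- The fibre coordinate of the trivialization of the space of orbits. -/
def fiberCoord (x : OrbitSpace a b P₁ P₂) : Circle := (e₁ x.out.1).2 ^ b * (e₂ x.out.2).2 ^ a

include he₁ he₂ in
-- Changing the representative by `θ` multiplies the coordinate by `θ ^ (a * b)` and by its inverse.
theorem fiberCoord_mk {p : P₁} {q : P₂} (hp : π₁ p ∈ e₁.baseSet) (hq : π₂ q ∈ e₂.baseSet) :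
    fiberCoord e₁ e₂ (mk a b (p, q)) = (e₁ p).2 ^ b * (e₂ q).2 ^ a := by
  obtain ⟨θ, hp', hq'⟩ := (mk_eq_iff a b).1 (mk_out (mk a b (p, q)))
  rw [fiberCoord, hp', hq', (he₁.smul p hp _).2, (he₂.smul q hq _).2, mul_zpow, mul_zpow,
    ← zpow_mul, ← zpow_mul, neg_mul, zpow_neg, mul_comm a b]
  rw [mul_mul_mul_comm, mul_inv_cancel, one_mul]

variable (e₁ e₂ m n) in
/-- The section of the quotient map determined by two trivializations, in coordinates. -/
def localSection (w : (W₁ × W₂) × Circle) : P₁ × P₂ :=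
  (e₁.toOpenPartialHomeomorph.symm (w.1.1, w.2 ^ m),
    e₂.toOpenPartialHomeomorph.symm (w.1.2, w.2 ^ n))

include hmn he₁ he₂ in
-- With `ζ = z ^ b * w ^ a`, the section has fibre coordinates `(ζ ^ m, ζ ^ n)`, which by the Bézout
-- identities are those of `(p, q)` moved by `θ = w ^ m * z ^ (-n)`. The orbit is the same.
theorem mk_localSection {p : P₁} {q : P₂} (hp : π₁ p ∈ e₁.baseSet) (hq : π₂ q ∈ e₂.baseSet) :
    mk a b (localSection m n e₁ e₂ ((π₁ p, π₂ q), (e₁ p).2 ^ b * (e₂ q).2 ^ a)) = mk a b (p, q) := by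
  set z := (e₁ p).2
  set w := (e₂ q).2
  have e1 : e₁.toOpenPartialHomeomorph.symm (π₁ p, (z ^ b * w ^ a) ^ m) =
      (w ^ m * z ^ (-n)) ^ a • p := by
    rw [zpow_mul_zpow_pow_eq hmn, he₁.symm_apply hp]
  have e2 : e₂.toOpenPartialHomeomorph.symm (π₂ q, (z ^ b * w ^ a) ^ n) =
      (w ^ m * z ^ (-n)) ^ (-b) • q := by
    rw [zpow_mul_zpow_pow_eq' hmn, he₂.symm_apply hq]
  rw [localSection, e1, e2, mk_zpow_smul]

theorem continuousOn_localSection :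
    ContinuousOn (localSection m n e₁ e₂) ((e₁.baseSet ×ˢ e₂.baseSet) ×ˢ univ) := by
  refine ContinuousOn.prodMk ?_ ?_
  · refine e₁.toOpenPartialHomeomorph.continuousOn_symm.comp
      ((continuous_fst.comp continuous_fst).prodMk (continuous_snd.zpow m)).continuousOn fun w hw => ?_
    exact e₁.mem_target.2 hw.1.1
  · refine e₂.toOpenPartialHomeomorph.continuousOn_symm.comp
      ((continuous_snd.comp continuous_fst).prodMk (continuous_snd.zpow n)).continuousOn fun w hw => ?_
    exact e₂.mem_target.2 hw.1.2

theorem proj_localSection {w : (W₁ × W₂) × Circle} (hw : w.1 ∈ e₁.baseSet ×ˢ e₂.baseSet) :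
    π₁ (localSection m n e₁ e₂ w).1 = w.1.1 ∧ π₂ (localSection m n e₁ e₂ w).2 = w.1.2 :=
  ⟨e₁.proj_symm_apply (e₁.mem_target.2 hw.1), e₂.proj_symm_apply (e₂.mem_target.2 hw.2)⟩

theorem coord_localSection {w : (W₁ × W₂) × Circle} (hw : w.1 ∈ e₁.baseSet ×ˢ e₂.baseSet) :
    (e₁ (localSection m n e₁ e₂ w).1).2 = w.2 ^ m ∧
      (e₂ (localSection m n e₁ e₂ w).2).2 = w.2 ^ n :=
  ⟨congrArg Prod.snd (e₁.apply_symm_apply (x := (w.1.1, w.2 ^ m)) (e₁.mem_target.2 hw.1)),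
    congrArg Prod.snd (e₂.apply_symm_apply (x := (w.1.2, w.2 ^ n)) (e₂.mem_target.2 hw.2))⟩

include he₁ he₂ in
theorem contMDiffOn_localSection : ContMDiffOn ((I₁.prod I₂).prod (𝓡 1)) (J₁.prod J₂) ∞
    (localSection m n e₁ e₂) ((e₁.baseSet ×ˢ e₂.baseSet) ×ˢ univ) := by
  have hz : ∀ k : ℤ, ContMDiff ((I₁.prod I₂).prod (𝓡 1)) (𝓡 1) ∞
      (fun w : (W₁ × W₂) × Circle => w.2 ^ k) := fun k w =>
    ContMDiffAt.circle_zpow contMDiffAt_snd k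
  refine ContMDiffOn.prodMk ?_ ?_
  · refine he₁.contMDiffOn_symm.comp
      ((contMDiff_fst.comp contMDiff_fst).prodMk (hz m)).contMDiffOn fun w hw => ?_
    exact e₁.mem_target.2 hw.1.1
  · refine he₂.contMDiffOn_symm.comp
      ((contMDiff_snd.comp contMDiff_fst).prodMk (hz n)).contMDiffOn fun w hw => ?_
    exact e₂.mem_target.2 hw.1.2

/-- The trivialization of the space of orbits induced by trivializations of the two bundles. -/
def trivialization : Bundle.Trivialization Circle
    (proj π₁ π₂ : OrbitSpace a b P₁ P₂ → W₁ × W₂) where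
  toFun x := (proj π₁ π₂ x, fiberCoord e₁ e₂ x)
  invFun w := mk a b (localSection m n e₁ e₂ w)
  source := proj π₁ π₂ ⁻¹' (e₁.baseSet ×ˢ e₂.baseSet)
  target := (e₁.baseSet ×ˢ e₂.baseSet) ×ˢ univ
  baseSet := e₁.baseSet ×ˢ e₂.baseSet
  open_baseSet := e₁.open_baseSet.prod e₂.open_baseSet
  source_eq := rfl
  target_eq := rfl
  proj_toFun _ _ := rfl
  open_source := (e₁.open_baseSet.prod e₂.open_baseSet).preimage (continuous_proj h₁ h₂)
  open_target := (e₁.open_baseSet.prod e₂.open_baseSet).prod isOpen_univ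
  map_source' x hx := ⟨hx, trivial⟩
  map_target' w hw := by
    rw [mem_preimage]
    have := proj_localSection (m := m) (n := n) hw.1
    change proj π₁ π₂ (mk a b ((localSection m n e₁ e₂ w).1, (localSection m n e₁ e₂ w).2)) ∈ _
    rw [proj_mk h₁ h₂, this.1, this.2]
    exact hw.1
  left_inv' x hx := by
    obtain ⟨⟨p, q⟩, rfl⟩ := mk_surjective a b x
    rw [mem_preimage, proj_mk h₁ h₂] at hx
    rw [proj_mk h₁ h₂, fiberCoord_mk he₁ he₂ hx.1 hx.2]
    exact mk_localSection hmn he₁ he₂ hx.1 hx.2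
  right_inv' w hw := by
    have h3 := proj_localSection (m := m) (n := n) hw.1
    have h4 := coord_localSection (m := m) (n := n) hw.1
    change (proj π₁ π₂ (mk a b ((localSection m n e₁ e₂ w).1, (localSection m n e₁ e₂ w).2)),
      fiberCoord e₁ e₂ (mk a b ((localSection m n e₁ e₂ w).1, (localSection m n e₁ e₂ w).2))) = _
    rw [proj_mk h₁ h₂, fiberCoord_mk he₁ he₂ (by rw [h3.1]; exact hw.1.1)
      (by rw [h3.2]; exact hw.1.2), h3.1, h3.2, h4.1, h4.2, zpow_zpow_mul_zpow_zpow hmn]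
  continuousOn_toFun := by
    refine (continuous_proj h₁ h₂).continuousOn.prodMk ?_
    have hq := isOpenQuotientMap_mk_of_bundle (a := a) (b := b) h₁ h₂
    have hsrc : IsOpen (proj π₁ π₂ ⁻¹' (e₁.baseSet ×ˢ e₂.baseSet) : Set (OrbitSpace a b P₁ P₂)) :=
      (e₁.open_baseSet.prod e₂.open_baseSet).preimage (continuous_proj h₁ h₂)
    -- Continuity on an open set of the quotient can be tested upstairs, where the coordinate is
    -- explicit.
    rw [hq.isQuotientMap.continuousOn_isOpen_iff hsrc]
    have hmem : ∀ x ∈ mk a b ⁻¹' (proj π₁ π₂ ⁻¹' (e₁.baseSet ×ˢ e₂.baseSet)),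
        π₁ x.1 ∈ e₁.baseSet ∧ π₂ x.2 ∈ e₂.baseSet := by
      rintro ⟨p, q⟩ hx
      rw [mem_preimage, mem_preimage, proj_mk h₁ h₂] at hx
      exact hx
    have hc : ContinuousOn (fun x : P₁ × P₂ => (e₁ x.1).2 ^ b * (e₂ x.2).2 ^ a)
        (mk a b ⁻¹' (proj π₁ π₂ ⁻¹' (e₁.baseSet ×ˢ e₂.baseSet))) := by
      refine ContinuousOn.mul (ContinuousOn.zpow (continuous_snd.comp_continuousOn
        (e₁.continuousOn_toFun.comp continuous_fst.continuousOn ?_)) b)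
        (ContinuousOn.zpow (continuous_snd.comp_continuousOn
        (e₂.continuousOn_toFun.comp continuous_snd.continuousOn ?_)) a)
      · exact fun x hx => e₁.mem_source.2 (hmem x hx).1
      · exact fun x hx => e₂.mem_source.2 (hmem x hx).2
    refine hc.congr ?_
    rintro ⟨p, q⟩ hx
    exact fiberCoord_mk he₁ he₂ (hmem _ hx).1 (hmem _ hx).2
  continuousOn_invFun :=
    (isOpenQuotientMap_mk_of_bundle h₁ h₂).continuous.comp_continuousOn continuousOn_localSection

end OrbitSpace

end OrbitSpaceBundle

/-! ### The smooth structure of the orbit space -/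

section OrbitSpaceBundle

variable {E₁ : Type*} [NormedAddCommGroup E₁] [NormedSpace ℝ E₁]
  {H₁ : Type*} [TopologicalSpace H₁] {I₁ : ModelWithCorners ℝ E₁ H₁}
  {E₂ : Type*} [NormedAddCommGroup E₂] [NormedSpace ℝ E₂]
  {H₂ : Type*} [TopologicalSpace H₂] {I₂ : ModelWithCorners ℝ E₂ H₂}
  {F₁ : Type*} [NormedAddCommGroup F₁] [NormedSpace ℝ F₁]
  {G₁ : Type*} [TopologicalSpace G₁] {J₁ : ModelWithCorners ℝ F₁ G₁}
  {F₂ : Type*} [NormedAddCommGroup F₂] [NormedSpace ℝ F₂]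
  {G₂ : Type*} [TopologicalSpace G₂] {J₂ : ModelWithCorners ℝ F₂ G₂}
  {F : Type*} [NormedAddCommGroup F] [NormedSpace ℝ F]
  {W₁ : Type*} [TopologicalSpace W₁] [ChartedSpace H₁ W₁]
  {W₂ : Type*} [TopologicalSpace W₂] [ChartedSpace H₂ W₂]
  {P₁ : Type*} [TopologicalSpace P₁] [ChartedSpace G₁ P₁] [MulAction Circle P₁]
  {P₂ : Type*} [TopologicalSpace P₂] [ChartedSpace G₂ P₂] [MulAction Circle P₂]
  {a b m n : ℤ} (hmn : m * b + n * a = 1) {π₁ : P₁ → W₁} {π₂ : P₂ → W₂}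
  (h₁ : IsPrincipalCircleBundle I₁ J₁ π₁) (h₂ : IsPrincipalCircleBundle I₂ J₂ π₂)
  {e₁ : Bundle.Trivialization Circle π₁} {e₂ : Bundle.Trivialization Circle π₂}
  (he₁ : IsSmoothTrivialization I₁ J₁ e₁) (he₂ : IsSmoothTrivialization I₂ J₂ e₂)

namespace OrbitSpace

include he₁ he₂ in
theorem contMDiffAt_coord {x : P₁ × P₂} (hp : π₁ x.1 ∈ e₁.baseSet) (hq : π₂ x.2 ∈ e₂.baseSet) :
    ContMDiffAt (J₁.prod J₂) (𝓡 1) ∞ (fun x : P₁ × P₂ => (e₁ x.1).2 ^ b * (e₂ x.2).2 ^ a) x := by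
  have k1 : ContMDiffAt J₁ (I₁.prod (𝓡 1)) ∞ e₁ x.1 :=
    he₁.contMDiffOn.contMDiffAt (e₁.open_source.mem_nhds (e₁.mem_source.2 hp))
  have k2 : ContMDiffAt J₂ (I₂.prod (𝓡 1)) ∞ e₂ x.2 :=
    he₂.contMDiffOn.contMDiffAt (e₂.open_source.mem_nhds (e₂.mem_source.2 hq))
  exact (ContMDiffAt.circle_zpow (contMDiffAt_snd.comp x (k1.comp x contMDiffAt_fst)) b).mul
    (ContMDiffAt.circle_zpow (contMDiffAt_snd.comp x (k2.comp x contMDiffAt_snd)) a)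

/-- The transition keeps the base point and evaluates the new fibre coordinate on the smooth local
section of the old trivialization, so it factors through smooth maps of `P₁ × P₂`. -/
theorem trivialization_transition {e₁' : Bundle.Trivialization Circle π₁}
    {e₂' : Bundle.Trivialization Circle π₂}
    (he₁' : IsSmoothTrivialization I₁ J₁ e₁') (he₂' : IsSmoothTrivialization I₂ J₂ e₂') :
    ContMDiffOn ((I₁.prod I₂).prod (𝓡 1)) ((I₁.prod I₂).prod (𝓡 1)) ∞
      ((trivialization hmn h₁ h₂ he₁' he₂').toOpenPartialHomeomorph ∘
        (trivialization hmn h₁ h₂ he₁ he₂).toOpenPartialHomeomorph.symm)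
      ((trivialization hmn h₁ h₂ he₁ he₂).toOpenPartialHomeomorph.symm.trans
        (trivialization hmn h₁ h₂ he₁' he₂').toOpenPartialHomeomorph).source := by
  have hsub : ((trivialization hmn h₁ h₂ he₁ he₂).toOpenPartialHomeomorph.symm.trans
        (trivialization hmn h₁ h₂ he₁' he₂').toOpenPartialHomeomorph).source ⊆
      {w | w.1 ∈ e₁.baseSet ×ˢ e₂.baseSet ∧ w.1 ∈ e₁'.baseSet ×ˢ e₂'.baseSet} := by
    intro w hw
    rw [OpenPartialHomeomorph.trans_source] at hw
    have hw1 : w.1 ∈ e₁.baseSet ×ˢ e₂.baseSet := hw.1.1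
    have hw2 : proj π₁ π₂ (mk a b ((localSection m n e₁ e₂ w).1, (localSection m n e₁ e₂ w).2)) ∈
      e₁'.baseSet ×ˢ e₂'.baseSet := hw.2
    have h3 := proj_localSection (m := m) (n := n) hw1
    rw [proj_mk h₁ h₂, h3.1, h3.2] at hw2
    exact ⟨hw1, hw2⟩
  refine ContMDiffOn.mono ?_ hsub
  have h3 : ∀ w ∈ {w : (W₁ × W₂) × Circle | w.1 ∈ e₁.baseSet ×ˢ e₂.baseSet ∧
      w.1 ∈ e₁'.baseSet ×ˢ e₂'.baseSet}, ContMDiffAt ((I₁.prod I₂).prod (𝓡 1))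
        ((I₁.prod I₂).prod (𝓡 1)) ∞ (fun w : (W₁ × W₂) × Circle => (w.1,
          (e₁' (localSection m n e₁ e₂ w).1).2 ^ b * (e₂' (localSection m n e₁ e₂ w).2).2 ^ a)) w := by
    intro w hw
    have h4 := proj_localSection (m := m) (n := n) hw.1
    have h5 : ContMDiffAt ((I₁.prod I₂).prod (𝓡 1)) (J₁.prod J₂) ∞ (localSection m n e₁ e₂) w :=
      (contMDiffOn_localSection he₁ he₂).contMDiffAt
        (((e₁.open_baseSet.prod e₂.open_baseSet).prod isOpen_univ).mem_nhds ⟨hw.1, trivial⟩)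
    refine contMDiffAt_fst.prodMk ((contMDiffAt_coord (a := a) (b := b) he₁' he₂' ?_ ?_).comp w h5)
    · rw [h4.1]
      exact hw.2.1
    · rw [h4.2]
      exact hw.2.2
  refine ContMDiffOn.congr (fun w hw => (h3 w hw).contMDiffWithinAt) fun w hw => ?_
  have h4 := proj_localSection (m := m) (n := n) hw.1
  change (proj π₁ π₂ (mk a b ((localSection m n e₁ e₂ w).1, (localSection m n e₁ e₂ w).2)),
    fiberCoord e₁' e₂' (mk a b ((localSection m n e₁ e₂ w).1, (localSection m n e₁ e₂ w).2))) = _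
  rw [proj_mk h₁ h₂, fiberCoord_mk he₁' he₂' (by rw [h4.1]; exact hw.2.1)
    (by rw [h4.2]; exact hw.2.2), h4.1, h4.2]

variable [I₁.Boundaryless] [I₂.Boundaryless] [IsManifold I₁ ∞ W₁] [IsManifold I₂ ∞ W₂]

/-- The space of orbits is a manifold, and a principal circle bundle over the product. -/
theorem exists_manifold_structure (L : ((E₁ × E₂) × EuclideanSpace ℝ (Fin 1)) ≃L[ℝ] F)
    (hmn : m * b + n * a = 1) (h₁ : IsPrincipalCircleBundle I₁ J₁ π₁)
    (h₂ : IsPrincipalCircleBundle I₂ J₂ π₂) :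
    ∃ (_ : ChartedSpace F (OrbitSpace a b P₁ P₂)) (_ : MulAction Circle (OrbitSpace a b P₁ P₂)),
      IsManifold 𝓘(ℝ, F) ∞ (OrbitSpace a b P₁ P₂) ∧
      ContMDiff (J₁.prod J₂) 𝓘(ℝ, F) ∞ (mk a b : P₁ × P₂ → OrbitSpace a b P₁ P₂) ∧
      (∀ x : P₁ × P₂, ∃ (U : Set (OrbitSpace a b P₁ P₂)) (τ : OrbitSpace a b P₁ P₂ → P₁ × P₂),
        IsOpen U ∧ mk a b x ∈ U ∧ ContMDiffOn 𝓘(ℝ, F) (J₁.prod J₂) ∞ τ U ∧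
        (∀ y ∈ U, mk a b (τ y) = y) ∧ τ (mk a b x) = x) ∧
      (∀ (z : Circle) (p : P₁) (q : P₂),
        z • mk a b (p, q) = mk a b (z ^ m • p, z ^ n • q)) ∧
      IsPrincipalCircleBundle (I₁.prod I₂) 𝓘(ℝ, F)
        (proj π₁ π₂ : OrbitSpace a b P₁ P₂ → W₁ × W₂) := by
  choose t₁ ht₁ ht₁' using h₁.exists_isSmoothTrivialization
  choose t₂ ht₂ ht₂' using h₂.exists_isSmoothTrivialization
  let T : W₁ × W₂ → Bundle.Trivialization Circle
      (proj π₁ π₂ : OrbitSpace a b P₁ P₂ → W₁ × W₂) := fun w =>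
    trivialization hmn h₁ h₂ (ht₁' w.1) (ht₂' w.2)
  let e : OrbitSpace a b P₁ P₂ → OpenPartialHomeomorph (OrbitSpace a b P₁ P₂)
      ((W₁ × W₂) × Circle) := fun x => (T (proj π₁ π₂ x)).toOpenPartialHomeomorph
  have he : ∀ x, x ∈ (e x).source := fun x => ⟨ht₁ _, ht₂ _⟩
  have htr : ∀ x y, ContMDiffOn ((I₁.prod I₂).prod (𝓡 1)) ((I₁.prod I₂).prod (𝓡 1)) ∞
      (e y ∘ (e x).symm) ((e x).symm.trans (e y)).source := fun x y =>
    trivialization_transition hmn h₁ h₂ (ht₁' _) (ht₂' _) (ht₁' _) (ht₂' _)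
  let cs := gluedChartedSpace ((I₁.prod I₂).prod (𝓡 1)) L e he
  let act := residualAction P₁ P₂ a b m n
  have hact : ∀ (z : Circle) (p : P₁) (q : P₂),
      z • mk a b (p, q) = mk a b (z ^ m • p, z ^ n • q) := residualAction_smul_mk
  have hman : IsManifold 𝓘(ℝ, F) ∞ (OrbitSpace a b P₁ P₂) := isManifold_glued _ L e he htr
  have hsm : ∀ x, ContMDiffOn 𝓘(ℝ, F) ((I₁.prod I₂).prod (𝓡 1)) ∞ (e x) (e x).source :=
    contMDiffOn_glued _ L e he htr
  have hsm' : ∀ x, ContMDiffOn ((I₁.prod I₂).prod (𝓡 1)) 𝓘(ℝ, F) ∞ (e x).symm (e x).target :=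
    contMDiffOn_glued_symm _ L e he htr
  have hmk : ContMDiff (J₁.prod J₂) 𝓘(ℝ, F) ∞
      (mk a b : P₁ × P₂ → OrbitSpace a b P₁ P₂) := by
    rintro ⟨p, q⟩
    have hs := he (mk a b (p, q))
    have hpq : proj π₁ π₂ (mk a b (p, q) : OrbitSpace a b P₁ P₂) = (π₁ p, π₂ q) := proj_mk h₁ h₂ p q
    have k1 : ContMDiffAt (J₁.prod J₂) ((I₁.prod I₂).prod (𝓡 1)) ∞ (fun x : P₁ × P₂ =>
        ((π₁ x.1, π₂ x.2), (t₁ (π₁ p) x.1).2 ^ b * (t₂ (π₂ q) x.2).2 ^ a)) (p, q) :=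
      ((h₁.contMDiff_proj.comp contMDiff_fst).contMDiffAt.prodMk
        (h₂.contMDiff_proj.comp contMDiff_snd).contMDiffAt).prodMk
        (contMDiffAt_coord (ht₁' _) (ht₂' _) (ht₁ _) (ht₂ _))
    have hopen : ∀ᶠ x : P₁ × P₂ in 𝓝 (p, q), π₁ x.1 ∈ (t₁ (π₁ p)).baseSet ∧
        π₂ x.2 ∈ (t₂ (π₂ q)).baseSet :=
      ((h₁.contMDiff_proj.continuous.comp continuous_fst).continuousAt.eventually_mem
        ((t₁ (π₁ p)).open_baseSet.mem_nhds (ht₁ _))).and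
      ((h₂.contMDiff_proj.continuous.comp continuous_snd).continuousAt.eventually_mem
        ((t₂ (π₂ q)).open_baseSet.mem_nhds (ht₂ _)))
    -- The quotient map is near `(p, q)` the inverse trivialization applied to the smooth
    -- coordinates of `k1`.
    have k2 := hsm' (mk a b (p, q))
    simp only [e, T] at k2
    rw [hpq] at k2
    refine ContMDiffAt.congr_of_eventuallyEq (ContMDiffAt.comp_of_eq (k2.contMDiffAt
      (OpenPartialHomeomorph.open_target _ |>.mem_nhds ?_)) k1 rfl) ?_
    · exact ⟨⟨ht₁ _, ht₂ _⟩, trivial⟩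
    · filter_upwards [hopen] with x hx
      exact (mk_localSection hmn (ht₁' _) (ht₂' _) hx.1 hx.2).symm
  have hsec : ∀ x : P₁ × P₂, ∃ (U : Set (OrbitSpace a b P₁ P₂))
      (τ : OrbitSpace a b P₁ P₂ → P₁ × P₂),
      IsOpen U ∧ mk a b x ∈ U ∧ ContMDiffOn 𝓘(ℝ, F) (J₁.prod J₂) ∞ τ U ∧
      (∀ y ∈ U, mk a b (τ y) = y) ∧ τ (mk a b x) = x := by
    intro x
    set y₀ := mk a b x with hy₀
    let τ₀ := fun y => localSection m n (t₁ (proj π₁ π₂ y₀).1) (t₂ (proj π₁ π₂ y₀).2) (e y₀ y)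
    have hτ₀ : ContMDiffOn 𝓘(ℝ, F) (J₁.prod J₂) ∞ τ₀ (e y₀).source :=
      (contMDiffOn_localSection (ht₁' _) (ht₂' _)).comp (hsm y₀) fun y hy => ⟨hy, trivial⟩
    have hmkτ : ∀ y ∈ (e y₀).source, mk a b (τ₀ y) = y := fun y hy => (e y₀).left_inv hy
    -- The coordinate section meets the orbit of `x` in some point; translating it by `θ` makes it
    -- pass through `x` itself.
    obtain ⟨θ, hθ₁, hθ₂⟩ := (mk_eq_iff a b).1 (hmkτ y₀ (he y₀)).symm
    refine ⟨(e y₀).source, fun y => (θ ^ a • (τ₀ y).1, θ ^ (-b) • (τ₀ y).2), (e y₀).open_source,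
      he y₀, ?_, fun y hy => ?_, ?_⟩
    · exact ((contMDiff_circle_const_smul h₁.smooth_smul _).comp_contMDiffOn
        (contMDiff_fst.comp_contMDiffOn hτ₀)).prodMk
        ((contMDiff_circle_const_smul h₂.smooth_smul _).comp_contMDiffOn
        (contMDiff_snd.comp_contMDiffOn hτ₀))
    · rw [mk_zpow_smul]
      exact hmkτ y hy
    · exact Prod.ext hθ₁.symm hθ₂.symm
  refine ⟨cs, act, hman, hmk, hsec, hact, ?_, ?_⟩
  · rintro ⟨z, y⟩
    obtain ⟨x, rfl⟩ := mk_surjective a b y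
    obtain ⟨U, τ, hU, hxU, hτ, hmkτ, -⟩ := hsec x
    have k0 : ContMDiffAt ((𝓡 1).prod 𝓘(ℝ, F)) (J₁.prod J₂) ∞
        (fun y : Circle × OrbitSpace a b P₁ P₂ => τ y.2) (z, mk a b x) :=
      ContMDiffAt.comp (z, mk a b x) (hτ.contMDiffAt (hU.mem_nhds hxU)) contMDiffAt_snd
    have k1 : ContMDiffAt ((𝓡 1).prod 𝓘(ℝ, F)) (J₁.prod J₂) ∞
        (fun y : Circle × OrbitSpace a b P₁ P₂ => (y.1 ^ m • (τ y.2).1, y.1 ^ n • (τ y.2).2))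
        (z, mk a b x) :=
      (ContMDiffAt.circle_smul h₁.smooth_smul (ContMDiffAt.circle_zpow contMDiffAt_fst m)
        (contMDiffAt_fst.comp _ k0)).prodMk
      (ContMDiffAt.circle_smul h₂.smooth_smul (ContMDiffAt.circle_zpow contMDiffAt_fst n)
        (contMDiffAt_snd.comp _ k0))
    refine (hmk.contMDiffAt.comp _ k1).congr_of_eventuallyEq ?_
    filter_upwards [continuous_snd.continuousAt.eventually_mem (hU.mem_nhds hxU)] with y hy
    exact (congrArg (fun q => y.1 • q) (hmkτ y.2 hy)).symm.trans (hact _ _ _)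
  · intro w
    refine ⟨T w, ⟨ht₁ _, ht₂ _⟩, ?_, ?_, ?_⟩
    -- As `w` lies in the image of the projection, `T w` is one of the glued maps `e x`.
    all_goals
      obtain ⟨x, hx⟩ : ∃ x : OrbitSpace a b P₁ P₂, proj π₁ π₂ x = w :=
        ⟨_, (T w).proj_symm_apply (x := (w, 1)) ((T w).mem_target.2 ⟨ht₁ _, ht₂ _⟩)⟩
    · rw [← hx]
      exact hsm x
    · rw [← hx]
      exact hsm' x
    · intro y hy z
      obtain ⟨⟨p, q⟩, rfl⟩ := mk_surjective a b y
      have hpq : π₁ p ∈ (t₁ w.1).baseSet ∧ π₂ q ∈ (t₂ w.2).baseSet := by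
        rw [proj_mk h₁ h₂] at hy
        exact hy
      have k1 := (ht₁' w.1).smul p hpq.1 (z ^ m)
      have k2 := (ht₂' w.2).smul q hpq.2 (z ^ n)
      have e1 : ∀ p q, π₁ p ∈ (t₁ w.1).baseSet → π₂ q ∈ (t₂ w.2).baseSet →
          (T w (mk a b (p, q))).2 = (t₁ w.1 p).2 ^ b * (t₂ w.2 q).2 ^ a := fun p q hp hq =>
        fiberCoord_mk (ht₁' _) (ht₂' _) hp hq
      rw [hact, proj_mk h₁ h₂, proj_mk h₁ h₂, k1.1, k2.1, e1 _ _ hpq.1 hpq.2,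
        e1 _ _ (by rw [k1.1]; exact hpq.1) (by rw [k2.1]; exact hpq.2), k1.2, k2.2, mul_zpow,
        mul_zpow, mul_mul_mul_comm, zpow_zpow_mul_zpow_zpow hmn]
      exact ⟨rfl, rfl⟩

end OrbitSpace

end OrbitSpaceBundle

/-! ### The orbit space as the circle bundle of the tensor product -/

section OrbitSpaceBundle

variable {E₁ : Type*} [NormedAddCommGroup E₁] [NormedSpace ℝ E₁]
  {H₁ : Type*} [TopologicalSpace H₁] {I₁ : ModelWithCorners ℝ E₁ H₁}
  {E₂ : Type*} [NormedAddCommGroup E₂] [NormedSpace ℝ E₂]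
  {H₂ : Type*} [TopologicalSpace H₂] {I₂ : ModelWithCorners ℝ E₂ H₂}
  {F₁ : Type*} [NormedAddCommGroup F₁] [NormedSpace ℝ F₁]
  {G₁ : Type*} [TopologicalSpace G₁] {J₁ : ModelWithCorners ℝ F₁ G₁}
  {F₂ : Type*} [NormedAddCommGroup F₂] [NormedSpace ℝ F₂]
  {G₂ : Type*} [TopologicalSpace G₂] {J₂ : ModelWithCorners ℝ F₂ G₂}
  {F : Type*} [NormedAddCommGroup F] [NormedSpace ℝ F]
  {G : Type*} [TopologicalSpace G] {J : ModelWithCorners ℝ F G}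
  {F' : Type*} [NormedAddCommGroup F'] [NormedSpace ℝ F']
  {G' : Type*} [TopologicalSpace G'] {J' : ModelWithCorners ℝ F' G'}
  {W₁ : Type*} [TopologicalSpace W₁] [ChartedSpace H₁ W₁]
  {W₂ : Type*} [TopologicalSpace W₂] [ChartedSpace H₂ W₂]
  {P₁ : Type*} [TopologicalSpace P₁] [ChartedSpace G₁ P₁] [MulAction Circle P₁]
  {P₂ : Type*} [TopologicalSpace P₂] [ChartedSpace G₂ P₂] [MulAction Circle P₂]

namespace IsPrincipalCircleBundle

theorem exists_preimage {π₁ : P₁ → W₁} (h₁ : IsPrincipalCircleBundle I₁ J₁ π₁) (w : W₁) :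
    ∃ p, π₁ p = w := by
  obtain ⟨e, he, -, -, -⟩ := h₁.locally_trivial w
  exact ⟨_, e.proj_symm_apply (x := (w, 1)) (e.mem_target.2 he)⟩

theorem exists_section_at {π₁ : P₁ → W₁} (h₁ : IsPrincipalCircleBundle I₁ J₁ π₁) (w : W₁) :
    ∃ (U : Set W₁) (s : W₁ → P₁), IsOpen U ∧ w ∈ U ∧ ContMDiffOn I₁ J₁ ∞ s U ∧
      ∀ u ∈ U, π₁ (s u) = u := by
  obtain ⟨p, rfl⟩ := h₁.exists_preimage w
  obtain ⟨U, s, hU, hp, hs, hs', -⟩ := h₁.exists_section p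
  exact ⟨U, s, hU, hp, hs, hs'⟩

theorem circleDiv_smul_right {π₁ : P₁ → W₁} (h₁ : IsPrincipalCircleBundle I₁ J₁ π₁)
    {p q : P₁} (h : π₁ p = π₁ q) (z : Circle) : circleDiv p (z • q) = z * circleDiv p q := by
  refine h₁.circleDiv_eq ?_
  rw [mul_smul, h₁.circleDiv_smul h]

theorem circleDiv_mul_circleDiv {π₁ : P₁ → W₁} (h₁ : IsPrincipalCircleBundle I₁ J₁ π₁)
    {p q r : P₁} (h : π₁ p = π₁ q) (h' : π₁ q = π₁ r) :
    circleDiv q r * circleDiv p q = circleDiv p r := by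
  refine (h₁.circleDiv_eq ?_).symm
  rw [mul_smul, h₁.circleDiv_smul h, h₁.circleDiv_smul h']

end IsPrincipalCircleBundle

open DiffForm OrbitSpace

variable {a b : ℤ} [ChartedSpace G (OrbitSpace a b P₁ P₂)]
  [MulAction Circle (OrbitSpace a b P₁ P₂)]

variable (I₁ I₂ J₁ J₂ J) in
/-- The space of orbits, with a smooth structure for which the quotient map is a submersion, as a
principal circle bundle over the product, with the action induced by a solution of
`m * b + n * a = 1`. -/
structure IsOrbitBundle (m n : ℤ) (π₁ : P₁ → W₁) (π₂ : P₂ → W₂)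
    (π : OrbitSpace a b P₁ P₂ → W₁ × W₂) : Prop where
  bezout : m * b + n * a = 1
  fst_bundle : IsPrincipalCircleBundle I₁ J₁ π₁
  snd_bundle : IsPrincipalCircleBundle I₂ J₂ π₂
  contMDiff_mk : ContMDiff (J₁.prod J₂) J ∞ (OrbitSpace.mk a b : P₁ × P₂ → OrbitSpace a b P₁ P₂)
  exists_section : ∀ x : P₁ × P₂, ∃ (U : Set (OrbitSpace a b P₁ P₂))
    (τ : OrbitSpace a b P₁ P₂ → P₁ × P₂), IsOpen U ∧ OrbitSpace.mk a b x ∈ U ∧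
      ContMDiffOn J (J₁.prod J₂) ∞ τ U ∧ (∀ y ∈ U, OrbitSpace.mk a b (τ y) = y) ∧
      τ (OrbitSpace.mk a b x) = x
  smul_mk : ∀ (z : Circle) (p : P₁) (q : P₂),
    z • OrbitSpace.mk a b (p, q) = OrbitSpace.mk a b (z ^ m • p, z ^ n • q)
  proj_mk : ∀ (p : P₁) (q : P₂), π (OrbitSpace.mk a b (p, q)) = (π₁ p, π₂ q)
  bundle : IsPrincipalCircleBundle (I₁.prod I₂) J π

namespace IsOrbitBundle

variable {m n : ℤ} {π₁ : P₁ → W₁} {π₂ : P₂ → W₂} {π : OrbitSpace a b P₁ P₂ → W₁ × W₂}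
  (h : IsOrbitBundle I₁ I₂ J₁ J₂ J m n π₁ π₂ π)

include h

/-- The element `z ^ b * w ^ a` acts through its powers `m` and `n`, which by the Bézout identities
agree with `(z, w)` up to the weighted circle. In particular the action does not depend on the
choice of `m` and `n`. -/
theorem mk_smul_smul (z w : Circle) (p : P₁) (q : P₂) :
    OrbitSpace.mk a b (z • p, w • q) = (z ^ b * w ^ a) • OrbitSpace.mk a b (p, q) := by
  rw [h.smul_mk, zpow_mul_zpow_pow_eq h.bezout, zpow_mul_zpow_pow_eq' h.bezout, mul_smul,
    mul_smul, mk_zpow_smul]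

theorem mfderiv_mk_surjective (x : P₁ × P₂) :
    Function.Surjective (mfderiv (J₁.prod J₂) J
      (OrbitSpace.mk a b : P₁ × P₂ → OrbitSpace a b P₁ P₂) x) := by
  obtain ⟨U, τ, hU, hxU, hτ, hτ', hτx⟩ := h.exists_section x
  have hτd : MDifferentiableAt J (J₁.prod J₂) τ (OrbitSpace.mk a b x) :=
    (hτ.contMDiffAt (hU.mem_nhds hxU)).mdifferentiableAt (by simp)
  have hmd := h.contMDiff_mk.contMDiffAt.mdifferentiableAt (x := x) (by simp)
  have h1 : mfderivModel J J (OrbitSpace.mk a b ∘ τ) (OrbitSpace.mk a b x) =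
      mfderivModel J J id (OrbitSpace.mk a b x) := by
    refine mfderivModel_congr ?_
    filter_upwards [hU.mem_nhds hxU] with u hu using hτ' u hu
  rw [mfderivModel_comp hτd hmd hτx, mfderivModel_id] at h1
  intro w
  exact ⟨mfderivModel J (J₁.prod J₂) τ (OrbitSpace.mk a b x) w,
    congrArg (fun A : F →L[ℝ] F => A w) h1⟩

/-- The images of pairs of sections serve as the sections `σ x y`; `mk_smul_smul` gives their
transition functions. -/
theorem isTensorCircleBundle : IsTensorCircleBundle I₁ I₂ J₁ J₂ J b a π₁ π₂ π := by
  choose U s₁ hU hxU hs₁ hs₁' using h.fst_bundle.exists_section_at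
  choose V s₂ hV hyV hs₂ hs₂' using h.snd_bundle.exists_section_at
  refine ⟨U, V, s₁, s₂, fun x y w => OrbitSpace.mk a b (s₁ x w.1, s₂ y w.2),
    fun x => ⟨hU x, hxU x, hs₁ x, hs₁' x⟩, fun y => ⟨hV y, hyV y, hs₂ y, hs₂' y⟩,
    fun x y => ⟨?_, fun w hw => ?_⟩, ?_⟩
  · exact h.contMDiff_mk.comp_contMDiffOn
      (((hs₁ x).comp contMDiffOn_fst fun w hw => hw.1).prodMk
        ((hs₂ y).comp contMDiffOn_snd fun w hw => hw.2))
  · rw [h.proj_mk, hs₁' x _ hw.1, hs₂' y _ hw.2]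
  · intro x x' y y' u _ v _ g₁ g₂ h1 h2
    simp only [h1, h2, h.mk_smul_smul]

/-- The space of orbits is isomorphic to every circle bundle of the tensor product. -/
theorem exists_equivariant_diffeomorph {S : Type*} [TopologicalSpace S] [ChartedSpace G' S]
    [MulAction Circle S] {πS : S → W₁ × W₂} (hS : IsPrincipalCircleBundle (I₁.prod I₂) J' πS)
    (hT : IsTensorCircleBundle I₁ I₂ J₁ J₂ J' b a π₁ π₂ πS) :
    ∃ Φ : OrbitSpace a b P₁ P₂ ≃ₘ^∞⟮J, J'⟯ S, (∀ x, πS (Φ x) = π x) ∧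
      ∀ (z : Circle) x, Φ (z • x) = z • Φ x := by
  obtain ⟨U, V, s₁, s₂, σ, hU, hV, hσ, htr⟩ := hT
  have h₁ := h.fst_bundle
  have h₂ := h.snd_bundle
  -- The equivariant map is forced once the pair `(s₁ x, s₂ y)` is sent to `σ x y`: the points are
  -- divided by the sections and the quotients enter with weights `b` and `a`.
  let Ψ : W₁ → W₂ → P₁ × P₂ → S := fun x y r =>
    (circleDiv (s₁ x (π₁ r.1)) r.1 ^ b * circleDiv (s₂ y (π₂ r.2)) r.2 ^ a) •
      σ x y (π₁ r.1, π₂ r.2)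
  -- The cocycle relation for `σ` compensates the change of the divisions `circleDiv`.
  have hindep : ∀ x x' y y' (r : P₁ × P₂), π₁ r.1 ∈ U x ∩ U x' → π₂ r.2 ∈ V y ∩ V y' →
      Ψ x' y' r = Ψ x y r := by
    intro x x' y y' r hr1 hr2
    have e1 : π₁ (s₁ x (π₁ r.1)) = π₁ r.1 := (hU x).2.2.2 _ hr1.1
    have e1' : π₁ (s₁ x' (π₁ r.1)) = π₁ r.1 := (hU x').2.2.2 _ hr1.2
    have e2 : π₂ (s₂ y (π₂ r.2)) = π₂ r.2 := (hV y).2.2.2 _ hr2.1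
    have e2' : π₂ (s₂ y' (π₂ r.2)) = π₂ r.2 := (hV y').2.2.2 _ hr2.2
    have k := htr x x' y y' _ hr1 _ hr2 (circleDiv (s₁ x (π₁ r.1)) (s₁ x' (π₁ r.1)))
      (circleDiv (s₂ y (π₂ r.2)) (s₂ y' (π₂ r.2)))
      (h₁.circleDiv_smul (e1.trans e1'.symm)).symm (h₂.circleDiv_smul (e2.trans e2'.symm)).symm
    simp only [Ψ]
    rw [k, ← h₁.circleDiv_mul_circleDiv (e1.trans e1'.symm) e1',
      ← h₂.circleDiv_mul_circleDiv (e2.trans e2'.symm) e2', smul_smul, mul_zpow, mul_zpow,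
      mul_mul_mul_comm]
  -- The indices vary with the point here, so smoothness must use `hindep` to freeze them locally.
  let Ψ' : P₁ × P₂ → S := fun r => Ψ (π₁ r.1) (π₂ r.2) r
  have hΨeq : ∀ (z w : Circle) (p : P₁) (q : P₂),
      Ψ' (z • p, w • q) = (z ^ b * w ^ a) • Ψ' (p, q) := by
    intro z w p q
    have e1 : π₁ (s₁ (π₁ p) (π₁ p)) = π₁ p := (hU _).2.2.2 _ (hU _).2.1
    have e2 : π₂ (s₂ (π₂ q) (π₂ q)) = π₂ q := (hV _).2.2.2 _ (hV _).2.1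
    simp only [Ψ', Ψ]
    rw [h₁.proj_smul, h₂.proj_smul, h₁.circleDiv_smul_right e1, h₂.circleDiv_smul_right e2,
      mul_zpow, mul_zpow, mul_mul_mul_comm, mul_smul]
  have hΨinv : ∀ r r' : P₁ × P₂, OrbitSpace.mk a b r = OrbitSpace.mk a b r' → Ψ' r = Ψ' r' := by
    rintro ⟨p, q⟩ ⟨p', q'⟩ hr
    obtain ⟨θ, hp, hq⟩ := (mk_eq_iff a b).1 hr
    dsimp only at hp hq
    rw [hp, hq, hΨeq, ← zpow_mul, ← zpow_mul, neg_mul, mul_comm b a, zpow_neg, mul_inv_cancel,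
      one_smul]
  have hΨπ : ∀ r, πS (Ψ' r) = (π₁ r.1, π₂ r.2) := fun r => by
    simp only [Ψ', Ψ]
    rw [hS.proj_smul]
    exact (hσ _ _).2 _ ⟨(hU _).2.1, (hV _).2.1⟩
  have hΨs : ContMDiff (J₁.prod J₂) J' ∞ Ψ' := by
    intro r
    have hp1 : ContMDiffAt (J₁.prod J₂) I₁ ∞ (fun r : P₁ × P₂ => π₁ r.1) r :=
      (h₁.contMDiff_proj.comp contMDiff_fst).contMDiffAt
    have hp2 : ContMDiffAt (J₁.prod J₂) I₂ ∞ (fun r : P₁ × P₂ => π₂ r.2) r :=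
      (h₂.contMDiff_proj.comp contMDiff_snd).contMDiffAt
    have hU0 := (hU (π₁ r.1)).1.mem_nhds (hU (π₁ r.1)).2.1
    have hV0 := (hV (π₂ r.2)).1.mem_nhds (hV (π₂ r.2)).2.1
    have hev1 := hp1.continuousAt.eventually_mem hU0
    have hev2 := hp2.continuousAt.eventually_mem hV0
    have k1 : ContMDiffAt (J₁.prod J₂) J₁ ∞ (fun r' : P₁ × P₂ => s₁ (π₁ r.1) (π₁ r'.1)) r :=
      ContMDiffAt.comp r ((hU (π₁ r.1)).2.2.1.contMDiffAt hU0) hp1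
    have k2 : ContMDiffAt (J₁.prod J₂) J₂ ∞ (fun r' : P₁ × P₂ => s₂ (π₂ r.2) (π₂ r'.2)) r :=
      ContMDiffAt.comp r ((hV (π₂ r.2)).2.2.1.contMDiffAt hV0) hp2
    have d1 := h₁.contMDiffAt_circleDiv k1 contMDiffAt_fst (by
      filter_upwards [hev1] with r' hr'
      exact (hU _).2.2.2 _ hr')
    have d2 := h₂.contMDiffAt_circleDiv k2 contMDiffAt_snd (by
      filter_upwards [hev2] with r' hr'
      exact (hV _).2.2.2 _ hr')
    have k3 : ContMDiffAt (J₁.prod J₂) J' ∞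
        (fun r' : P₁ × P₂ => σ (π₁ r.1) (π₂ r.2) (π₁ r'.1, π₂ r'.2)) r :=
      ContMDiffAt.comp r ((hσ (π₁ r.1) (π₂ r.2)).1.contMDiffAt (prod_mem_nhds hU0 hV0))
        (hp1.prodMk hp2)
    have k4 : ContMDiffAt (J₁.prod J₂) J' ∞ (Ψ (π₁ r.1) (π₂ r.2)) r :=
      ContMDiffAt.circle_smul hS.smooth_smul ((d1.circle_zpow b).mul (d2.circle_zpow a)) k3
    refine k4.congr_of_eventuallyEq ?_
    filter_upwards [hev1, hev2] with r' hr1 hr2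
    exact hindep _ _ _ _ r' ⟨hr1, (hU _).2.1⟩ ⟨hr2, (hV _).2.1⟩
  let Φ : OrbitSpace a b P₁ P₂ → S := fun x => Ψ' x.out
  have hΦmk : ∀ r, Φ (OrbitSpace.mk a b r) = Ψ' r := fun r => hΨinv _ _ (mk_out _)
  have hΦs : ContMDiff J J' ∞ Φ := by
    intro x
    obtain ⟨r, rfl⟩ := mk_surjective a b x
    obtain ⟨A, τ, hA, hxA, hτ, hτ', -⟩ := h.exists_section r
    refine ((hΨs.contMDiffAt).comp _ (hτ.contMDiffAt (hA.mem_nhds hxA))).congr_of_eventuallyEq ?_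
    filter_upwards [hA.mem_nhds hxA] with y hy
    rw [Function.comp_apply, ← hΦmk, hτ' y hy]
  have hΦπ : ∀ x, πS (Φ x) = π x := by
    intro x
    obtain ⟨⟨p, q⟩, rfl⟩ := mk_surjective a b x
    rw [hΦmk, hΨπ, h.proj_mk]
  have hΦeq : ∀ (z : Circle) x, Φ (z • x) = z • Φ x := by
    intro z x
    obtain ⟨⟨p, q⟩, rfl⟩ := mk_surjective a b x
    rw [h.smul_mk, hΦmk, hΦmk, hΨeq, zpow_zpow_mul_zpow_zpow h.bezout]
  obtain ⟨Φ', hΦ'⟩ := h.bundle.exists_diffeomorph hS hΦs hΦπ hΦeq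
  exact ⟨Φ', fun x => by rw [hΦ', hΦπ], fun z x => by rw [hΦ', hΦ', hΦeq]⟩

end IsOrbitBundle

end OrbitSpaceBundle

/-! ### The induced connection on the orbit space -/

section OrbitSpaceConnection

variable {E₁ : Type*} [NormedAddCommGroup E₁] [NormedSpace ℝ E₁]
  {H₁ : Type*} [TopologicalSpace H₁] {I₁ : ModelWithCorners ℝ E₁ H₁}
  {E₂ : Type*} [NormedAddCommGroup E₂] [NormedSpace ℝ E₂]
  {H₂ : Type*} [TopologicalSpace H₂] {I₂ : ModelWithCorners ℝ E₂ H₂}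
  {F₁ : Type*} [NormedAddCommGroup F₁] [NormedSpace ℝ F₁]
  {G₁ : Type*} [TopologicalSpace G₁] {J₁ : ModelWithCorners ℝ F₁ G₁}
  {F₂ : Type*} [NormedAddCommGroup F₂] [NormedSpace ℝ F₂]
  {G₂ : Type*} [TopologicalSpace G₂] {J₂ : ModelWithCorners ℝ F₂ G₂}
  {F : Type*} [NormedAddCommGroup F] [NormedSpace ℝ F]
  {G : Type*} [TopologicalSpace G] {J : ModelWithCorners ℝ F G}
  {F' : Type*} [NormedAddCommGroup F'] [NormedSpace ℝ F']
  {G' : Type*} [TopologicalSpace G'] {J' : ModelWithCorners ℝ F' G'}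
  {W₁ : Type*} [TopologicalSpace W₁] [ChartedSpace H₁ W₁]
  {W₂ : Type*} [TopologicalSpace W₂] [ChartedSpace H₂ W₂]
  {P₁ : Type*} [TopologicalSpace P₁] [ChartedSpace G₁ P₁] [MulAction Circle P₁]
  {P₂ : Type*} [TopologicalSpace P₂] [ChartedSpace G₂ P₂] [MulAction Circle P₂]

variable {N : Type*} [TopologicalSpace N] [ChartedSpace G' N]

open DiffForm OrbitSpace

theorem mfderivModel_const_mul {σ : N → ℝ} {y : N} (hσ : MDifferentiableAt J' 𝓘(ℝ, ℝ) σ y) (c : ℝ)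
    (v : F') : mfderivModel J' 𝓘(ℝ, ℝ) (fun y => c * σ y) y v = c * mfderivModel J' 𝓘(ℝ, ℝ) σ y v := by
  have h1 : HasFDerivAt (fun s : ℝ => c * s) (c • ContinuousLinearMap.id ℝ ℝ) (σ y) :=
    (hasFDerivAt_id (σ y)).const_mul c
  have h2 := mfderivModel_comp hσ h1.hasMFDerivAt.mdifferentiableAt rfl
  have h3 : mfderivModel 𝓘(ℝ, ℝ) 𝓘(ℝ, ℝ) (fun s : ℝ => c * s) (σ y) =
    c • ContinuousLinearMap.id ℝ ℝ := h1.hasMFDerivAt.mfderiv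
  rw [h3] at h2
  exact congrArg (fun A : F' →L[ℝ] ℝ => A v) h2

variable {a b : ℤ} [ChartedSpace G (OrbitSpace a b P₁ P₂)]
  [MulAction Circle (OrbitSpace a b P₁ P₂)]

namespace IsOrbitBundle

variable {m n : ℤ} {π₁ : P₁ → W₁} {π₂ : P₂ → W₂} {π : OrbitSpace a b P₁ P₂ → W₁ × W₂}
  (h : IsOrbitBundle I₁ I₂ J₁ J₂ J m n π₁ π₂ π)
  {α₁ : DiffForm J₁ P₁ 1} {α₂ : DiffForm J₂ P₂ 1} {ω₁ : DiffForm I₁ W₁ 2} {ω₂ : DiffForm I₂ W₂ 2}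

section

variable (h₁ : IsCircleConnection I₁ J₁ π₁ α₁ ω₁) (h₂ : IsCircleConnection I₂ J₂ π₂ α₂ ω₂)

include h h₁ h₂

/-- The form `b α₁ + a α₂` is basic for the weighted action. -/
theorem pullback_weightedSum_eq {f₁ g₁ : N → P₁} {f₂ g₂ : N → P₂} {y : N}
    (hf₁ : ContMDiffAt J' J₁ ∞ f₁ y) (hf₂ : ContMDiffAt J' J₂ ∞ f₂ y)
    (hg₁ : ContMDiffAt J' J₁ ∞ g₁ y) (hg₂ : ContMDiffAt J' J₂ ∞ g₂ y)
    (hfg : ∀ᶠ u in 𝓝 y, OrbitSpace.mk a b (f₁ u, f₂ u) = OrbitSpace.mk a b (g₁ u, g₂ u)) :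
    pullback J' (fun u => (g₁ u, g₂ u)) (weightedSum b a α₁ α₂) y =
      pullback J' (fun u => (f₁ u, f₂ u)) (weightedSum b a α₁ α₂) y := by
  have hπ : ∀ᶠ u in 𝓝 y, (π₁ (f₁ u), π₂ (f₂ u)) = (π₁ (g₁ u), π₂ (g₂ u)) := by
    filter_upwards [hfg] with u hu
    rw [← h.proj_mk, ← h.proj_mk, hu]
  have hπ₁ : ∀ᶠ u in 𝓝 y, π₁ (f₁ u) = π₁ (g₁ u) := hπ.mono fun u hu => congrArg Prod.fst hu
  have hπ₂ : ∀ᶠ u in 𝓝 y, π₂ (f₂ u) = π₂ (g₂ u) := hπ.mono fun u hu => congrArg Prod.snd hu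
  -- For `z` and `w` carrying `f₁` to `g₁` and `f₂` to `g₂`, this makes `exp (2 π i σ)` equal to `θ
  -- = w ^ m * z ^ (-n)`. Once `z ^ b * w ^ a = 1` is known, the Bézout identities give `z = θ ^
  -- (-a)` and `w = θ ^ b`.
  obtain ⟨σ, hσ, hσ'⟩ := exists_circle_lift
    (((h.snd_bundle.contMDiffAt_circleDiv hf₂ hg₂ hπ₂).circle_zpow m).mul
      ((h.fst_bundle.contMDiffAt_circleDiv hf₁ hg₁ hπ₁).circle_zpow (-n)))
  have hzw : ∀ᶠ u in 𝓝 y,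
      Circle.exp (2 * Real.pi * (-(a : ℝ) * σ u)) • f₁ u = g₁ u ∧
      Circle.exp (2 * Real.pi * ((b : ℝ) * σ u)) • f₂ u = g₂ u := by
    filter_upwards [hfg, hπ₁, hπ₂] with u hu hu₁ hu₂
    have hz := h.fst_bundle.circleDiv_smul hu₁
    have hw := h.snd_bundle.circleDiv_smul hu₂
    have hσu := hσ' u
    simp only [Pi.mul_apply] at hσu
    generalize circleDiv (f₁ u) (g₁ u) = z at *
    generalize circleDiv (f₂ u) (g₂ u) = w at *
    -- This element fixes the common orbit, and the action on the orbit bundle is free.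
    have hone : z ^ b * w ^ a = 1 := by
      refine h.bundle.smul_left_injective (p := OrbitSpace.mk a b (f₁ u, f₂ u)) ?_
      rw [← h.mk_smul_smul, hz, hw, one_smul, hu]
    have e1 := zpow_mul_zpow_pow_eq h.bezout z w
    have e2 := zpow_mul_zpow_pow_eq' h.bezout z w
    have hexp : ∀ k : ℤ, Circle.exp (2 * Real.pi * ((k : ℝ) * σ u)) = (w ^ m * z ^ (-n)) ^ k := by
      intro k
      rw [hσu, ← Circle.exp_intCast_mul]
      congr 1
      ring
    rw [hone, one_zpow] at e1 e2
    constructor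
    · rw [← hz]
      congr 1
      have := hexp (-a)
      push_cast at this
      rw [this, zpow_neg]
      exact (eq_inv_of_mul_eq_one_right e1.symm).symm
    · rw [← hw, hexp]
      congr 1
      rw [zpow_neg] at e2
      exact (eq_of_inv_mul_eq_one e2.symm)
  have hσd : MDifferentiableAt J' 𝓘(ℝ, ℝ) σ y := hσ.mdifferentiableAt (by simp)
  have hc : ∀ c : ℝ, MDifferentiableAt J' 𝓘(ℝ, ℝ) (fun u => c * σ u) y := fun c =>
    mdifferentiableAt_const.mul hσd
  have hf₁d : MDifferentiableAt J' J₁ f₁ y := hf₁.mdifferentiableAt (by simp)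
  have hf₂d : MDifferentiableAt J' J₂ f₂ y := hf₂.mdifferentiableAt (by simp)
  rw [pullback_weightedSum b a α₁ α₂ (hg₁.mdifferentiableAt (by simp))
    (hg₂.mdifferentiableAt (by simp)), pullback_weightedSum b a α₁ α₂ hf₁d hf₂d,
    pullback_congr α₁ (hzw.mono fun u hu => hu.1.symm),
    pullback_congr α₂ (hzw.mono fun u hu => hu.2.symm)]
  refine ext_lin
    (α := (b : ℝ) • pullback J' (_ : N → P₁) α₁ + (a : ℝ) • pullback J' (_ : N → P₂) α₂)
    (β := (b : ℝ) • pullback J' (_ : N → P₁) α₁ + (a : ℝ) • pullback J' (_ : N → P₂) α₂)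
    fun v => ?_
  -- By the gauge formula the two changes are `b * (-a) * dσ` and `a * b * dσ`, which cancel.
  have k1 := (h₁.lin_exp_smul (hc (-(a : ℝ))) hf₁d v).trans
    (congrArg (· + _) (mfderivModel_const_mul hσd _ v))
  have k2 := (h₂.lin_exp_smul (hc (b : ℝ)) hf₂d v).trans
    (congrArg (· + _) (mfderivModel_const_mul hσd _ v))
  refine (congrArg₂ (fun r s : ℝ => (b : ℝ) * r + (a : ℝ) * s) k1 k2).trans ?_
  change _ = (b : ℝ) * (pullback J' f₁ α₁).lin y v + (a : ℝ) * (pullback J' f₂ α₂).lin y v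
  ring

end

variable (α₁ α₂)

theorem exists_section_nhds (y : OrbitSpace a b P₁ P₂)
    (h : IsOrbitBundle I₁ I₂ J₁ J₂ J m n π₁ π₂ π) :
    ∃ τ : OrbitSpace a b P₁ P₂ → P₁ × P₂, ContMDiffAt J (J₁.prod J₂) ∞ τ y ∧
      ∀ᶠ u in 𝓝 y, OrbitSpace.mk a b (τ u) = u := by
  obtain ⟨x, rfl⟩ := OrbitSpace.mk_surjective a b y
  obtain ⟨U, τ, hU, hxU, hτ, hτ', -⟩ := h.exists_section x
  exact ⟨τ, hτ.contMDiffAt (hU.mem_nhds hxU), Filter.mem_of_superset (hU.mem_nhds hxU) hτ'⟩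

variable {α₁ α₂}

/-- The form is defined at each point by pulling back along some local section. The choice does not
matter: a section after the quotient map stays in the orbits, where `pullback_weightedSum_eq`
compares it with the identity. -/
theorem exists_pullback_mk_eq (h : IsOrbitBundle I₁ I₂ J₁ J₂ J m n π₁ π₂ π)
    (h₁ : IsCircleConnection I₁ J₁ π₁ α₁ ω₁) (h₂ : IsCircleConnection I₂ J₂ π₂ α₂ ω₂) :
    ∃ α : DiffForm J (OrbitSpace a b P₁ P₂) 1,
      pullback (J₁.prod J₂) (OrbitSpace.mk a b) α = weightedSum b a α₁ α₂ := by
  choose τ hτ hτ' using fun y => h.exists_section_nhds (m := m) y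
  refine ⟨fun y => pullback J (τ y) (weightedSum b a α₁ α₂) y, funext fun x => ?_⟩
  have hmk := h.contMDiff_mk x
  refine (pullback_congr_form (f := OrbitSpace.mk a b) (x := x)
    (θ := pullback J (τ (OrbitSpace.mk a b x)) (weightedSum b a α₁ α₂)) rfl).trans ?_
  rw [← pullback_comp _ (hmk.mdifferentiableAt (by simp)) ((hτ _).mdifferentiableAt (by simp))]
  have hc : ContMDiffAt (J₁.prod J₂) (J₁.prod J₂) ∞ (τ (OrbitSpace.mk a b x) ∘ OrbitSpace.mk a b) x :=
    (hτ _).comp x hmk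
  refine (h.pullback_weightedSum_eq h₁ h₂ (f₁ := Prod.fst) (f₂ := Prod.snd) contMDiffAt_fst
    contMDiffAt_snd (contMDiffAt_fst.comp x hc) (contMDiffAt_snd.comp x hc) ?_).trans
    (pullback_id _ x)
  filter_upwards [hmk.continuousAt.eventually (hτ' (OrbitSpace.mk a b x))] with u hu using hu.symm

/-- The circle orbit lifts to `(exp (2 π i m s) • p, exp (2 π i n s) • q)`, on whose velocity `b α₁
+ a α₂` takes the value `b * m + a * n = 1`. -/
theorem fundamentalVector_mk (h : IsOrbitBundle I₁ I₂ J₁ J₂ J m n π₁ π₂ π)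
    {α : DiffForm J (OrbitSpace a b P₁ P₂) 1}
    (hα : pullback (J₁.prod J₂) (OrbitSpace.mk a b) α = weightedSum b a α₁ α₂)
    (h₁ : IsCircleConnection I₁ J₁ π₁ α₁ ω₁) (h₂ : IsCircleConnection I₂ J₂ π₂ α₂ ω₂)
    (x : P₁ × P₂) :
    α.lin (OrbitSpace.mk a b x) (fundamentalVector J (OrbitSpace.mk a b x)) = 1 := by
  obtain ⟨p, q⟩ := x
  have hcurve : (fun s : ℝ => Circle.exp (2 * Real.pi * s) • OrbitSpace.mk a b (p, q)) =
      OrbitSpace.mk a b ∘ fun s : ℝ => (Circle.exp (2 * Real.pi * ((m : ℝ) * s)) • p,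
        Circle.exp (2 * Real.pi * ((n : ℝ) * s)) • q) := by
    funext s
    have hexp : ∀ k : ℤ, Circle.exp (2 * Real.pi * ((k : ℝ) * s)) =
        Circle.exp (2 * Real.pi * s) ^ k := fun k => by
      rw [← Circle.exp_intCast_mul, mul_left_comm]
    rw [h.smul_mk, Function.comp_apply, hexp, hexp]
  have hm : ∀ c : ℝ, ContMDiff 𝓘(ℝ, ℝ) 𝓘(ℝ, ℝ) ∞ (fun s : ℝ => c * s) := fun c =>
    contMDiff_const.mul contMDiff_id
  have hp : ContMDiff 𝓘(ℝ, ℝ) J₁ ∞ (fun s : ℝ => Circle.exp (2 * Real.pi * ((m : ℝ) * s)) • p) :=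
    (contMDiff_exp_smul h.fst_bundle.smooth_smul).comp ((hm _).prodMk contMDiff_const)
  have hq : ContMDiff 𝓘(ℝ, ℝ) J₂ ∞ (fun s : ℝ => Circle.exp (2 * Real.pi * ((n : ℝ) * s)) • q) :=
    (contMDiff_exp_smul h.snd_bundle.smooth_smul).comp ((hm _).prodMk contMDiff_const)
  have hpd := (hp 0).mdifferentiableAt (by simp)
  have hqd := (hq 0).mdifferentiableAt (by simp)
  have key : (pullback 𝓘(ℝ, ℝ)
      (fun s : ℝ => Circle.exp (2 * Real.pi * s) • OrbitSpace.mk a b (p, q)) α) 0 =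
      ((b : ℝ) • pullback 𝓘(ℝ, ℝ) (fun s : ℝ => Circle.exp (2 * Real.pi * ((m : ℝ) * s)) • p) α₁ +
      (a : ℝ) • pullback 𝓘(ℝ, ℝ) (fun s : ℝ => Circle.exp (2 * Real.pi * ((n : ℝ) * s)) • q) α₂)
        0 := by
    rw [hcurve, pullback_comp _ (hpd.prodMk hqd) ((h.contMDiff_mk _).mdifferentiableAt (by simp)),
      hα, pullback_weightedSum b a α₁ α₂ hpd hqd]
    rfl
  have hl := lin_eq_of_eq key (1 : ℝ)
  have k1 := h₁.lin_exp_smul ((hm (m : ℝ) 0).mdifferentiableAt (by simp))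
    (mdifferentiableAt_const (c := p)) (1 : ℝ)
  have k2 := h₂.lin_exp_smul ((hm (n : ℝ) 0).mdifferentiableAt (by simp))
    (mdifferentiableAt_const (c := q)) (1 : ℝ)
  have e0 : ∀ c : ℝ, mfderivModel 𝓘(ℝ, ℝ) 𝓘(ℝ, ℝ) (fun s : ℝ => c * s) 0 (1 : ℝ) = c := by
    intro c
    have := mfderivModel_const_mul (σ := (id : ℝ → ℝ)) (y := 0) (J' := 𝓘(ℝ, ℝ))
      mdifferentiableAt_id c (1 : ℝ)
    rw [mfderivModel_id] at this
    simpa using this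
  have e1 : (pullback 𝓘(ℝ, ℝ) (fun _ : ℝ => p) α₁).lin 0 (1 : ℝ) = 0 :=
    (congrArg (fun A : ℝ →L[ℝ] F₁ => α₁.lin p (A 1)) (mfderivModel_const 0 p)).trans
      (map_zero _)
  have e2 : (pullback 𝓘(ℝ, ℝ) (fun _ : ℝ => q) α₂).lin 0 (1 : ℝ) = 0 :=
    (congrArg (fun A : ℝ →L[ℝ] F₂ => α₂.lin q (A 1)) (mfderivModel_const 0 q)).trans
      (map_zero _)
  replace k1 := k1.trans ((congrArg₂ (· + ·) (e0 _) e1).trans (add_zero _))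
  replace k2 := k2.trans ((congrArg₂ (· + ·) (e0 _) e2).trans (add_zero _))
  have hbez : (b : ℝ) * m + (a : ℝ) * n = 1 := by
    have := h.bezout
    have : ((m * b + n * a : ℤ) : ℝ) = 1 := by rw [this]; simp
    push_cast at this
    linarith
  have hr := hl.trans ((congrArg₂ (fun r s : ℝ => (b : ℝ) * r + (a : ℝ) * s) k1 k2).trans hbez)
  exact (lin_congr α (by simp) _).trans hr

/-- The connection induced on the space of orbits. -/
theorem isCircleConnection [I₁.Boundaryless] [I₂.Boundaryless] [J₁.Boundaryless] [J₂.Boundaryless]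
    [J.Boundaryless] [IsManifold I₁ ∞ W₁] [IsManifold I₂ ∞ W₂] [IsManifold J₁ ∞ P₁]
    [IsManifold J₂ ∞ P₂] [IsManifold J ∞ (OrbitSpace a b P₁ P₂)]
    (h : IsOrbitBundle I₁ I₂ J₁ J₂ J m n π₁ π₂ π)
    {α : DiffForm J (OrbitSpace a b P₁ P₂) 1}
    (hα : pullback (J₁.prod J₂) (OrbitSpace.mk a b) α = weightedSum b a α₁ α₂)
    (h₁ : IsCircleConnection I₁ J₁ π₁ α₁ ω₁) (h₂ : IsCircleConnection I₂ J₂ π₂ α₂ ω₂) :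
    IsCircleConnection (I₁.prod I₂) J π α (weightedSum b a ω₁ ω₂) := by
  have hmkd : ∀ x, MDifferentiableAt (J₁.prod J₂) J
      (OrbitSpace.mk a b : P₁ × P₂ → OrbitSpace a b P₁ P₂) x :=
    fun x => (h.contMDiff_mk x).mdifferentiableAt (by simp)
  have hβ : (weightedSum b a α₁ α₂).IsSmooth := weightedSum_isSmooth b a h₁.smooth h₂.smooth
  have hsmooth : α.IsSmooth := by
    rw [isSmooth_iff_smoothAt] at hβ ⊢
    intro y
    obtain ⟨τ, hτ, hτ'⟩ := h.exists_section_nhds y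
    -- Pulling `hα` back by a local section shows that `α` is locally the pullback of a smooth form.
    refine SmoothAt.congr ((hβ (τ y)).pullback hτ) ?_
    filter_upwards [eventually_contMDiffAt_one hτ, hτ'.eventually_nhds] with u hu hu'
    rw [← hα, ← pullback_comp _ (hu.mdifferentiableAt (by simp)) (hmkd _)]
    exact (pullback_congr (g := id) α hu').trans (pullback_id α u)
  refine ⟨h.bundle, hsmooth, fun z => funext fun y => ?_, fun y t => ?_, funext fun y => ?_⟩
  · obtain ⟨x, rfl⟩ := OrbitSpace.mk_surjective a b y
    -- Forms on the orbit space may be compared upstairs, since the quotient map is a submersion.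
    refine eq_of_pullback_eq (h.mfderiv_mk_surjective x) ?_
    have hz1 := (contMDiff_circle_const_smul h.fst_bundle.smooth_smul (z ^ m)).contMDiffAt (x := x.1)
      |>.mdifferentiableAt (by simp)
    have hz2 := (contMDiff_circle_const_smul h.snd_bundle.smooth_smul (z ^ n)).contMDiffAt (x := x.2)
      |>.mdifferentiableAt (by simp)
    have hz := (contMDiff_circle_const_smul h.bundle.smooth_smul z).contMDiffAt
      (x := OrbitSpace.mk a b x) |>.mdifferentiableAt (by simp)
    have hcomp : (fun y : OrbitSpace a b P₁ P₂ => z • y) ∘ OrbitSpace.mk a b =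
        OrbitSpace.mk a b ∘ fun r : P₁ × P₂ =>
          (((fun p => z ^ m • p) ∘ Prod.fst) r, ((fun q => z ^ n • q) ∘ Prod.snd) r) :=
      funext fun r => h.smul_mk z r.1 r.2
    have hz1' := hz1.comp x (mdifferentiableAt_fst (I := J₁) (I' := J₂))
    have hz2' := hz2.comp x (mdifferentiableAt_snd (I := J₁) (I' := J₂))
    rw [← pullback_comp _ (hmkd x) hz, hcomp, pullback_comp _ (hz1'.prodMk hz2') (hmkd _), hα]
    refine (pullback_weightedSum b a α₁ α₂ hz1' hz2').trans ?_
    rw [pullback_comp _ mdifferentiableAt_fst hz1, pullback_comp _ mdifferentiableAt_snd hz2,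
      h₁.invariant, h₂.invariant]
    rfl
  · rw [apply_eq_lin]
    refine (congrArg (α.lin _) (mfderiv_orbit h.bundle.smooth_smul y t)).trans ?_
    obtain ⟨x, hx⟩ := OrbitSpace.mk_surjective a b (Circle.exp (2 * Real.pi * t) • y)
    rw [← hx]
    exact h.fundamentalVector_mk hα h₁ h₂ x
  · obtain ⟨x, rfl⟩ := OrbitSpace.mk_surjective a b y
    refine eq_of_pullback_eq (h.mfderiv_mk_surjective x) ?_
    have hπd : MDifferentiableAt J (I₁.prod I₂) π (OrbitSpace.mk a b x) :=
      (h.bundle.contMDiff_proj _).mdifferentiableAt (by simp)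
    have hπ1 : MDifferentiableAt J₁ I₁ π₁ x.1 :=
      (h.fst_bundle.contMDiff_proj _).mdifferentiableAt (by simp)
    have hπ2 : MDifferentiableAt J₂ I₂ π₂ x.2 :=
      (h.snd_bundle.contMDiff_proj _).mdifferentiableAt (by simp)
    have hcomp : π ∘ OrbitSpace.mk a b =
        fun r : P₁ × P₂ => ((π₁ ∘ Prod.fst) r, (π₂ ∘ Prod.snd) r) :=
      funext fun r => h.proj_mk r.1 r.2
    rw [← d_pullback ((isSmooth_iff_smoothAt _).1 hsmooth _) (h.contMDiff_mk x), hα,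
      weightedSum_d b a h₁.smooth h₂.smooth, ← pullback_comp _ (hmkd x) hπd, hcomp]
    refine Eq.trans ?_ (pullback_weightedSum b a ω₁ ω₂ (hπ1.comp x mdifferentiableAt_fst)
      (hπ2.comp x mdifferentiableAt_snd)).symm
    rw [pullback_comp _ mdifferentiableAt_fst hπ1, pullback_comp _ mdifferentiableAt_snd hπ2,
      h₁.curvature, h₂.curvature]
    rfl

end IsOrbitBundle

end OrbitSpaceConnection

/-! ### Smoothness of composition operators on continuous curves -/

section Superposition

variable {K : Type*} [TopologicalSpace K] [CompactSpace K]

namespace ContinuousMap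

variable {E F : Type*} [NormedAddCommGroup E] [NormedSpace ℝ E] [NormedAddCommGroup F]
  [NormedSpace ℝ F]

variable (K E F) in
/-- Pointwise evaluation of a family of linear maps at a family of vectors. -/
def pointwiseApply : C(K, E →L[ℝ] F) →L[ℝ] C(K, E) →L[ℝ] C(K, F) :=
  LinearMap.mkContinuous₂
    (LinearMap.mk₂ ℝ (fun (A : C(K, E →L[ℝ] F)) (h : C(K, E)) =>
        (⟨fun t => A t (h t), A.continuous.clm_apply h.continuous⟩ : C(K, F)))
      (fun _ _ _ => by ext; simp) (fun _ _ _ => by ext; simp) (fun _ _ _ => by ext; simp)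
      (fun _ _ _ => by ext; simp)) 1 fun A h => by
    refine (ContinuousMap.norm_le _ (by positivity)).2 fun t => ?_
    rw [one_mul]
    exact (A t).le_of_opNorm_le_of_le (A.norm_coe_le_norm t) (h.norm_coe_le_norm t)

/-- Composition with `X'` is continuous for the supremum norm, which bounds the variation of `X'`
near `γ t` uniformly in `t`; the mean value inequality does the rest. -/
theorem hasFDerivAt_postcomp {X : E → F} {X' : E → E →L[ℝ] F} (hX : Continuous X)
    (hX' : Continuous X') (h : ∀ x, HasFDerivAt X (X' x) x) (γ : C(K, E)) :
    HasFDerivAt (fun γ : C(K, E) => (⟨X, hX⟩ : C(E, F)).comp γ)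
      (pointwiseApply K E F ((⟨X', hX'⟩ : C(E, E →L[ℝ] F)).comp γ)) γ := by
  rw [hasFDerivAt_iff_isLittleO, Asymptotics.isLittleO_iff]
  intro c hc
  have hcont := (ContinuousMap.continuous_postcomp (X := K) (⟨X', hX'⟩ : C(E, E →L[ℝ] F))).tendsto γ
  obtain ⟨δ, hδ, hball⟩ := Metric.eventually_nhds_iff_ball.1
    (hcont.eventually_mem (Metric.closedBall_mem_nhds
      ((⟨X', hX'⟩ : C(E, E →L[ℝ] F)).comp γ) hc))
  filter_upwards [Metric.ball_mem_nhds γ hδ] with γ' hγ'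
  refine (ContinuousMap.norm_le _ (by positivity)).2 fun t => ?_
  have hle : ‖γ' t - γ t‖ ≤ ‖γ' - γ‖ := (γ' - γ).norm_coe_le_norm t
  have hlt : ‖γ' - γ‖ < δ := by rwa [mem_ball_iff_norm] at hγ'
  refine le_trans ?_ (mul_le_mul_of_nonneg_left hle hc.le)
  refine (convex_closedBall (γ t) ‖γ' t - γ t‖).norm_image_sub_le_of_norm_hasFDerivWithin_le'
    (f' := X') (fun x _ => (h x).hasFDerivWithinAt) (fun y hy => ?_)
    (Metric.mem_closedBall_self (norm_nonneg _)) (by rw [mem_closedBall_iff_norm])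
  -- This translate of `γ` takes the value `y` at `t` and stays `δ`-close to `γ`, so the bound on
  -- curves bounds `X' y - X' (γ t)`.
  have h1 : γ + ContinuousMap.const K (y - γ t) ∈ Metric.ball γ δ := by
    rw [mem_ball_iff_norm, add_sub_cancel_left]
    refine lt_of_le_of_lt ((ContinuousMap.norm_le _ (norm_nonneg _)).2 fun _ => le_rfl)
      (lt_of_le_of_lt ?_ (hle.trans_lt hlt))
    rwa [mem_closedBall_iff_norm] at hy
  have h2 := (ContinuousMap.dist_apply_le_dist t).trans (Metric.mem_closedBall.1 (hball _ h1))
  simpa [dist_eq_norm] using h2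

end ContinuousMap

universe u

/-- The derivative is again a composition operator, for `X'`, followed by a continuous linear map.
The induction replaces `F` by `E →L[ℝ] F`, hence the quantification over spaces of one universe. -/
theorem ContinuousMap.contDiff_nat_postcomp (n : ℕ) : ∀ {E F : Type u} [NormedAddCommGroup E]
    [NormedSpace ℝ E] [NormedAddCommGroup F] [NormedSpace ℝ F] {X : E → F} (hX : ContDiff ℝ n X),
    ContDiff ℝ n (fun γ : C(K, E) => (⟨X, hX.continuous⟩ : C(E, F)).comp γ) := by
  induction n with
  | zero =>
    intro E F _ _ _ _ X hX
    exact contDiff_zero.2 (ContinuousMap.continuous_postcomp _)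
  | succ n ih =>
    intro E F _ _ _ _ X hX
    obtain ⟨X', hX', h⟩ := contDiff_succ_iff_hasFDerivAt.1 hX
    exact contDiff_succ_iff_hasFDerivAt.2 ⟨_, (pointwiseApply K E F).contDiff.comp (ih hX'),
      hasFDerivAt_postcomp hX.continuous hX'.continuous h⟩

theorem ContinuousMap.contDiff_postcomp {E F : Type u} [NormedAddCommGroup E]
    [NormedSpace ℝ E] [NormedAddCommGroup F] [NormedSpace ℝ F] {X : E → F} (hX : ContDiff ℝ ∞ X) :
    ContDiff ℝ ∞ (fun γ : C(K, E) => (⟨X, hX.continuous⟩ : C(E, F)).comp γ) :=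
  contDiff_infty.2 fun n => contDiff_nat_postcomp n (contDiff_infty.1 hX n)

end Superposition

/-! ### Local flows on Banach spaces -/

section LocalFlow

variable {E : Type*} [NormedAddCommGroup E] [NormedSpace ℝ E]

/-- The curve on `[-1, 1]`, extended to the real line by constants. -/
def curveExtend (γ : C(Icc (-1 : ℝ) 1, E)) (t : ℝ) : E :=
  γ (projIcc (-1) 1 (by norm_num) t)

theorem continuous_curveExtend (γ : C(Icc (-1 : ℝ) 1, E)) : Continuous (curveExtend γ) :=
  γ.continuous.comp continuous_projIcc

theorem curveExtend_of_mem (γ : C(Icc (-1 : ℝ) 1, E)) {t : ℝ} (ht : t ∈ Icc (-1 : ℝ) 1) :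
    curveExtend γ t = γ ⟨t, ht⟩ := by
  rw [curveExtend, projIcc_of_mem]

variable (E) in
/-- The primitive, vanishing at `0`, of a curve on `[-1, 1]`. -/
def curvePrimitive : C(Icc (-1 : ℝ) 1, E) →L[ℝ] C(Icc (-1 : ℝ) 1, E) :=
  LinearMap.mkContinuous
    { toFun := fun γ => ⟨fun t => ∫ s in (0 : ℝ)..t, curveExtend γ s,
        (intervalIntegral.continuous_primitive
          (fun a b => (continuous_curveExtend γ).intervalIntegrable a b) 0).comp
          continuous_subtype_val⟩
      map_add' := fun γ γ' => by
        ext t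
        exact intervalIntegral.integral_add ((continuous_curveExtend γ).intervalIntegrable _ _)
          ((continuous_curveExtend γ').intervalIntegrable _ _)
      map_smul' := fun c γ => by
        ext t
        exact intervalIntegral.integral_smul c _ } 1 fun γ => by
    refine (ContinuousMap.norm_le _ (by positivity)).2 fun t => ?_
    refine (intervalIntegral.norm_integral_le_of_norm_le_const (C := ‖γ‖)
      fun s _ => γ.norm_coe_le_norm _).trans ?_
    rw [sub_zero, one_mul]
    exact mul_le_of_le_one_right (norm_nonneg _) (abs_le.2 t.2)

/-- Local flow of a smooth vector field on a Banach space: solutions `c` on `(-1, 1)` of the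
rescaled equation `c' = 2 ε X c` with `c (1/2)` depending smoothly on `ε` and the initial value. -/
theorem ContDiff.exists_local_flow [CompleteSpace E] {X : E → E} (hX : ContDiff ℝ ∞ X) (x₀ : E)
    {U : Set E} (hU : U ∈ 𝓝 x₀) :
    ∃ ψ : ℝ × E → E, ContDiffAt ℝ ∞ ψ (0, x₀) ∧ ∀ᶠ q in 𝓝 ((0 : ℝ), x₀), ∃ c : ℝ → E,
      c 0 = q.2 ∧ c (1 / 2) = ψ q ∧
        ∀ t ∈ Ioo (-1 : ℝ) 1, c t ∈ U ∧ HasDerivAt c ((2 * q.1) • X (c t)) t := by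
  let Y : C(Icc (-1 : ℝ) 1, E) → C(Icc (-1 : ℝ) 1, E) := fun γ =>
    (⟨X, hX.continuous⟩ : C(E, E)).comp γ
  have hY : ContDiff ℝ ∞ Y := ContinuousMap.contDiff_postcomp hX
  let κ : E →L[ℝ] C(Icc (-1 : ℝ) 1, E) := ContinuousLinearMap.const ℝ (Icc (-1 : ℝ) 1)
  -- Zeros of `f` are the solutions of the integral equation. At `ε = 0` the nonlinear term
  -- disappears and the derivative in the curve is the identity, so the implicit function theorem
  -- applies.
  let f : (ℝ × E) × C(Icc (-1 : ℝ) 1, E) → C(Icc (-1 : ℝ) 1, E) := fun p =>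
    p.2 - κ p.1.2 - (2 * p.1.1) • curvePrimitive E (Y p.2)
  have hf : ContDiff ℝ ∞ f := by
    refine (contDiff_snd.sub (κ.contDiff.comp (contDiff_snd.comp contDiff_fst))).sub ?_
    exact (contDiff_const.mul (contDiff_fst.comp contDiff_fst)).smul
      ((curvePrimitive E).contDiff.comp (hY.comp contDiff_snd))
  let u : (ℝ × E) × C(Icc (-1 : ℝ) 1, E) := ((0, x₀), κ x₀)
  have hfu : f u = 0 := by simp [f, u]
  have hinv : fderiv ℝ f u ∘L ContinuousLinearMap.inr ℝ (ℝ × E) C(Icc (-1 : ℝ) 1, E) =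
      ContinuousLinearMap.id ℝ _ := by
    have h1 : HasFDerivAt (fun γ => f ((0, x₀), γ))
        (fderiv ℝ f u ∘L ContinuousLinearMap.inr ℝ (ℝ × E) C(Icc (-1 : ℝ) 1, E)) (κ x₀) :=
      HasFDerivAt.comp (κ x₀) (hf.differentiable (by simp) u).hasFDerivAt
        (hasFDerivAt_prodMk_right (0, x₀) (κ x₀))
    have h2 : (fun γ => f ((0, x₀), γ)) = fun γ => γ - κ x₀ := by
      funext γ
      simp [f]
    rw [h2] at h1
    exact h1.unique ((hasFDerivAt_id _).sub_const _)
  have if₂ : (fderiv ℝ f u ∘L ContinuousLinearMap.inr ℝ (ℝ × E)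
      C(Icc (-1 : ℝ) 1, E)).IsInvertible := by
    rw [hinv]
    exact ContinuousLinearMap.isInvertible_equiv (f := ContinuousLinearEquiv.refl ℝ _)
  have cdf : ContDiffAt ℝ ∞ f u := hf.contDiffAt
  let Ψ := cdf.implicitFunction (by simp) if₂
  have hΨ : ContDiffAt ℝ ∞ Ψ (0, x₀) := cdf.contDiffAt_implicitFunction (by simp) if₂
  have hΨ0 : Ψ (0, x₀) = κ x₀ := cdf.implicitFunction_apply_self (by simp) if₂
  have hΨf : ∀ᶠ q in 𝓝 ((0 : ℝ), x₀), f (q, Ψ q) = f u :=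
    cdf.eventually_apply_implicitFunction (by simp) if₂
  -- The factor `2 ε` makes time `1 / 2` correspond to flow time `ε`, at an interior point of the
  -- interval where the differential equation holds.
  have hmem : (1 / 2 : ℝ) ∈ Icc (-1 : ℝ) 1 := by constructor <;> norm_num
  refine ⟨fun q => Ψ q ⟨1 / 2, hmem⟩, ?_, ?_⟩
  · exact ((ContinuousMap.evalCLM ℝ (⟨1 / 2, hmem⟩ : Icc (-1 : ℝ) 1)).contDiff.contDiffAt).comp _ hΨ
  obtain ⟨r, hr, hrU⟩ := Metric.mem_nhds_iff.1 hU
  have hball : ∀ᶠ q in 𝓝 ((0 : ℝ), x₀), Ψ q ∈ Metric.ball (κ x₀) r :=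
    hΨ.continuousAt.eventually_mem (by rw [hΨ0]; exact Metric.ball_mem_nhds _ hr)
  filter_upwards [hΨf, hball] with q hq hqr
  replace hq : Ψ q - κ q.2 - (2 * q.1) • curvePrimitive E (Y (Ψ q)) = 0 := hq.trans hfu
  rw [sub_sub, sub_eq_zero] at hq
  have hq' : ∀ t (ht : t ∈ Icc (-1 : ℝ) 1), curveExtend (Ψ q) t =
      q.2 + (2 * q.1) • ∫ s in (0 : ℝ)..t, X (curveExtend (Ψ q) s) := by
    intro t ht
    rw [curveExtend_of_mem _ ht]
    exact congrArg (fun γ : C(Icc (-1 : ℝ) 1, E) => γ ⟨t, ht⟩) hq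
  refine ⟨curveExtend (Ψ q), ?_, curveExtend_of_mem _ hmem, fun t ht => ⟨hrU ?_, ?_⟩⟩
  · rw [hq' 0 (by constructor <;> norm_num)]
    simp
  · rw [mem_ball_iff_norm] at hqr ⊢
    exact lt_of_le_of_lt ((Ψ q - κ x₀).norm_coe_le_norm (projIcc (-1) 1 (by norm_num) t)) hqr
  · have hc : Continuous fun s => X (curveExtend (Ψ q) s) :=
      hX.continuous.comp (continuous_curveExtend _)
    have h1 : HasDerivAt (fun t => q.2 + (2 * q.1) • ∫ s in (0 : ℝ)..t, X (curveExtend (Ψ q) s))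
        ((2 * q.1) • X (curveExtend (Ψ q) t)) t :=
      ((hc.integral_hasStrictDerivAt 0 t).hasDerivAt.const_smul _).const_add _
    refine h1.congr_of_eventuallyEq ?_
    filter_upwards [Ioo_mem_nhds ht.1 ht.2] with s hs using hq' s (Ioo_subset_Icc_self hs)

end LocalFlow

/-! ### Local flows on manifolds -/

section Flows

/-- A function that is smooth near a point of a finite-dimensional space agrees near that point with
a globally smooth one. -/
theorem ContDiffOn.exists_contDiff_eventuallyEq {E F : Type*} [NormedAddCommGroup E]
    [NormedSpace ℝ E] [FiniteDimensional ℝ E] [NormedAddCommGroup F] [NormedSpace ℝ F] {V : E → F}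
    {O : Set E} (hO : IsOpen O) (hV : ContDiffOn ℝ ∞ V O) {x₀ : E} (hx₀ : x₀ ∈ O) :
    ∃ X : E → F, ContDiff ℝ ∞ X ∧ X =ᶠ[𝓝 x₀] V := by
  obtain ⟨r, hr, hrO⟩ := Metric.nhds_basis_closedBall.mem_iff.1 (hO.mem_nhds hx₀)
  let B : ContDiffBump x₀ := ⟨r / 2, r, by positivity, by linarith⟩
  refine ⟨fun x => B x • V x, contDiff_iff_contDiffAt.2 fun x => ?_, ?_⟩
  · by_cases hx : x ∈ Metric.closedBall x₀ r
    · exact B.contDiff.contDiffAt.smul (hV.contDiffAt (hO.mem_nhds (hrO hx)))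
    · refine (contDiffAt_const (c := (0 : F))).congr_of_eventuallyEq ?_
      filter_upwards [Metric.isClosed_closedBall.isOpen_compl.mem_nhds hx] with y hy
      rw [B.zero_of_le_dist (not_le.1 fun h => hy (Metric.mem_closedBall.2 h)).le, zero_smul]
  · filter_upwards [B.eventuallyEq_one] with x hx
    rw [hx]
    exact one_smul _ _

variable {E : Type*} [NormedAddCommGroup E] [NormedSpace ℝ E]
  {H : Type*} [TopologicalSpace H] {I : ModelWithCorners ℝ E H}
  {M : Type*} [TopologicalSpace M] [ChartedSpace H M]

/-- The coordinate expression of a vector field in the preferred chart at `x₀`. -/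
def vectorFieldInChart (v : (x : M) → TangentSpace I x) (x₀ : M) (z : E) : E :=
  mfderivModel I 𝓘(ℝ, E) (extChartAt I x₀) ((extChartAt I x₀).symm z) (v ((extChartAt I x₀).symm z))

/-- A vector field is smooth when all its coordinate expressions are. -/
def IsSmoothVectorField (v : (x : M) → TangentSpace I x) : Prop :=
  ∀ x₀ : M, ContDiffOn ℝ ∞ (vectorFieldInChart v x₀) (extChartAt I x₀).target

theorem IsSmoothVectorField.const_smul {v : (x : M) → TangentSpace I x}
    (hv : IsSmoothVectorField v) (c : ℝ) : IsSmoothVectorField (c • v) := by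
  intro x₀
  refine ((hv x₀).const_smul c).congr fun z _ => ?_
  exact (mfderivModel I 𝓘(ℝ, E) (extChartAt I x₀) _).map_smul c _

variable [I.Boundaryless] [IsManifold I ∞ M] {v : (x : M) → TangentSpace I x}

theorem IsSmoothVectorField.contMDiff [IsManifold I 1 M] (hv : IsSmoothVectorField v) :
    ContMDiff I I.tangent 1 (fun x => (⟨x, v x⟩ : TangentBundle I M)) := by
  intro x₀
  rw [Bundle.contMDiffAt_section]
  have h1 : ContMDiffAt I 𝓘(ℝ, E) 1 (vectorFieldInChart v x₀ ∘ extChartAt I x₀) x₀ := by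
    refine ContMDiffAt.comp x₀ (I' := 𝓘(ℝ, E)) ?_ contMDiffAt_extChartAt
    exact (((hv x₀).contDiffAt (extChartAt_target_mem_nhds x₀)).of_le (by simp)).contMDiffAt
  refine h1.congr_of_eventuallyEq ?_
  filter_upwards [extChartAt_source_mem_nhds (I := I) x₀] with x hx
  rw [Function.comp_apply, vectorFieldInChart, (extChartAt I x₀).left_inv hx]
  have hx' : x ∈ (chartAt H x₀).source := by rwa [extChartAt_source] at hx
  rw [← Bundle.Trivialization.continuousLinearMapAt_apply_of_mem ℝ _ (by simpa using hx')]
  exact congrArg (fun A : E →L[ℝ] E => A (v x))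
    (TangentBundle.continuousLinearMapAt_trivializationAt hx')

theorem mfderivModel_extChartAt_symm_comp (x₀ : M) {z : E} (hz : z ∈ (extChartAt I x₀).target) :
    (mfderivModel 𝓘(ℝ, E) I (extChartAt I x₀).symm z).comp
      (mfderivModel I 𝓘(ℝ, E) (extChartAt I x₀) ((extChartAt I x₀).symm z)) =
      ContinuousLinearMap.id ℝ E := by
  have hx := (extChartAt I x₀).map_target hz
  rw [← mfderivModel_comp (y := z) (g := (extChartAt I x₀).symm)
    ((contMDiffAt_extChartAt' (n := ∞) (by rwa [← extChartAt_source I])).mdifferentiableAt (by simp))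
    (DiffForm.mdifferentiableAt_extChartAt_symm x₀ hz) ((extChartAt I x₀).right_inv hz),
    ← mfderivModel_id (I := I) ((extChartAt I x₀).symm z)]
  refine mfderivModel_congr ?_
  filter_upwards [(isOpen_extChartAt_source (I := I) x₀).mem_nhds hx] with y hy
  exact (extChartAt I x₀).left_inv hy

/-- The local flow of a smooth vector field on a manifold. -/
theorem IsSmoothVectorField.exists_local_flow [FiniteDimensional ℝ E]
    (hv : IsSmoothVectorField v) (x₀ : M) :
    ∃ ψ : ℝ × M → M, ContMDiffAt (𝓘(ℝ, ℝ).prod I) I ∞ ψ (0, x₀) ∧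
      ∀ᶠ q in 𝓝 ((0 : ℝ), x₀), ∃ c : ℝ → M, c 0 = q.2 ∧ c (1 / 2) = ψ q ∧
        IsMIntegralCurveOn c ((2 * q.1) • v) (Ioo (-1) 1) := by
  have : CompleteSpace E := FiniteDimensional.complete ℝ E
  let e := extChartAt I x₀
  obtain ⟨X, hX, hXV⟩ := (hv x₀).exists_contDiff_eventuallyEq (isOpen_extChartAt_target x₀)
    (mem_extChartAt_target x₀)
  -- Solutions confined to this set solve the equation of `v`, not merely that of its cut-off
  -- extension `X`.
  have hU : {z | z ∈ e.target ∧ X z = vectorFieldInChart v x₀ z} ∈ 𝓝 (e x₀) :=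
    Filter.inter_mem (extChartAt_target_mem_nhds x₀) hXV
  obtain ⟨ψ, hψ, hc⟩ := hX.exists_local_flow (e x₀) hU
  have hch : ContMDiffAt (𝓘(ℝ, ℝ).prod I) 𝓘(ℝ, ℝ × E) ∞
      (fun q : ℝ × M => (q.1, e q.2)) (0, x₀) :=
    contMDiffAt_fst.prodMk_space (ContMDiffAt.comp (I' := I) (g := extChartAt I x₀) ((0 : ℝ), x₀)
      contMDiffAt_extChartAt contMDiffAt_snd)
  have hev : ∀ᶠ q in 𝓝 ((0 : ℝ), x₀), ((q.1, e q.2) : ℝ × E) ∈ {q : ℝ × E | ∃ c : ℝ → E,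
      c 0 = q.2 ∧ c (1 / 2) = ψ q ∧
        ∀ t ∈ Ioo (-1 : ℝ) 1, c t ∈ {z | z ∈ e.target ∧ X z = vectorFieldInChart v x₀ z} ∧
          HasDerivAt c ((2 * q.1) • X (c t)) t} :=
    hch.continuousAt.eventually hc
  have hψ0 : ψ (0, e x₀) ∈ e.target := by
    obtain ⟨c, -, h2, h3⟩ := hc.self_of_nhds
    rw [← h2]
    exact (h3 (1 / 2) (by constructor <;> norm_num)).1.1
  refine ⟨fun q => e.symm (ψ (q.1, e q.2)), ?_, ?_⟩
  · refine ContMDiffAt.comp (0, x₀) (I' := 𝓘(ℝ, E)) ?_ (hψ.contMDiffAt.comp (0, x₀) hch)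
    exact (contMDiffOn_extChartAt_symm x₀).contMDiffAt
      ((isOpen_extChartAt_target x₀).mem_nhds hψ0)
  · have hsrc : ∀ᶠ q in 𝓝 ((0 : ℝ), x₀), q.2 ∈ e.source :=
      continuousAt_snd.eventually_mem (extChartAt_source_mem_nhds x₀)
    filter_upwards [hev, hsrc] with q hq hqs
    obtain ⟨c, h1, h2, h3⟩ := hq
    refine ⟨e.symm ∘ c, ?_, ?_, fun t ht => ?_⟩
    · rw [Function.comp_apply, h1, e.left_inv hqs]
    · rw [Function.comp_apply, h2]
    · obtain ⟨⟨hct, hcX⟩, hd⟩ := h3 t ht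
      rw [hcX] at hd
      have hs := DiffForm.mdifferentiableAt_extChartAt_symm (I := I) x₀ hct
      have h4 := (hs.hasMFDerivAt.comp t hd.hasFDerivAt.hasMFDerivAt).hasMFDerivWithinAt
        (s := Ioo (-1) 1)
      refine h4.congr_mfderiv ?_
      refine ContinuousLinearMap.ext_ring ?_
      have h5 := congrArg (fun A : E →L[ℝ] E => (2 * q.1) • A (v (e.symm (c t))))
        (mfderivModel_extChartAt_symm_comp (I := I) x₀ hct)
      refine Eq.trans ?_ (h5.trans (one_smul ℝ _).symm)
      refine Eq.trans ?_ ((mfderivModel 𝓘(ℝ, E) I (extChartAt I x₀).symm (c t)).map_smul _ _)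
      exact congrArg (mfderivModel 𝓘(ℝ, E) I (extChartAt I x₀).symm (c t)) (one_smul ℝ _)

end Flows

/-! ### Global flows on compact manifolds -/

section GlobalFlow

variable {E : Type*} [NormedAddCommGroup E] [NormedSpace ℝ E]
  {H : Type*} [TopologicalSpace H] {I : ModelWithCorners ℝ E H}
  {M : Type*} [TopologicalSpace M] [ChartedSpace H M]

/-- The map `F` is a smooth flow of the vector field `v`. -/
structure IsSmoothFlow (v : (x : M) → TangentSpace I x) (F : ℝ × M → M) : Prop where
  contMDiff : ContMDiff (𝓘(ℝ, ℝ).prod I) I ∞ F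
  zero : ∀ x, F (0, x) = x
  add : ∀ s t x, F (s + t, x) = F (s, F (t, x))
  isMIntegralCurve : ∀ x, IsMIntegralCurve (fun t => F (t, x)) v

variable [I.Boundaryless] [IsManifold I ∞ M] {v : (x : M) → TangentSpace I x}

/-- If a one-parameter group of maps is smooth for small times, then it is smooth for all times. -/
theorem contMDiff_of_eventually {F : ℝ × M → M} {n : ℕ}
    (hadd : ∀ s t x, F (s + t, x) = F (s, F (t, x)))
    (h : ∀ᶠ t in 𝓝 (0 : ℝ), ContMDiff I I n fun x => F (t, x)) (t : ℝ) :
    ContMDiff I I n fun x => F (t, x) := by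
  have hnat : ∀ s : ℝ, (ContMDiff I I n fun x => F (s, x)) → ∀ k : ℕ,
      ContMDiff I I n fun x => F ((k + 1 : ℕ) * s, x) := by
    intro s hs k
    induction k with
    | zero => simpa using hs
    | succ k ih =>
      have : (fun x => F ((k + 1 + 1 : ℕ) * s, x)) =
          (fun x => F (s, x)) ∘ fun x => F ((k + 1 : ℕ) * s, x) := by
        funext x
        rw [Function.comp_apply, ← hadd]
        congr 2
        push_cast
        ring
      rw [this]
      exact hs.comp ih
  -- The time `t` is split into `k + 1` equal steps, small enough for the hypothesis.
  have hlim : Filter.Tendsto (fun k : ℕ => t / ((k : ℝ) + 1)) Filter.atTop (𝓝 0) := by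
    have := (tendsto_one_div_add_atTop_nhds_zero_nat (𝕜 := ℝ)).const_mul t
    simpa [div_eq_mul_inv] using this
  obtain ⟨k, hk⟩ := (hlim.eventually h).exists
  have := hnat _ hk k
  have hkt : ((k + 1 : ℕ) : ℝ) * (t / ((k : ℝ) + 1)) = t := by
    push_cast
    field_simp
  rwa [hkt] at this

/-- A smooth vector field on a compact manifold has a global smooth flow. -/
theorem IsSmoothVectorField.exists_isSmoothFlow [FiniteDimensional ℝ E] [CompactSpace M] [T2Space M]
    (hv : IsSmoothVectorField v) : ∃ F : ℝ × M → M, IsSmoothFlow v F := by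
  have : CompleteSpace E := FiniteDimensional.complete ℝ E
  have hM1 : IsManifold I 1 M := IsManifold.of_le (n := ∞) (by simp)
  -- Compactness gives an existence time common to all starting points, from which integral curves
  -- extend to all times.
  have hloc : ∀ᶠ ε in 𝓝 (0 : ℝ), ∀ x ∈ (univ : Set M), ∃ c : ℝ → M, c 0 = x ∧
      IsMIntegralCurveOn c ((2 * ε) • v) (Ioo (-1) 1) := by
    refine isCompact_univ.eventually_forall_of_forall_eventually fun x₀ _ => ?_
    obtain ⟨ψ, -, hψ⟩ := hv.exists_local_flow x₀
    filter_upwards [hψ] with q hq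
    obtain ⟨c, h0, -, h⟩ := hq
    exact ⟨c, h0, h⟩
  obtain ⟨ε, hε, hε0⟩ : ∃ ε : ℝ, (∀ x ∈ (univ : Set M), ∃ c : ℝ → M, c 0 = x ∧
      IsMIntegralCurveOn c ((2 * ε) • v) (Ioo (-1) 1)) ∧ 0 < ε :=
    ((hloc.filter_mono nhdsWithin_le_nhds).and self_mem_nhdsWithin).exists (f := 𝓝[>] (0 : ℝ))
  have hglobal : ∀ x : M, ∃ γ : ℝ → M, γ 0 = x ∧ IsMIntegralCurve γ v := by
    refine exists_isMIntegralCurve_of_isMIntegralCurveOn hv.contMDiff (ε := 2 * ε) (by positivity)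
      fun x => ?_
    obtain ⟨c, h0, h⟩ := hε x (mem_univ x)
    refine ⟨c ∘ (· * (2 * ε)⁻¹), by simpa using h0, ?_⟩
    have h1 := h.comp_mul (2 * ε)⁻¹
    rw [smul_smul, inv_mul_cancel₀ (by positivity), one_smul] at h1
    refine h1.mono fun t ht => ?_
    rw [Set.mem_ofPred_eq, ← div_eq_mul_inv]
    constructor
    · rw [lt_div_iff₀ (by positivity)]; linarith [ht.1]
    · rw [div_lt_iff₀ (by positivity)]; linarith [ht.2]
  choose γ hγ0 hγ using hglobal
  let F : ℝ × M → M := fun q => γ q.2 q.1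
  have hadd : ∀ s t x, F (s + t, x) = F (s, F (t, x)) := by
    intro s t x
    have := isMIntegralCurve_Ioo_eq_of_contMDiff_boundaryless (t₀ := 0) hv.contMDiff
      ((hγ x).comp_add t) (hγ (γ x t)) (by simp [hγ0])
    exact congrFun this s
  -- By uniqueness of integral curves `F` agrees near `(0, x₀)` with the smooth local flow, both
  -- read at time `1 / 2` of the rescaled curves.
  have hF0 : ∀ x₀, ContMDiffAt (𝓘(ℝ, ℝ).prod I) I ∞ F (0, x₀) := by
    intro x₀
    obtain ⟨ψ, hψ, hev⟩ := hv.exists_local_flow x₀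
    refine hψ.congr_of_eventuallyEq ?_
    filter_upwards [hev] with q hq
    obtain ⟨c, h0, h1, h⟩ := hq
    have h2 := isMIntegralCurveOn_Ioo_eqOn_of_contMDiff_boundaryless (t₀ := 0)
      (a := -1) (b := 1) (by constructor <;> norm_num) (hv.const_smul (2 * q.1)).contMDiff
      (((hγ q.2).comp_mul (2 * q.1)).isMIntegralCurveOn _) h (by simp [hγ0, h0])
    have h3 := h2 (x := 1 / 2) (by constructor <;> norm_num)
    rw [h1] at h3
    rw [← h3]
    simp only [F, Function.comp_apply]
    congr 1
    ring
  -- A finite order is fixed because only finite orders spread from a point to a neighbourhood. The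
  -- time interval may shrink with `n`, which the group law repairs.
  have hsmall : ∀ n : ℕ, ∀ᶠ t in 𝓝 (0 : ℝ), ∀ x ∈ (univ : Set M),
      ContMDiffAt (𝓘(ℝ, ℝ).prod I) I n F (t, x) := by
    intro n
    have hMn : IsManifold I n M := IsManifold.of_le (n := ∞) (by exact_mod_cast le_top)
    refine isCompact_univ.eventually_forall_of_forall_eventually fun x₀ _ => ?_
    have h1 : ContMDiffAt (𝓘(ℝ, ℝ).prod I) I n F (0, x₀) :=
      (hF0 x₀).of_le (by exact_mod_cast le_top)
    exact (contMDiffAt_iff_contMDiffAt_nhds (by simp)).1 h1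
  have htime : ∀ t, ContMDiff I I ∞ fun x => F (t, x) := by
    intro t
    refine contMDiff_infty.2 fun n => contMDiff_of_eventually hadd ?_ t
    filter_upwards [hsmall n] with s hs x
    exact (hs x (mem_univ x)).comp x (contMDiffAt_const.prodMk contMDiffAt_id)
  refine ⟨F, fun q => ?_, hγ0, hadd, hγ⟩
  obtain ⟨t₀, x₀⟩ := q
  -- The group law reduces joint smoothness at time `t₀` to time `0` and the smooth time-`t₀` map.
  have h1 : F = fun q => F (t₀, F (q.1 - t₀, q.2)) := by
    funext q
    rw [← hadd, add_sub_cancel]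
  rw [h1]
  have h2 : ContMDiffAt (𝓘(ℝ, ℝ).prod I) (𝓘(ℝ, ℝ).prod I) ∞
      (fun q : ℝ × M => (q.1 - t₀, q.2)) (t₀, x₀) :=
    (contMDiffAt_fst.sub contMDiffAt_const).prodMk contMDiffAt_snd
  refine ContMDiffAt.comp (t₀, x₀) (g := fun x => F (t₀, x)) (htime t₀ _) ?_
  refine ContMDiffAt.comp (t₀, x₀) (g := F) ?_ h2
  simp only [sub_self]
  exact hF0 x₀

variable {F : ℝ × M → M}

namespace IsSmoothFlow

theorem contMDiff_time (h : IsSmoothFlow v F) (t : ℝ) : ContMDiff I I ∞ fun x => F (t, x) :=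
  h.contMDiff.comp (contMDiff_const.prodMk contMDiff_id)

/-- The diffeomorphisms of a flow. -/
def diffeomorph (h : IsSmoothFlow v F) (t : ℝ) : M ≃ₘ^∞⟮I, I⟯ M where
  toFun x := F (t, x)
  invFun x := F (-t, x)
  left_inv x := by
    change F (-t, F (t, x)) = x
    rw [← h.add, neg_add_cancel, h.zero]
  right_inv x := by
    change F (t, F (-t, x)) = x
    rw [← h.add, add_neg_cancel, h.zero]
  contMDiff_toFun := h.contMDiff_time t
  contMDiff_invFun := h.contMDiff_time (-t)

end IsSmoothFlow

end GlobalFlow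

/-! ### Cartan's formula and pullback along flows -/

section FlowPullback

variable {E : Type*} [NormedAddCommGroup E] [NormedSpace ℝ E]
  {H : Type*} [TopologicalSpace H] {I : ModelWithCorners ℝ E H}
  {M : Type*} [TopologicalSpace M] [ChartedSpace H M]

open DiffForm

theorem extDeriv_one_apply {Θ : E → E [⋀^Fin 1]→L[ℝ] ℝ} (q v w : E) :
    extDeriv Θ q ![v, w] = fderiv ℝ Θ q v ![w] - fderiv ℝ Θ q w ![v] := by
  have h0 : (0 : Fin 2).removeNth ![v, w] = ![w] := by
    ext i; fin_cases i; rfl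
  have h1 : (1 : Fin 2).removeNth ![v, w] = ![v] := by
    ext i; fin_cases i; rfl
  rw [extDeriv, ContinuousAlternatingMap.alternatizeUncurryFin_apply, Fin.sum_univ_two, h0, h1]
  simp [sub_eq_add_neg]

theorem hasDerivAt_form_apply {Θ : E → E [⋀^Fin 1]→L[ℝ] ℝ} {q : E} (hΘ : DifferentiableAt ℝ Θ q)
    {γ : ℝ → E} {u : E} {t : ℝ} (hγ : HasDerivAt γ u t) (hq : γ t = q) (w : E) :
    HasDerivAt (fun t => Θ (γ t) ![w]) (fderiv ℝ Θ q u ![w]) t := by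
  subst hq
  exact ((ContinuousAlternatingMap.apply ℝ E ℝ ![w]).hasFDerivAt).comp_hasDerivAt t
    (hΘ.hasFDerivAt.comp_hasDerivAt t hγ)

theorem hasDerivAt_prodMk_left' (s r : ℝ) : HasDerivAt (fun s : ℝ => (s, r)) ((1 : ℝ), (0 : ℝ)) s :=
  (hasDerivAt_id s).prodMk (hasDerivAt_const s r)

theorem hasDerivAt_prodMk_right' (s r : ℝ) : HasDerivAt (fun r : ℝ => (s, r)) ((0 : ℝ), (1 : ℝ)) r :=
  (hasDerivAt_const r s).prodMk (hasDerivAt_id r)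

variable [I.Boundaryless] [IsManifold I ∞ M]

/-- Cartan's formula, for the pullback of a form to the plane that vanishes in the first
coordinate direction. -/
theorem DiffForm.hasDerivAt_pullback_plane {f : ℝ × ℝ → M} {η : DiffForm I M 1} (hη : η.IsSmooth)
    {s r : ℝ} (hf : ContMDiffAt 𝓘(ℝ, ℝ × ℝ) I ∞ f (s, r))
    (h0 : ∀ᶠ q in 𝓝 (s, r), (pullback 𝓘(ℝ, ℝ × ℝ) f η).lin q ((1 : ℝ), (0 : ℝ)) = 0) :
    HasDerivAt (fun s => (pullback 𝓘(ℝ, ℝ × ℝ) f η).lin (s, r) ((0 : ℝ), (1 : ℝ)))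
      (η.d.toModel (f (s, r)) ![mfderivModel 𝓘(ℝ, ℝ × ℝ) I f (s, r) ((1 : ℝ), (0 : ℝ)),
        mfderivModel 𝓘(ℝ, ℝ × ℝ) I f (s, r) ((0 : ℝ), (1 : ℝ))]) s := by
  have hηf : η.SmoothAt (f (s, r)) := (isSmooth_iff_smoothAt η).1 hη _
  have hsm := hηf.pullback hf
  have hd := d_pullback hηf hf
  set Θ : DiffForm 𝓘(ℝ, ℝ × ℝ) (ℝ × ℝ) 1 := pullback 𝓘(ℝ, ℝ × ℝ) f η with hΘdef
  have hΘ : DifferentiableAt ℝ (show ℝ × ℝ → (ℝ × ℝ) [⋀^Fin 1]→L[ℝ] ℝ from Θ) (s, r) := by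
    have h1 : ContDiffAt ℝ ∞ (Θ.inChart (s, r)) (extChartAt 𝓘(ℝ, ℝ × ℝ) (s, r) (s, r)) := hsm
    rw [inChart_self] at h1
    exact h1.differentiableAt (by simp)
  have hlin : ∀ q w, Θ.lin q w = (show ℝ × ℝ → (ℝ × ℝ) [⋀^Fin 1]→L[ℝ] ℝ from Θ) q ![w] :=
    fun q w => (apply_eq_lin Θ q w).symm
  have h1 := hasDerivAt_form_apply hΘ (hasDerivAt_prodMk_left' s r) rfl ((0 : ℝ), (1 : ℝ))
  have h2 := hasDerivAt_form_apply hΘ (hasDerivAt_prodMk_right' s r) rfl ((1 : ℝ), (0 : ℝ))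
  -- The first-direction component vanishes near the point, hence so does its derivative in the
  -- second direction. Only one term of `dΘ` survives.
  have h3 : fderiv ℝ (show ℝ × ℝ → (ℝ × ℝ) [⋀^Fin 1]→L[ℝ] ℝ from Θ) (s, r) ((0 : ℝ), (1 : ℝ))
      ![((1 : ℝ), (0 : ℝ))] = 0 := by
    refine h2.unique ((hasDerivAt_const r (0 : ℝ)).congr_of_eventuallyEq ?_)
    have hc : ContinuousAt (fun r : ℝ => (s, r)) r := by fun_prop
    filter_upwards [hc.eventually h0] with r' hr'
    rw [← hlin]
    exact hr'
  have h4 := extDeriv_one_apply (Θ := (show ℝ × ℝ → (ℝ × ℝ) [⋀^Fin 1]→L[ℝ] ℝ from Θ)) (s, r)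
    ((1 : ℝ), (0 : ℝ)) ((0 : ℝ), (1 : ℝ))
  rw [h3, sub_zero, ← d_self] at h4
  have h5 := congrArg (fun A : (ℝ × ℝ) [⋀^Fin 2]→L[ℝ] ℝ =>
    A ![((1 : ℝ), (0 : ℝ)), ((0 : ℝ), (1 : ℝ))]) hd
  have h6 : pullback 𝓘(ℝ, ℝ × ℝ) f η.d (s, r) ![((1 : ℝ), (0 : ℝ)), ((0 : ℝ), (1 : ℝ))] =
      η.d.toModel (f (s, r)) ![mfderivModel 𝓘(ℝ, ℝ × ℝ) I f (s, r) ((1 : ℝ), (0 : ℝ)),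
        mfderivModel 𝓘(ℝ, ℝ × ℝ) I f (s, r) ((0 : ℝ), (1 : ℝ))] := by
    rw [pullback_apply]
    refine congrArg (η.d.toModel (f (s, r))) ?_
    ext i
    fin_cases i <;> rfl
  rw [← h6]
  refine (h1.congr_deriv (h4.symm.trans h5)).congr_of_eventuallyEq ?_
  exact Filter.Eventually.of_forall fun s' => hlin (s', r) _

theorem exists_curve (x : M) (w : E) : ∃ c : ℝ → M, ContMDiffAt 𝓘(ℝ, ℝ) I ∞ c 0 ∧ c 0 = x ∧
    mfderivModel 𝓘(ℝ, ℝ) I c 0 1 = w := by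
  have hz := mem_extChartAt_target (I := I) x
  let l : ℝ → E := fun r => extChartAt I x x + r • mfderivModel I 𝓘(ℝ, E) (extChartAt I x) x w
  have hl0 : l 0 = extChartAt I x x := by simp [l]
  have hl : ContDiff ℝ ∞ l := contDiff_const.add (contDiff_id.smul contDiff_const)
  have hs : ContMDiffAt 𝓘(ℝ, E) I ∞ (extChartAt I x).symm (l 0) := by
    rw [hl0]
    exact (contMDiffOn_extChartAt_symm x).contMDiffAt ((isOpen_extChartAt_target x).mem_nhds hz)
  refine ⟨(extChartAt I x).symm ∘ l, hs.comp 0 hl.contMDiff.contMDiffAt, ?_, ?_⟩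
  · rw [Function.comp_apply, hl0, extChartAt_to_inv]
  · have h1 : HasDerivAt l (mfderivModel I 𝓘(ℝ, E) (extChartAt I x) x w) 0 := by
      have h0 := ((hasDerivAt_id (0 : ℝ)).smul_const
        (mfderivModel I 𝓘(ℝ, E) (extChartAt I x) x w)).const_add (extChartAt I x x)
      rwa [one_smul] at h0
    have h2 : mfderivModel 𝓘(ℝ, ℝ) 𝓘(ℝ, E) l 0 1 =
        mfderivModel I 𝓘(ℝ, E) (extChartAt I x) x w :=
      (congrArg (fun A : ℝ →L[ℝ] E => A 1) h1.hasFDerivAt.hasMFDerivAt.mfderiv).trans (one_smul ℝ _)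
    have h3 := mfderivModel_comp (hl.contMDiff.contMDiffAt.mdifferentiableAt (x := (0 : ℝ)) (by simp))
      (mdifferentiableAt_extChartAt_symm (I := I) x hz) hl0
    rw [h3, ContinuousLinearMap.comp_apply, h2]
    have h4 := congrArg (fun A : E →L[ℝ] E => A w) (mfderivModel_extChartAt_symm_comp (I := I) x hz)
    simpa [extChartAt_to_inv] using h4

variable {v : (x : M) → TangentSpace I x} {F : ℝ × M → M}

namespace IsSmoothFlow

/-- For a curve `c` with velocity `w` at `x`, the map `(s, r) ↦ F (s, c r)` has `v` as its first
partial derivative. The hypothesis `η(v) = 0` is then that of `hasDerivAt_pullback_plane`. -/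
theorem hasDerivAt_pullback (hF : IsSmoothFlow v F) {η : DiffForm I M 1} (hη : η.IsSmooth)
    (hv : ∀ x, η.lin x (v x) = 0) (x : M) (w : E) (s : ℝ) :
    HasDerivAt (fun s => (pullback I (fun x => F (s, x)) η).lin x w)
      (η.d.toModel (F (s, x)) ![v (F (s, x)), mfderivModel I I (fun x => F (s, x)) x w]) s := by
  obtain ⟨c, hc, hc0, hcw⟩ := exists_curve (I := I) x w
  let f : ℝ × ℝ → M := fun q => F (q.1, c q.2)
  have hfc : ∀ n : WithTop ℕ∞, n ≤ ∞ → ∀ s r, ContMDiffAt 𝓘(ℝ, ℝ) I n c r →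
      ContMDiffAt 𝓘(ℝ, ℝ × ℝ) I n f (s, r) := by
    intro n hn s r hcr
    have h1 : ContMDiffAt 𝓘(ℝ, ℝ × ℝ) 𝓘(ℝ, ℝ) n (fun q : ℝ × ℝ => q.1) (s, r) :=
      contDiff_fst.contMDiff.contMDiffAt
    have h2 : ContMDiffAt 𝓘(ℝ, ℝ × ℝ) 𝓘(ℝ, ℝ) n (fun q : ℝ × ℝ => q.2) (s, r) :=
      contDiff_snd.contMDiff.contMDiffAt
    exact ContMDiffAt.comp (s, r) (g := F) (hF.contMDiff.contMDiffAt.of_le hn)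
      (h1.prodMk (ContMDiffAt.comp (s, r) (g := c) hcr h2))
  have hfst : ∀ s r, ContMDiffAt 𝓘(ℝ, ℝ) I 1 c r →
      mfderivModel 𝓘(ℝ, ℝ × ℝ) I f (s, r) ((1 : ℝ), (0 : ℝ)) = v (f (s, r)) := by
    intro s r hcr
    have h1 := mfderivModel_comp (x := s) (f := fun s : ℝ => (s, r))
      (hasDerivAt_prodMk_left' s r).hasFDerivAt.hasMFDerivAt.mdifferentiableAt
      ((hfc 1 (by simp) s r hcr).mdifferentiableAt (by simp)) rfl
    have h2 : mfderivModel 𝓘(ℝ, ℝ) 𝓘(ℝ, ℝ × ℝ) (fun s : ℝ => (s, r)) s 1 = ((1 : ℝ), (0 : ℝ)) :=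
      (congrArg (fun A : ℝ →L[ℝ] ℝ × ℝ => A 1)
        (hasDerivAt_prodMk_left' s r).hasFDerivAt.hasMFDerivAt.mfderiv).trans (one_smul ℝ _)
    have h3 : mfderivModel 𝓘(ℝ, ℝ) I (f ∘ fun s : ℝ => (s, r)) s 1 = v (f (s, r)) :=
      (congrArg (fun A : ℝ →L[ℝ] E => A 1) (hF.isMIntegralCurve (c r) s).mfderiv).trans
        (one_smul ℝ _)
    rw [← h3, h1, ContinuousLinearMap.comp_apply, h2]
  have hsnd : ∀ s, mfderivModel 𝓘(ℝ, ℝ × ℝ) I f (s, 0) ((0 : ℝ), (1 : ℝ)) =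
      mfderivModel I I (fun x => F (s, x)) x w := by
    intro s
    have h1 := mfderivModel_comp (x := (0 : ℝ)) (f := fun r : ℝ => (s, r))
      (hasDerivAt_prodMk_right' s 0).hasFDerivAt.hasMFDerivAt.mdifferentiableAt
      ((hfc ∞ le_rfl s 0 hc).mdifferentiableAt (by simp)) rfl
    have h2 : mfderivModel 𝓘(ℝ, ℝ) 𝓘(ℝ, ℝ × ℝ) (fun r : ℝ => (s, r)) 0 1 = ((0 : ℝ), (1 : ℝ)) :=
      (congrArg (fun A : ℝ →L[ℝ] ℝ × ℝ => A 1)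
        (hasDerivAt_prodMk_right' s 0).hasFDerivAt.hasMFDerivAt.mfderiv).trans (one_smul ℝ _)
    have h3 := mfderivModel_comp (g := fun x => F (s, x)) (hc.mdifferentiableAt (by simp))
      ((hF.contMDiff_time s x).mdifferentiableAt (by simp)) hc0
    rw [← hcw, ← h2, ← ContinuousLinearMap.comp_apply, ← h1, ← ContinuousLinearMap.comp_apply, ← h3]
    rfl
  have hf0 : ∀ s, f (s, 0) = F (s, x) := fun s => by simp only [f, hc0]
  have hc1 : ∀ᶠ r in 𝓝 (0 : ℝ), ContMDiffAt 𝓘(ℝ, ℝ) I 1 c r := eventually_contMDiffAt_one hc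
  have hc1' : ∀ᶠ q in 𝓝 (s, (0 : ℝ)), ContMDiffAt 𝓘(ℝ, ℝ) I 1 c q.2 :=
    continuousAt_snd.eventually hc1
  have key := hasDerivAt_pullback_plane hη (hfc ∞ le_rfl s 0 hc) (hc1'.mono fun q hq =>
    (congrArg (η.lin (f q)) (hfst q.1 q.2 hq)).trans (hv _))
  rw [hfst s 0 (hc.of_le (by simp)), hsnd] at key
  have hval : ∀ s, (pullback I (fun x => F (s, x)) η).lin x w =
      (pullback 𝓘(ℝ, ℝ × ℝ) f η).lin (s, 0) ((0 : ℝ), (1 : ℝ)) := by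
    intro s
    refine Eq.trans ?_ (congrArg (η.lin (f (s, 0))) (hsnd s)).symm
    exact lin_congr η (hf0 s).symm _
  simp only [hval]
  refine key.congr_deriv ?_
  have hcongr : ∀ y, y = F (s, x) → ∀ u : E,
      η.d.toModel y ![(v y : E), u] = η.d.toModel (F (s, x)) ![(v (F (s, x)) : E), u] := by
    rintro y rfl u
    rfl
  exact hcongr _ (hf0 s) _

/-- Both terms of the Lie derivative, `dβ(v, ·)` and `d(β(v))`, vanish. -/
theorem pullback_eq_of_closed (hF : IsSmoothFlow v F) {β : DiffForm I M 1} (hβ : β.IsSmooth)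
    (hd : β.d = 0) (hv : ∀ x, β.lin x (v x) = 0) (s : ℝ) (x : M) (w : E) :
    (pullback I (fun x => F (s, x)) β).lin x w = β.lin x w := by
  have h1 : ∀ s, HasDerivAt (fun s => (pullback I (fun x => F (s, x)) β).lin x w) 0 s := fun s =>
    (hF.hasDerivAt_pullback hβ hv x w s).congr_deriv (by rw [hd]; rfl)
  have h2 := is_const_of_deriv_eq_zero (fun s => (h1 s).differentiableAt) (fun s => (h1 s).deriv) s 0
  rw [h2]
  have h3 : (fun x => F (0, x)) = id := funext hF.zero
  rw [h3]
  exact lin_eq_of_eq (pullback_id β x) w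

/-- If `α(v) = 0` and `dα(v, ·) = β` is closed, then the flow of `v` carries `α` to `α + s β`. -/
theorem pullback_eq_add_smul (hF : IsSmoothFlow v F) {α β : DiffForm I M 1} (hα : α.IsSmooth)
    (hβ : β.IsSmooth) (hd : β.d = 0) (hαv : ∀ x, α.lin x (v x) = 0)
    (hdα : ∀ x w, α.d.toModel x ![v x, w] = β.lin x w) (s : ℝ) (x : M) (w : E) :
    (pullback I (fun x => F (s, x)) α).lin x w = α.lin x w + s * β.lin x w := by
  have hβv : ∀ x, β.lin x (v x) = 0 := by
    intro x
    refine (hdα x (v x)).symm.trans ?_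
    exact (α.d.toModel x).map_eq_zero_of_eq _ (i := 0) (j := 1) rfl (by simp)
  have h1 : ∀ s, HasDerivAt (fun s => (pullback I (fun x => F (s, x)) α).lin x w - s * β.lin x w)
      0 s := fun s =>
    ((hF.hasDerivAt_pullback hα hαv x w s).sub ((hasDerivAt_id s).mul_const _)).congr_deriv (by
      rw [hdα, one_mul, sub_eq_zero]
      exact hF.pullback_eq_of_closed hβ hd hβv s x w)
  have h2 := is_const_of_deriv_eq_zero (fun s => (h1 s).differentiableAt) (fun s => (h1 s).deriv) s 0
  have h3 : (fun x => F (0, x)) = id := funext hF.zero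
  have h4 : (pullback I (fun x => F (0, x)) α).lin x w = α.lin x w := by
    rw [h3]
    exact lin_eq_of_eq (pullback_id α x) w
  rw [h4] at h2
  linarith

end IsSmoothFlow

end FlowPullback

/-! ### Linear algebra of contact forms -/

section ContactLinearAlgebra

variable {E : Type*} [NormedAddCommGroup E] [NormedSpace ℝ E]

/-- The bilinear form `a ⊗ a + b` defined by a linear form and an alternating form. -/
def contactBilin (a : E →L[ℝ] ℝ) (b : E [⋀^Fin 2]→L[ℝ] ℝ) : E →L[ℝ] E →L[ℝ] ℝ :=
  a.smulRight a +
    ((ContinuousAlternatingMap.ofSubsingletonLIE (𝕜 := ℝ) (E := E) (F := ℝ) (0 : Fin 1)).symm :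
      E [⋀^Fin 1]→L[ℝ] ℝ →L[ℝ] E →L[ℝ] ℝ).comp b.curryLeft

theorem contactBilin_apply (a : E →L[ℝ] ℝ) (b : E [⋀^Fin 2]→L[ℝ] ℝ) (v w : E) :
    contactBilin a b v w = a v * a w + b ![v, w] := by
  change a v * a w + b (Matrix.vecCons v fun _ => w) = _
  congr 2
  ext i
  fin_cases i <;> rfl

theorem contactBilin_apply_self (a : E →L[ℝ] ℝ) (b : E [⋀^Fin 2]→L[ℝ] ℝ) (v : E) :
    contactBilin a b v v = a v * a v := by
  rw [contactBilin_apply, b.map_eq_zero_of_eq ![v, v] (i := 0) (j := 1) rfl (by simp), add_zero]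

theorem isInvertible_of_injective [FiniteDimensional ℝ E] {B : E →L[ℝ] E →L[ℝ] ℝ}
    (hB : Function.Injective B) : B.IsInvertible := by
  have hfin : Module.finrank ℝ E = Module.finrank ℝ (E →L[ℝ] ℝ) := by
    rw [← Subspace.dual_finrank_eq]
    exact (LinearMap.toContinuousLinearMap (𝕜 := ℝ) (E := E) (F' := ℝ)).finrank_eq
  let e := (LinearEquiv.ofInjectiveOfFinrankEq (B : E →ₗ[ℝ] E →L[ℝ] ℝ) hB hfin).toContinuousLinearEquiv
  exact ⟨e, rfl⟩

end ContactLinearAlgebra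

/-! ### The stability argument -/

section Moser

variable {E : Type*} [NormedAddCommGroup E] [NormedSpace ℝ E]
  {H : Type*} [TopologicalSpace H] {I : ModelWithCorners ℝ E H}
  {M : Type*} [TopologicalSpace M] [ChartedSpace H M]

namespace DiffForm

/-- The bilinear form `α ⊗ α + dα` on the tangent space at `x`. -/
def contactBilinAt (α : DiffForm I M 1) (x : M) : E →L[ℝ] E →L[ℝ] ℝ :=
  contactBilin (α.lin x) (α.d.toModel x)

variable {α β : DiffForm I M 1}

/-- Pairing `v` with itself leaves `α(v) ^ 2`, so a vector in the kernel has `α(v) = 0`, and then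
`dα(v, ·) = 0`. -/
theorem IsContactForm.contactBilinAt_injective (hα : α.IsContactForm) (x : M) :
    Function.Injective (α.contactBilinAt x) := by
  refine (injective_iff_map_eq_zero _).2 fun v hv => ?_
  have h0 : α.lin x v = 0 := by
    have := contactBilin_apply_self (α.lin x) (α.d.toModel x) v
    rw [← contactBilinAt, hv] at this
    simpa using this.symm
  refine hα.nondegenerate x v ((apply_eq_lin α x v).trans h0) fun w _ => ?_
  have := contactBilin_apply (α.lin x) (α.d.toModel x) v w
  rw [← contactBilinAt, hv, h0, zero_mul, zero_add] at this
  exact this.symm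

/-- The vector field `v` with `α(v) α + dα(v, ·) = β`. -/
def moserField (α β : DiffForm I M 1) (x : M) : TangentSpace I x :=
  (α.contactBilinAt x).inverse (β.lin x)

variable [FiniteDimensional ℝ E]

theorem IsContactForm.contactBilinAt_moserField (hα : α.IsContactForm) (x : M) :
    α.contactBilinAt x (moserField α β x) = β.lin x :=
  (((isInvertible_of_injective (hα.contactBilinAt_injective x)).inverse_apply_eq).1 rfl).symm

variable [I.Boundaryless] [IsManifold I ∞ M]

/-- In coordinates the field solves a linear system with smooth coefficients and invertible
operator, and inversion of operators is smooth. -/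
theorem IsContactForm.isSmoothVectorField_moserField (hα : α.IsContactForm) (hβ : β.IsSmooth) :
    IsSmoothVectorField (moserField α β) := by
  intro x₀
  have : CompleteSpace E := FiniteDimensional.complete ℝ E
  let a : E → E [⋀^Fin 1]→L[ℝ] ℝ := α.inChart x₀
  let l : (E [⋀^Fin 1]→L[ℝ] ℝ) →L[ℝ] E →L[ℝ] ℝ :=
    ((ContinuousAlternatingMap.ofSubsingletonLIE (𝕜 := ℝ) (E := E) (F := ℝ) (0 : Fin 1)).symm :
      E [⋀^Fin 1]→L[ℝ] ℝ →L[ℝ] E →L[ℝ] ℝ)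
  let B : E → E →L[ℝ] E →L[ℝ] ℝ := fun z => contactBilin (l (a z)) (extDeriv a z)
  let b : E → E →L[ℝ] ℝ := fun z => l (β.inChart x₀ z)
  have ho := isOpen_extChartAt_target (I := I) x₀
  have ha : ContDiffOn ℝ ∞ a (extChartAt I x₀).target := hα.smooth x₀
  have hla : ContDiffOn ℝ ∞ (fun z => l (a z)) (extChartAt I x₀).target := l.contDiff.comp_contDiffOn ha
  have hb : ContDiffOn ℝ ∞ b (extChartAt I x₀).target := l.contDiff.comp_contDiffOn (hβ x₀)
  have hfa : ContDiffOn ℝ ∞ (fderiv ℝ a) (extChartAt I x₀).target :=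
    ha.fderiv_of_isOpen ho (by simp)
  have hB : ContDiffOn ℝ ∞ B (extChartAt I x₀).target := by
    refine contDiffOn_clm_apply.2 fun u => contDiffOn_clm_apply.2 fun w => ?_
    simp only [B, contactBilin_apply, extDeriv_one_apply]
    refine ((hla.clm_apply contDiffOn_const).mul (hla.clm_apply contDiffOn_const)).add ?_
    exact ((ContinuousAlternatingMap.apply ℝ E ℝ ![w]).contDiff.comp_contDiffOn
      (hfa.clm_apply contDiffOn_const)).sub
      ((ContinuousAlternatingMap.apply ℝ E ℝ ![u]).contDiff.comp_contDiffOn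
      (hfa.clm_apply contDiffOn_const))
  have key : ∀ z ∈ (extChartAt I x₀).target, (B z).IsInvertible ∧
      vectorFieldInChart (moserField α β) x₀ z = (B z).inverse (b z) := by
    intro z hz
    set A := mfderivModel 𝓘(ℝ, E) I (extChartAt I x₀).symm z with hA
    set x := (extChartAt I x₀).symm z with hx
    have hAD := mfderivModel_extChartAt_symm_comp (I := I) x₀ hz
    -- By `d_inChart`, the coordinate operator is the pullback of `α ⊗ α + dα` by the isomorphism
    -- `A`.
    have hBz : ∀ u w, B z u w = α.contactBilinAt x (A u) (A w) := by
      intro u w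
      simp only [B]
      rw [contactBilin_apply, contactBilinAt, contactBilin_apply]
      refine congrArg₂ (· + ·) rfl ?_
      have h1 := congrArg (fun θ : E [⋀^Fin 2]→L[ℝ] ℝ => θ ![u, w]) (d_inChart hα.smooth x₀ hz)
      refine h1.symm.trans ?_
      change α.d.toModel x (fun i => A (![u, w] i)) = _
      congr 1
      ext i
      fin_cases i <;> rfl
    have hbz (w : E) : b z w = β.lin x (A w) := rfl
    have hAs : Function.Surjective A := fun w => ⟨_, congrArg (fun L : E →L[ℝ] E => L w) hAD⟩
    have hAi : Function.Injective A :=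
      (LinearMap.injective_iff_surjective (f := (A : E →ₗ[ℝ] E))).2 hAs
    have hinv : (B z).IsInvertible := by
      refine isInvertible_of_injective ((injective_iff_map_eq_zero _).2 fun u hu => ?_)
      refine (injective_iff_map_eq_zero A).1 hAi u ?_
      refine (injective_iff_map_eq_zero _).1 (hα.contactBilinAt_injective x) _ ?_
      ext w
      obtain ⟨w, rfl⟩ := hAs w
      rw [← hBz, hu]
      rfl
    refine ⟨hinv, (hinv.inverse_apply_eq.2 ?_).symm⟩
    ext w
    rw [hbz, hBz]
    have h2 : A (vectorFieldInChart (moserField α β) x₀ z) = moserField α β x :=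
      congrArg (fun L : E →L[ℝ] E => L (moserField α β x)) hAD
    rw [h2]
    exact (congrArg (fun L : E →L[ℝ] ℝ => L (A w)) (hα.contactBilinAt_moserField x)).symm
  refine ContDiffOn.congr (f := fun z => (B z).inverse (b z)) (fun z hz => ?_) fun z hz => (key z hz).2
  exact (((key z hz).1.contDiffAt_map_inverse).comp z (hB.contDiffAt (ho.mem_nhds hz))).contDiffWithinAt.clm_apply (hb z hz)

/-- Moser stability for a contact form `α` and a closed form `β` vanishing on the Reeb field. -/
theorem IsContactForm.exists_diffeomorph [CompactSpace M] [T2Space M] (hα : α.IsContactForm)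
    (hβ : β.IsSmooth) (hd : β.d = 0) (R : M → E) (hR₁ : ∀ x, α.lin x (R x) = 1)
    (hR₂ : ∀ x w, α.d.toModel x ![R x, w] = 0) (hR₃ : ∀ x, β.lin x (R x) = 0) :
    ∃ Φ : M ≃ₘ^∞⟮I, I⟯ M, ∀ x w, (pullback I Φ (α + β)).lin x w = α.lin x w := by
  have h0 : ∀ x w, α.lin x (moserField α β x) * α.lin x w + α.d.toModel x ![moserField α β x, w] =
      β.lin x w := fun x w =>
    (contactBilin_apply (α.lin x) (α.d.toModel x) (moserField α β x) w).symm.trans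
      (congrArg (fun L : E →L[ℝ] ℝ => L w) (hα.contactBilinAt_moserField x))
  -- The defining equation is evaluated on `R`, where both `dα` and `β` vanish and `α` is `1`.
  have hαv : ∀ x, α.lin x (moserField α β x) = 0 := by
    intro x
    have h1 := h0 x (R x)
    have h2 : α.d.toModel x ![moserField α β x, R x] = 0 := by
      have h3 := (α.d.toModel x).map_swap ![R x, moserField α β x] (i := 0) (j := 1) (by simp)
      have h4 : (![R x, moserField α β x] : Fin 2 → E) ∘ Equiv.swap 0 1 =
          ![moserField α β x, R x] := by
        ext i
        fin_cases i <;> rfl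
      rw [h4] at h3
      exact h3.trans ((congrArg Neg.neg (hR₂ x _)).trans neg_zero)
    rw [hR₁, hR₃, mul_one] at h1
    linarith
  have hdα : ∀ x w, α.d.toModel x ![moserField α β x, w] = β.lin x w := fun x w => by
    have h1 := h0 x w
    rw [hαv, zero_mul, zero_add] at h1
    exact h1
  have hβv : ∀ x, β.lin x (moserField α β x) = 0 := by
    intro x
    refine (hdα x (moserField α β x)).symm.trans ?_
    exact (α.d.toModel x).map_eq_zero_of_eq _ (i := 0) (j := 1) rfl (by simp)
  obtain ⟨F, hF⟩ := (hα.isSmoothVectorField_moserField hβ).exists_isSmoothFlow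
  -- At time `-1` the pullback of `α` is `α - β` and that of `β` is `β`.
  refine ⟨hF.diffeomorph (-1), fun x w => ?_⟩
  have h1 := hF.pullback_eq_add_smul hα.smooth hβ hd hαv hdα (-1) x w
  have h2 := hF.pullback_eq_of_closed hβ hd hβv (-1) x w
  change (pullback I (fun x => F (-1, x)) α).lin x w + (pullback I (fun x => F (-1, x)) β).lin x w = _
  rw [h1, h2]
  ring

end DiffForm

end Moser

/-! ### Connections with equal curvature -/

section CompareConnections

variable {E : Type*} [NormedAddCommGroup E] [NormedSpace ℝ E]
  {H : Type*} [TopologicalSpace H] {I : ModelWithCorners ℝ E H}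
  {F : Type*} [NormedAddCommGroup F] [NormedSpace ℝ F]
  {G : Type*} [TopologicalSpace G] {J : ModelWithCorners ℝ F G}
  {F' : Type*} [NormedAddCommGroup F'] [NormedSpace ℝ F']
  {G' : Type*} [TopologicalSpace G'] {J' : ModelWithCorners ℝ F' G'}
  {W : Type*} [TopologicalSpace W] [ChartedSpace H W]
  {P : Type*} [TopologicalSpace P] [ChartedSpace G P] [MulAction Circle P]
  {S : Type*} [TopologicalSpace S] [ChartedSpace G' S] [MulAction Circle S]

open DiffForm

theorem mfderivModel_fundamentalVector {Φ : P → S}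
    (hs : ContMDiff ((𝓡 1).prod J) J ∞ (fun q : Circle × P => q.1 • q.2))
    (hΦ : ContMDiff J J' ∞ Φ) (heq : ∀ (z : Circle) p, Φ (z • p) = z • Φ p) (p : P) :
    mfderivModel J J' Φ p (fundamentalVector J p) = fundamentalVector J' (Φ p) := by
  have hod : MDifferentiable 𝓘(ℝ, ℝ) J (fun s : ℝ => Circle.exp (2 * Real.pi * s) • p) :=
    ((contMDiff_exp_smul hs).comp (contMDiff_id.prodMk contMDiff_const)).mdifferentiable (by simp)
  have h1 := mfderivModel_comp (x := (0 : ℝ)) (hod 0) ((hΦ p).mdifferentiableAt (by simp)) (by simp)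
  have h2 : (Φ ∘ fun s : ℝ => Circle.exp (2 * Real.pi * s) • p) =
      fun s : ℝ => Circle.exp (2 * Real.pi * s) • Φ p := funext fun s => heq _ _
  rw [h2] at h1
  exact (congrArg (fun A : ℝ →L[ℝ] F' => A 1) h1).symm

variable [I.Boundaryless] [J.Boundaryless] [J'.Boundaryless]
  [IsManifold I ∞ W] [IsManifold J ∞ P] [IsManifold J' ∞ S]

/-- Two connections with the same symplectic curvature on isomorphic circle bundles with compact
total space have contactomorphic contact structures. -/
theorem IsCircleConnection.contactomorphic [FiniteDimensional ℝ F] [CompactSpace P] [T2Space P]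
    {π : P → W} {πS : S → W} {α : DiffForm J P 1} {αS : DiffForm J' S 1} {η : DiffForm I W 2}
    (hη : η.IsSymplectic) (hP : IsCircleConnection I J π α η)
    (hS : IsCircleConnection I J' πS αS η) (Φ : P ≃ₘ^∞⟮J, J'⟯ S) (hΦπ : ∀ p, πS (Φ p) = π p)
    (heq : ∀ (z : Circle) p, Φ (z • p) = z • Φ p) : α.Contactomorphic αS := by
  have hΦ : ContMDiff J J' ∞ Φ := Φ.contMDiff
  have hΦd : ∀ p, MDifferentiableAt J J' Φ p := fun p => (hΦ p).mdifferentiableAt (by simp)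
  have hΦα : (pullback J Φ αS).IsSmooth := hS.smooth.pullback hΦ
  -- Equal curvatures make this difference closed, and equivariance of `Φ` with equal normalizations
  -- makes it vanish on the fundamental vector field.
  let β : DiffForm J P 1 := pullback J Φ αS + (-1 : ℝ) • α
  have hβs : ∀ p, β.SmoothAt p := fun p => ((isSmooth_iff_smoothAt _).1 hΦα p).add
    (((isSmooth_iff_smoothAt _).1 hP.smooth p).const_smul _)
  have hβ : β.IsSmooth := (isSmooth_iff_smoothAt _).2 hβs
  have hd : β.d = 0 := by
    funext p
    have h1 : (pullback J Φ αS).d p = α.d p := by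
      rw [d_pullback ((isSmooth_iff_smoothAt _).1 hS.smooth _) (hΦ p), hS.curvature, hP.curvature,
        ← pullback_comp _ (hΦd p) ((hS.bundle.contMDiff_proj _).mdifferentiableAt (by simp))]
      exact pullback_congr η (Filter.Eventually.of_forall hΦπ)
    rw [d_add ((isSmooth_iff_smoothAt _).1 hΦα p)
      (((isSmooth_iff_smoothAt _).1 hP.smooth p).const_smul _), d_smul, h1]
    ext v
    change α.d p v + (-1) * α.d p v = 0
    ring
  have hβR : ∀ p, β.lin p (fundamentalVector J p) = 0 := by
    intro p
    have h1 : (pullback J Φ αS).lin p (fundamentalVector J p) = 1 :=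
      (congrArg (αS.lin (Φ p)) (mfderivModel_fundamentalVector hP.bundle.smooth_smul hΦ heq p)).trans
        (hS.lin_fundamentalVector _)
    change (pullback J Φ αS).lin p (fundamentalVector J p) +
      (-1) * α.lin p (fundamentalVector J p) = 0
    rw [h1, hP.lin_fundamentalVector]
    norm_num
  obtain ⟨Ψ, hΨ⟩ := (hP.isContactForm hη).exists_diffeomorph hβ hd (fundamentalVector J)
    hP.lin_fundamentalVector (fun p w => hP.d_fundamentalVector p w) hβR
  have hsum : α + β = pullback J Φ αS := by
    simp only [β]
    funext p
    ext v
    simp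
  rw [hsum] at hΨ
  refine ⟨Ψ.trans Φ, fun p v => ?_⟩
  have hΨd : MDifferentiableAt J J Ψ p := (Ψ.contMDiff p).mdifferentiableAt (by simp)
  have h1 : (pullback J (Φ ∘ Ψ) αS).lin p v = α.lin p v :=
    (lin_eq_of_eq (pullback_comp αS hΨd (hΦd _)) v).trans (hΨ p v)
  rw [apply_eq_lin, apply_eq_lin]
  exact iff_of_eq (congrArg (· = 0) h1)

end CompareConnections

theorem theorem3p3 {n₁ n₂ : ℕ}
    {W₁ : Type*} [TopologicalSpace W₁] [T2Space W₁] [SecondCountableTopology W₁]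
    [ChartedSpace (EuclideanSpace ℝ (Fin n₁)) W₁] [IsManifold (𝓡 n₁) ∞ W₁]
    {W₂ : Type*} [TopologicalSpace W₂] [T2Space W₂] [SecondCountableTopology W₂]
    [ChartedSpace (EuclideanSpace ℝ (Fin n₂)) W₂] [IsManifold (𝓡 n₂) ∞ W₂]
    {P₁ : Type*} [TopologicalSpace P₁] [T2Space P₁] [SecondCountableTopology P₁]
    [ChartedSpace (EuclideanSpace ℝ (Fin (n₁ + 1))) P₁] [IsManifold (𝓡 (n₁ + 1)) ∞ P₁]
    [MulAction Circle P₁]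
    {P₂ : Type*} [TopologicalSpace P₂] [T2Space P₂] [SecondCountableTopology P₂]
    [ChartedSpace (EuclideanSpace ℝ (Fin (n₂ + 1))) P₂] [IsManifold (𝓡 (n₂ + 1)) ∞ P₂]
    [MulAction Circle P₂]
    (ω₁ : DiffForm (𝓡 n₁) W₁ 2) (π₁ : P₁ → W₁) (α₁ : DiffForm (𝓡 (n₁ + 1)) P₁ 1)
    (h₁ : IsBoothbyWang (𝓡 n₁) (𝓡 (n₁ + 1)) π₁ α₁ ω₁)
    (ω₂ : DiffForm (𝓡 n₂) W₂ 2) (π₂ : P₂ → W₂) (α₂ : DiffForm (𝓡 (n₂ + 1)) P₂ 1)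
    (h₂ : IsBoothbyWang (𝓡 n₂) (𝓡 (n₂ + 1)) π₂ α₂ ω₂)
    (a b : ℤ) (hab : IsCoprime a b) :
    (a ≠ 0 → b ≠ 0 → (DiffForm.weightedSum b a ω₁ ω₂).IsSymplectic) ∧
    ∃ (_ : ChartedSpace (EuclideanSpace ℝ (Fin (n₁ + n₂ + 1))) (OrbitSpace a b P₁ P₂))
      (_ : MulAction Circle (OrbitSpace a b P₁ P₂))
      (π : OrbitSpace a b P₁ P₂ → W₁ × W₂)
      (α : DiffForm (𝓡 (n₁ + n₂ + 1)) (OrbitSpace a b P₁ P₂) 1),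
      -- the orbit space is a manifold, and the projection to it is a smooth submersion
      T2Space (OrbitSpace a b P₁ P₂) ∧
      SecondCountableTopology (OrbitSpace a b P₁ P₂) ∧
      IsManifold (𝓡 (n₁ + n₂ + 1)) ∞ (OrbitSpace a b P₁ P₂) ∧
      ContMDiff ((𝓡 (n₁ + 1)).prod (𝓡 (n₂ + 1))) (𝓡 (n₁ + n₂ + 1)) ∞
        (OrbitSpace.mk a b : P₁ × P₂ → OrbitSpace a b P₁ P₂) ∧
      (∀ x : P₁ × P₂, Function.Surjective (mfderiv ((𝓡 (n₁ + 1)).prod (𝓡 (n₂ + 1)))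
        (𝓡 (n₁ + n₂ + 1)) (OrbitSpace.mk a b : P₁ × P₂ → OrbitSpace a b P₁ P₂) x)) ∧
      -- it is a circle bundle over the product through the induced projection and action,
      -- namely the one of the tensor product line bundle
      (∀ p q, π (OrbitSpace.mk a b (p, q)) = (π₁ p, π₂ q)) ∧
      (∀ (z w : Circle) (p : P₁) (q : P₂),
        OrbitSpace.mk a b (z • p, w • q) = (z ^ b * w ^ a) • OrbitSpace.mk a b (p, q)) ∧
      IsTensorCircleBundle (𝓡 n₁) (𝓡 n₂) (𝓡 (n₁ + 1)) (𝓡 (n₂ + 1)) (𝓡 (n₁ + n₂ + 1))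
        b a π₁ π₂ π ∧
      -- it carries the induced connection, with curvature `b ω₁ + a ω₂`
      DiffForm.pullback ((𝓡 (n₁ + 1)).prod (𝓡 (n₂ + 1))) (OrbitSpace.mk a b) α
        = DiffForm.weightedSum b a α₁ α₂ ∧
      IsCircleConnection ((𝓡 n₁).prod (𝓡 n₂)) (𝓡 (n₁ + n₂ + 1)) π α
        (DiffForm.weightedSum b a ω₁ ω₂) ∧
      -- which is a contact form as soon as `b ω₁ + a ω₂` is symplectic
      ((DiffForm.weightedSum b a ω₁ ω₂).IsSymplectic → α.IsContactForm) ∧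
      -- comparison with every Boothby–Wang manifold of the product
      ∀ (S : Type*) [TopologicalSpace S] [T2Space S] [SecondCountableTopology S]
        [ChartedSpace (EuclideanSpace ℝ (Fin (n₁ + n₂ + 1))) S]
        [IsManifold (𝓡 (n₁ + n₂ + 1)) ∞ S] [MulAction Circle S] (πS : S → W₁ × W₂),
        IsPrincipalCircleBundle ((𝓡 n₁).prod (𝓡 n₂)) (𝓡 (n₁ + n₂ + 1)) πS →
        IsTensorCircleBundle (𝓡 n₁) (𝓡 n₂) (𝓡 (n₁ + 1)) (𝓡 (n₂ + 1)) (𝓡 (n₁ + n₂ + 1))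
          b a π₁ π₂ πS →
        Nonempty (OrbitSpace a b P₁ P₂ ≃ₘ^∞⟮𝓡 (n₁ + n₂ + 1), 𝓡 (n₁ + n₂ + 1)⟯ S) ∧
        (CompactSpace W₁ → CompactSpace W₂ → ∀ αS : DiffForm (𝓡 (n₁ + n₂ + 1)) S 1,
          IsBoothbyWang ((𝓡 n₁).prod (𝓡 n₂)) (𝓡 (n₁ + n₂ + 1)) πS αS
            (DiffForm.weightedSum b a ω₁ ω₂) →
          DiffForm.Contactomorphic α αS) := by

  refine ⟨fun ha hb => DiffForm.weightedSum_isSymplectic ha hb h₁.symplectic h₂.symplectic, ?_⟩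
  obtain ⟨n, m, hnm⟩ := hab
  have hmn : m * b + n * a = 1 := by linarith
  -- Any linear isomorphism will do; it only moves the product model space to the Euclidean space of
  -- the same dimension.
  let L : ((EuclideanSpace ℝ (Fin n₁) × EuclideanSpace ℝ (Fin n₂)) × EuclideanSpace ℝ (Fin 1)) ≃L[ℝ]
      EuclideanSpace ℝ (Fin (n₁ + n₂ + 1)) := ContinuousLinearEquiv.ofFinrankEq (by simp)
  have hb₁ := h₁.connection.bundle
  have hb₂ := h₂.connection.bundle
  obtain ⟨cs, act, hman, hmk, hsec, hsmul, hbundle⟩ :=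
    OrbitSpace.exists_manifold_structure L hmn hb₁ hb₂
  have h : IsOrbitBundle (𝓡 n₁) (𝓡 n₂) (𝓡 (n₁ + 1)) (𝓡 (n₂ + 1)) (𝓡 (n₁ + n₂ + 1)) m n π₁ π₂
      (OrbitSpace.proj π₁ π₂ : OrbitSpace a b P₁ P₂ → W₁ × W₂) :=
    ⟨hmn, hb₁, hb₂, hmk, hsec, hsmul, OrbitSpace.proj_mk hb₁ hb₂, hbundle⟩
  obtain ⟨α, hα⟩ := h.exists_pullback_mk_eq h₁.connection h₂.connection
  have hconn := h.isCircleConnection hα h₁.connection h₂.connection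
  have hT2 : T2Space (OrbitSpace a b P₁ P₂) := hbundle.t2Space
  have hquot := OrbitSpace.isOpenQuotientMap_mk_of_bundle (a := a) (b := b) hb₁ hb₂
  refine ⟨cs, act, OrbitSpace.proj π₁ π₂, α, hT2,
    hquot.isQuotientMap.secondCountableTopology hquot.isOpenMap, hman, hmk,
    h.mfderiv_mk_surjective, h.proj_mk, h.mk_smul_smul, h.isTensorCircleBundle, hα, hconn,
    hconn.isContactForm, ?_⟩
  intro S _ _ _ _ _ _ πS hS hT
  obtain ⟨Φ, hΦπ, hΦeq⟩ := h.exists_equivariant_diffeomorph hS hT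
  refine ⟨⟨Φ⟩, fun _ _ αS hαS => ?_⟩
  have hcompact : CompactSpace (OrbitSpace a b P₁ P₂) := hbundle.compactSpace
  exact hconn.contactomorphic hαS.symplectic hαS.connection Φ hΦπ hΦeq

end
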